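/- Let $k$ be a field of prime characteristic $p>2$, let $G=\langle g\rangle$ be a cyclic group of finite order $q\ge 1$ with $p\mid q$, and let $R=k\langle x,y\rangle/(x^p,\;y^p,\;yx-xy-\tfrac12x^2)$. The group $G$ acts on $R$ by algebra automorphisms with ${}^gx=x$, ${}^gy=x+y$, and $R\#kG$ denotes the bosonization (as an algebra, the skew group algebra with $gr=({}^gr)g$). The field $k$ is the trivial module over $R$ and $R\#kG$ via $\varepsilon(x)=\varepsilon(y)=0$, $\varepsilon(g)=1$. Put $A=k[x]/(x^p)$, $B=k[y]/(y^p)$ and $[\ell]^{[t]}=\ell(\ell+1)\cdots(\ell+t-1)$. (1) The elements $x^iy^j$ $(0\le i,j<p)$ form a basis of $R$, and $y^rx^\ell=\sum_{t=0}^r\binom rt 2^{-t}[\ell]^{[t]}x^{\ell+t}y^{r-t}$; that is, $R=A\otimes_\tau B$ with $\tau(y^r\otimes x^\ell)=\sum_{t}\binom rt2^{-t}[\ell]^{[t]}x^{\ell+t}\otimes y^{r-t}$. (2) Let $P_\bullet(A)$ be the complex with $P_i(A)=A$ for $i\ge0$ whose differential $P_i(A)\to P_{i-1}(A)$ is multiplication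 by $x$ for $i$ odd and by $x^{p-1}$ for $i$ even, and define $P_\bullet(B)$ likewise with $y$. There is an $R$-module structure on $P_i(A)\otimes P_j(B)=A\otimes B$ in which $x^\ell y^r$ sends $x^m\otimes y^s$ to $\sum_{t=0}^r\binom rt2^{-t}[m+e_i]^{[t]}x^{\ell+m+t}\otimes y^{r-t+s}$, where $e_i=0$ for $i$ even and $e_i=1$ for $i$ odd. With it, $K_\bullet=\mathrm{Tot}(P_\bullet(A)\otimes P_\bullet(B))$, with differential $\sum(d_i\otimes1+(-1)^i1\otimes d_j)$ and augmentation $\varepsilon\otimes\varepsilon$, is a free resolution of $k$ over $R$. The module $K_n$ is free on the elements $\phi_{i,j}=1\otimes1\in P_i(A)\otimes P_j(B)$, $i+j=n$, and (with $\phi_{i,j}=0$ if $i<0$ or $j<0$) \[d(\phi_{i,j})=\begin{cases}x^{p-1}\phi_{i-1,j}+y^{p-1}\phi_{i,j-1}& i,j\text{ even}\\ x^{p-1}\phi_{i-1,j}+y\,\phi_{i,j-1}& i\text{ even},\ j\text{ odd}\\ x\,\phi_{i-1,j}-(y^{p-1}+\frac12xy^{p-2})\phi_{i,j-1}& i\text{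 odd},\ j\text{ even}\\ x\,\phi_{i-1,j}-(y-\frac12x)\phi_{i,j-1}& i,j\text{ odd.}\end{cases}\] (3) Let $\alpha=-y^{p-2}+\sum_{i=1}^{p-2}(-1)^{i+1}\frac{(i+1)!}{2^{i+1}}x^iy^{p-2-i}\in R$. There is a $k$-linear action of $G$ on every $K_n$ with ${}^h(rz)=({}^hr)({}^hz)$ for $h\in G$, $r\in R$, $z\in K_n$, which commutes with the differentials (so that $K_\bullet$ is $G$-equivariant) and satisfies, for all $s\ge0$, \[{}^{g^s}\phi_{i,j}=\begin{cases}\phi_{i,j}\\ \phi_{i,j}+s\,\phi_{i+1,j-1}\\ \phi_{i,j}+\bigl(\sum_{t=0}^{s-1}{}^{g^t}\alpha\bigr)\phi_{i+1,j-1}\end{cases}\qquad {}^{g^{-s}}\phi_{i,j}=\begin{cases}\phi_{i,j}& i\text{ odd}\\ \phi_{i,j}-s\,\phi_{i+1,j-1}& i\text{ even},\ j\text{ odd}\\ \phi_{i,j}-\bigl(\sum_{t=1}^{s}{}^{g^{-t}}\alpha\bigr)\phi_{i+1,j-1}& i,j\text{ even.}\end{cases}\] (The same three cases apply to both formulas.)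 (4) Let $P_\bullet(kG)$ be the complex with $P_l(kG)=kG$ for $l\ge0$ whose differential $P_l(kG)\to P_{l-1}(kG)$ is multiplication by $g-1$ for $l$ odd and by $\sum_{s=0}^{q-1}g^s$ for $l$ even, and let $\phi_l=1\in P_l(kG)$. Let $R\#kG$ act on $K_a\otimes P_b(kG)$ by $(rh)(z\otimes v)=r({}^hz)\otimes hv$ for $r\in R$, $h\in G$. Then $Y_\bullet=\mathrm{Tot}(K_\bullet\otimes P_\bullet(kG))$, with differential $\sum(d_a\otimes1+(-1)^a1\otimes d_b)$ and augmentation $\varepsilon\otimes\varepsilon$, is a free resolution of $k$ over $R\#kG$. The module $Y_n$ is free on the elements $\phi_{i,j,l}=\phi_{i,j}\otimes\phi_l$, $i+j+l=n$, and (with $\phi_{i,j,l}=0$ if an index is negative) \[d(\phi_{i,j,l})=d(\phi_{i,j})\otimes\phi_l+(-1)^{i+j}\bigl(c_l\,\phi_{i,j,l-1}-c_{i,j,l}\,\phi_{i+1,j-1,l-1}\bigr),\] where $c_l=g-1$ for $l$ odd, $c_l=\sum_{s=0}^{q-1}g^s$ for $l$ even, and \[c_{i,j,l}=\begin{cases}0&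 i\text{ odd}\\ g& i\text{ even},\ j,l\text{ odd}\\ \alpha g& i,j\text{ even},\ l\text{ odd}\\ \sum_{s=0}^{q-1}s\,g^s& i,l\text{ even},\ j\text{ odd}\\ \sum_{s=1}^{q-1}\bigl(\sum_{t=0}^{s-1}{}^{g^t}\alpha\bigr)g^s& i,j,l\text{ even;}\end{cases}\] here $d(\phi_{i,j})\otimes\phi_l$ is the formula of (2) with every $\phi_{a,b}$ replaced by $\phi_{a,b,l}$. (5) For each $n$ the space $\mathrm{Hom}_{R\#kG}(Y_n,k)$ has a $k$-basis $\phi^*_{i,j,l}$, $i+j+l=n$, dual to the $\phi_{i,j,l}$. With $d^*(f)=f\circ d$, \[d^*(\phi^*_{i,j,l})=\begin{cases}\phi^*_{i-1,j+1,l+1}& i\text{ odd},\ j,l\text{ even}\\ 0&\text{otherwise.}\end{cases}\] For every $n\ge0$ the kernel of $d^*$ on $\mathrm{Hom}_{R\#kG}(Y_n,k)$ is spanned by the $\phi^*_{i,j,l}$ with $i+j+l=n$ for which it is not the case that $i$ is odd and $j,l$ are even, and the image of $d^*$ in $\mathrm{Hom}_{R\#kG}(Y_{n+1},k)$ is spanned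 by the $\phi^*_{i,j,l}$ with $i+j+l=n+1$, $i$ even and $j,l$ odd. Consequently, as a $k$-vector space, $H^n(R\#kG,k)=\mathrm{Ext}^n_{R\#kG}(k,k)$ is isomorphic to the span of all $\phi^*_{i,j,l}$ with $i+j+l=n$ except, for $n$ even, those with $i$ even and $j,l$ odd, and, for $n$ odd, those with $i$ odd and $j,l$ even. -/

import Mathlib

open scoped TensorProduct

universe u

noncomputable section

namespace JordanBosonization

/-! ### Generic homological notions -/

section Generic

/-- `⋯ → Y 1 → Y 0 → M → 0` is a free resolution of the `S`-module `M`. -/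
structure IsFreeResolution (S : Type*) [Ring S] {M : Type*} [AddCommGroup M] [Module S M]
    (Y : ℕ → Type*) [∀ n, AddCommGroup (Y n)] [∀ n, Module S (Y n)]
    (d : ∀ n, Y (n + 1) →ₗ[S] Y n) (ε : Y 0 →ₗ[S] M) : Prop where
  free : ∀ n, Module.Free S (Y n)
  exact_succ : ∀ n, Function.Exact (d (n + 1)) (d n)
  exact_zero : Function.Exact (d 0) ε
  surjective : Function.Surjective ε

variable (k : Type*) [Field k]

/-- The pairs `(i, j)` of natural numbers with `i + j = n`. -/
abbrev Pairs (n : ℕ) : Type := {ij : ℕ × ℕ // ij.1 + ij.2 = n}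

/-- The triples `(i, j, l)` of natural numbers with `i + j + l = n`. -/
abbrev Triples (n : ℕ) : Type := {t : ℕ × ℕ × ℕ // t.1 + t.2.1 + t.2.2 = n}

section Tot

variable (C D : ℕ → Type*) [∀ i, AddCommGroup (C i)] [∀ i, Module k (C i)]
  [∀ i, AddCommGroup (D i)] [∀ i, Module k (D i)]

/-- Degree `n` of the total complex: the (finite) direct sum of `C i ⊗ D j` over `i + j = n`. -/
abbrev Tot (n : ℕ) : Type _ :=
  (ij : Pairs n) → C ij.1.1 ⊗[k] D ij.1.2

variable {C D}

/-- The differential `∑ (d_i ⊗ 1 + (-1)^i 1 ⊗ d_j)` of the total complex, written through the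
component of the result in `C i ⊗ D j`. -/
def totD (dC : ∀ i, C (i + 1) →ₗ[k] C i) (dD : ∀ j, D (j + 1) →ₗ[k] D j) (n : ℕ) :
    Tot k C D (n + 1) →ₗ[k] Tot k C D n :=
  LinearMap.pi fun ij =>
    (dC ij.1.1).rTensor (D ij.1.2) ∘ₗ
        LinearMap.proj (R := k)
          (φ := fun ab : Pairs (n + 1) => C ab.1.1 ⊗[k] D ab.1.2)
          ⟨(ij.1.1 + 1, ij.1.2), by have := ij.2; dsimp only; omega⟩
      + (-1 : k) ^ ij.1.1 • ((dD ij.1.2).lTensor (C ij.1.1) ∘ₗ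
        LinearMap.proj (R := k)
          (φ := fun ab : Pairs (n + 1) => C ab.1.1 ⊗[k] D ab.1.2)
          ⟨(ij.1.1, ij.1.2 + 1), by have := ij.2; dsimp only; omega⟩)

/-- The augmentation `ε ⊗ ε` of the total complex. -/
def totAug (εC : C 0 →ₗ[k] k) (εD : D 0 →ₗ[k] k) : Tot k C D 0 →ₗ[k] k :=
  LinearMap.mul' k k ∘ₗ TensorProduct.map εC εD ∘ₗ
    LinearMap.proj (R := k)
      (φ := fun ab : Pairs 0 => C ab.1.1 ⊗[k] D ab.1.2) ⟨(0, 0), rfl⟩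

end Tot

/-- A `G`-equivariant structure on a complex `(C, d)` of modules over an algebra `R` on which the
group `G` acts: `k`-linear actions of `G` on all `C n` with `ᵍ(r z) = (ᵍr) (ᵍz)` that commute
with the differentials. -/
structure EquivariantAction (R : Type*) [Ring R] (G : Type*) [Group G] [MulSemiringAction G R]
    (C : ℕ → Type*) [∀ n, AddCommGroup (C n)] [∀ n, Module k (C n)] [∀ n, Module R (C n)]
    (d : ∀ n, C (n + 1) →ₗ[k] C n) where
  rho : ∀ n, Representation k G (C n)
  semilinear : ∀ n (h : G) (r : R) (z : C n), rho n h (r • z) = (h • r) • rho n h z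
  comm_d : ∀ n (h : G) (z : C (n + 1)), d n (rho (n + 1) h z) = rho n h (d n z)

/-- The map `f ↦ f ∘ d` on modules of homomorphisms into `T`. -/
def coboundary {S : Type*} [Ring S] {M N : Type*} (T : Type*) [AddCommGroup M] [Module S M]
    [AddCommGroup N] [Module S N] [AddCommGroup T] [Module S T] [Module k T] [SMulCommClass S k T]
    (d : M →ₗ[S] N) : (N →ₗ[S] T) →ₗ[k] (M →ₗ[S] T) where
  toFun f := f.comp d
  map_add' _ _ := rfl
  map_smul' _ _ := rfl

end Generic

variable (k : Type u) [Field k] (p q : ℕ)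

/-! ### The algebra `R`, the group `G` and the bosonization -/

open FreeAlgebra in
/-- The relations `x ^ p = 0`, `y ^ p = 0`, `y x = x y + x ^ 2 / 2` (here `x = ι 0`, `y = ι 1`). -/
inductive Rel : FreeAlgebra k (Fin 2) → FreeAlgebra k (Fin 2) → Prop
  | x_pow : Rel (ι k 0 ^ p) 0
  | y_pow : Rel (ι k 1 ^ p) 0
  | comm : Rel (ι k 1 * ι k 0) (ι k 0 * ι k 1 + (2⁻¹ : k) • ι k 0 ^ 2)

/-- `R = k⟨x, y⟩ / (x ^ p, y ^ p, y x - x y - x ^ 2 / 2)`. -/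
def R : Type u := RingQuot (Rel k p)

instance : Ring (R k p) := inferInstanceAs (Ring (RingQuot (Rel k p)))
instance : Algebra k (R k p) := inferInstanceAs (Algebra k (RingQuot (Rel k p)))

/-- The projection of the free algebra onto `R`. -/
def toR : FreeAlgebra k (Fin 2) →ₐ[k] R k p := RingQuot.mkAlgHom k (Rel k p)

variable {k p} in
theorem toR_rel {a b : FreeAlgebra k (Fin 2)} (h : Rel k p a b) : toR k p a = toR k p b :=
  RingQuot.mkAlgHom_rel k h

/-- The generator `x` of `R`. -/
def x : R k p := toR k p (FreeAlgebra.ι k 0)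

/-- The generator `y` of `R`. -/
def y : R k p := toR k p (FreeAlgebra.ι k 1)

theorem x_pow : x k p ^ p = 0 := by
  simpa [x] using toR_rel (Rel.x_pow (k := k) (p := p))

theorem y_pow : y k p ^ p = 0 := by
  simpa [y] using toR_rel (Rel.y_pow (k := k) (p := p))

theorem y_mul_x : y k p * x k p = x k p * y k p + (2⁻¹ : k) • x k p ^ 2 := by
  simpa [x, y] using toR_rel (Rel.comm (k := k) (p := p))

/-- The algebra homomorphism out of `R` with prescribed images of `x` and `y`. -/
def lift {E : Type*} [Ring E] [Algebra k E] (a b : E) (ha : a ^ p = 0) (hb : b ^ p = 0)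
    (hab : b * a = a * b + (2⁻¹ : k) • a ^ 2) : R k p →ₐ[k] E :=
  RingQuot.liftAlgHom k (s := Rel k p) ⟨FreeAlgebra.lift k ![a, b], by
    rintro _ _ (_ | _ | _) <;> simp [ha, hb, hab]⟩

section lift

variable {E : Type*} [Ring E] [Algebra k E] (a b : E) (ha : a ^ p = 0) (hb : b ^ p = 0)
    (hab : b * a = a * b + (2⁻¹ : k) • a ^ 2)

theorem lift_x : lift k p a b ha hb hab (x k p) = a :=
  (RingQuot.liftAlgHom_mkAlgHom_apply k _ _ _).trans (by simp)

theorem lift_y : lift k p a b ha hb hab (y k p) = b :=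
  (RingQuot.liftAlgHom_mkAlgHom_apply k _ _ _).trans (by simp)

variable {k p} in
theorem hom_ext {f f' : R k p →ₐ[k] E} (hx : f (x k p) = f' (x k p))
    (hy : f (y k p) = f' (y k p)) : f = f' := by
  refine RingQuot.ringQuot_ext' (S := k) (s := Rel k p) f f' ?_
  apply FreeAlgebra.hom_ext
  funext i
  fin_cases i
  · exact hx
  · exact hy

end lift

theorem add_pow_of_commute [Fact p.Prime] [CharP k p] {E : Type*} [Ring E] [Algebra k E]
    {a b : E} (h : Commute a b) : (a + b) ^ p = a ^ p + b ^ p := by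
  obtain ⟨r, hr⟩ := h.exists_add_pow_prime_eq (Fact.out : p.Prime)
  have : (p : E) = 0 := by
    rw [← map_natCast (algebraMap k E), CharP.cast_eq_zero, map_zero]
  rw [hr, this]; simp

theorem y_mul_x_pow (n : ℕ) :
    y k p * x k p ^ n = x k p ^ n * y k p + ((n : k) * 2⁻¹) • x k p ^ (n + 1) := by
  induction n with
  | zero => simp
  | succ n ih =>
    rw [pow_succ, ← mul_assoc, ih, add_mul, mul_assoc, y_mul_x, mul_add]
    simp only [smul_mul_assoc, mul_smul_comm, ← pow_succ, ← pow_add, Nat.cast_succ,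
      add_mul, add_smul, one_mul]
    rw [show x k p ^ n * (x k p * y k p) = x k p ^ (n + 1) * y k p by rw [pow_succ, mul_assoc]]
    abel

theorem add_smul_pow [Fact p.Prime] [CharP k p] (c : k) : (y k p + c • x k p) ^ p = 0 := by
  set r : Module.End k (R k p) := LinearMap.mulRight k (y k p) with hr
  set a : Module.End k (R k p) := LinearMap.mulLeft k (y k p + c • x k p) - r with hadef
  have hl : Commute (LinearMap.mulLeft k (y k p + c • x k p) : Module.End k (R k p)) r :=
    LinearMap.commute_mulLeft_right _ _
  have hc : Commute a r := by
    rw [hadef]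
    exact Commute.sub_left hl (Commute.refl r)
  have h1 : ∀ n : ℕ, ∃ γ : k, (a ^ n) 1 = γ • x k p ^ n := by
    intro n
    induction n with
    | zero => exact ⟨1, by simp⟩
    | succ n ih =>
      obtain ⟨γ, hγ⟩ := ih
      refine ⟨γ * (n * 2⁻¹ + c), ?_⟩
      rw [pow_succ', Module.End.mul_apply, hγ, map_smul, mul_smul]
      congr 1
      simp only [hadef, r, LinearMap.sub_apply, LinearMap.mulLeft_apply, LinearMap.mulRight_apply,
        add_mul, y_mul_x_pow, smul_mul_assoc, ← pow_succ', add_smul]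
      abel
  have h2 := congrArg (fun f => f 1) (add_pow_of_commute k p hc)
  obtain ⟨γ, hγ⟩ := h1 p
  have h3 : a + r = LinearMap.mulLeft k (y k p + c • x k p) := by simp [hadef]
  simp only [h3, LinearMap.add_apply, hγ, r, LinearMap.pow_mulLeft, LinearMap.pow_mulRight,
    LinearMap.mulLeft_apply, LinearMap.mulRight_apply, mul_one, one_mul, x_pow, y_pow,
    smul_zero, add_zero] at h2
  exact h2

/-- The endomorphism `x ↦ x`, `y ↦ y + c x` of `R`. -/
def sigma [Fact p.Prime] [CharP k p] (c : k) : R k p →ₐ[k] R k p :=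
  lift k p (x k p) (y k p + c • x k p) (x_pow k p) (add_smul_pow k p c) (by
    simp only [add_mul, mul_add, y_mul_x, smul_mul_assoc, mul_smul_comm]
    abel)

theorem sigma_zero [Fact p.Prime] [CharP k p] : sigma k p 0 = AlgHom.id k (R k p) := by
  apply hom_ext <;> simp [sigma, lift_x, lift_y]

theorem sigma_add [Fact p.Prime] [CharP k p] (c c' : k) :
    sigma k p (c + c') = (sigma k p c).comp (sigma k p c') := by
  apply hom_ext
  · simp [sigma, lift_x]
  · simp [sigma, lift_x, lift_y, add_smul]
    abel

/-- The cyclic group of order `q`. -/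
abbrev G : Type := Multiplicative (ZMod q)

/-- The generator `g` of `G`. -/
def g : G q := Multiplicative.ofAdd 1

/-- The action of `G` on `R` by algebra automorphisms with `ᵍx = x`, `ᵍy = x + y`; thus
`g ^ s` acts by `x ↦ x`, `y ↦ y + s x`, which only depends on `s` modulo `q` because the
characteristic `p` divides `q`. -/
instance [Fact p.Prime] [CharP k p] [Fact (p ∣ q)] : MulSemiringAction (G q) (R k p) where
  smul h r := sigma k p (ZMod.castHom (Fact.out : p ∣ q) k h.toAdd) r
  one_smul r := by
    change sigma k p (ZMod.castHom (Fact.out : p ∣ q) k 0) r = r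
    rw [map_zero, sigma_zero]; rfl
  mul_smul h h' r := by
    change sigma k p (ZMod.castHom (Fact.out : p ∣ q) k (h.toAdd + h'.toAdd)) r = _
    rw [map_add, sigma_add]; rfl
  smul_zero h := map_zero (sigma k p _)
  smul_add h := map_add (sigma k p _)
  smul_one h := map_one (sigma k p _)
  smul_mul h := map_mul (sigma k p _)

instance [Fact p.Prime] [CharP k p] [Fact (p ∣ q)] : SMulCommClass (G q) k (R k p) where
  smul_comm _ c r := map_smul (sigma k p _) c r

/-- The bosonization `R # kG`; as an algebra it is the skew group algebra of `G` over `R`, with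
`g r = (ᵍr) g`. -/
abbrev Bos [Fact p.Prime] [CharP k p] [Fact (p ∣ q)] : Type u := SkewMonoidAlgebra (R k p) (G q)

section elements

variable [Fact p.Prime] [CharP k p] [Fact (p ∣ q)]

/-- `r ∈ R` as an element of `R # kG`. -/
def ofR (r : R k p) : Bos k p q := SkewMonoidAlgebra.single 1 r

/-- `h ∈ G` as an element of `R # kG`. -/
def ofG (h : G q) : Bos k p q := SkewMonoidAlgebra.single h 1

end elements

/-! ### Trivial modules -/

/-- The augmentation `ε(x) = ε(y) = 0` of `R`. -/
def augR (hp : p ≠ 0) : R k p →ₐ[k] k := lift k p 0 0 (zero_pow hp) (zero_pow hp) (by simp)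

/-- The augmentation `ε(x) = ε(y) = 0`, `ε(g) = 1` of `R # kG`. -/
def augBos [Fact p.Prime] [CharP k p] [Fact (p ∣ q)] : Bos k p q →ₐ[k] k :=
  SkewMonoidAlgebra.liftNCAlgHom (augR k p (Fact.out : p.Prime).ne_zero) (1 : G q →* k) (by
    intro r h
    simp only [MonoidHom.one_apply, mul_one, one_mul]
    change (augR k p _).comp (sigma k p _) r = _
    congr 1
    apply hom_ext <;> simp [augR, sigma, lift_x, lift_y])

/-- The field `k`, as the trivial module over `R` and over `R # kG`. -/
def Triv : Type u := k

instance : AddCommGroup (Triv k) := inferInstanceAs (AddCommGroup k)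
instance : Module k (Triv k) := inferInstanceAs (Module k k)

/-- `k` as the underlying space of the trivial module. -/
def toTriv : k ≃ₗ[k] Triv k := LinearEquiv.refl k k

instance [Fact p.Prime] : Module (R k p) (Triv k) :=
  Module.compHom (Triv k) (augR k p (Fact.out : p.Prime).ne_zero).toRingHom

instance [Fact p.Prime] [CharP k p] [Fact (p ∣ q)] : Module (Bos k p q) (Triv k) :=
  Module.compHom (Triv k) (augBos k p q).toRingHom

instance [Fact p.Prime] [CharP k p] [Fact (p ∣ q)] : SMulCommClass (Bos k p q) k (Triv k) where
  smul_comm s c t := smul_comm (augBos k p q s) c t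

/-! ### The resolution `K = Tot(P(A) ⊗ P(B))` over `R` -/

/-- The truncated polynomial algebra `k[t]/(t ^ p)`; both `A = k[x]/(x ^ p)` and
`B = k[y]/(y ^ p)` are copies of it. -/
abbrev Trunc : Type u := AdjoinRoot (Polynomial.X ^ p : Polynomial k)

/-- The class `t` of the variable in `k[t]/(t ^ p)`. -/
abbrev root : Trunc k p := AdjoinRoot.root (Polynomial.X ^ p : Polynomial k)

/-- The augmentation `t ↦ 0` of `k[t]/(t ^ p)`. -/
def augTrunc [Fact p.Prime] : Trunc k p →ₐ[k] k :=
  AdjoinRoot.liftAlgHom _ (Algebra.ofId k k) 0 (by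
    simp [(Fact.out : p.Prime).ne_zero])

/-- The differential from degree `i + 1` to degree `i` of the periodic resolution of `k` over
`k[t]/(t ^ p)`: multiplication by `t` if `i + 1` is odd, by `t ^ (p - 1)` if `i + 1` is even. -/
def dTrunc (i : ℕ) : Trunc k p →ₗ[k] Trunc k p :=
  LinearMap.mulLeft k (if Odd (i + 1) then root k p else root k p ^ (p - 1))

/-- `P_i(A)`. -/
def PA (_i : ℕ) : Type u := Trunc k p

/-- `P_j(B)`. -/
def PB (_j : ℕ) : Type u := Trunc k p

instance (i : ℕ) : AddCommGroup (PA k p i) := inferInstanceAs (AddCommGroup (Trunc k p))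
instance (i : ℕ) : Module k (PA k p i) := inferInstanceAs (Module k (Trunc k p))
instance (j : ℕ) : AddCommGroup (PB k p j) := inferInstanceAs (AddCommGroup (Trunc k p))
instance (j : ℕ) : Module k (PB k p j) := inferInstanceAs (Module k (Trunc k p))

/-- The element `x ^ m` of `P_i(A) = A`. -/
def xPow (i m : ℕ) : PA k p i := root k p ^ m

/-- The element `y ^ m` of `P_j(B) = B`. -/
def yPow (j m : ℕ) : PB k p j := root k p ^ m

/-- The differential of `P(A)`. -/
def dA (i : ℕ) : PA k p (i + 1) →ₗ[k] PA k p i := dTrunc k p i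

/-- The differential of `P(B)`. -/
def dB (j : ℕ) : PB k p (j + 1) →ₗ[k] PB k p j := dTrunc k p j

/-- The operator `f ↦ (t ^ 2 f' + e t f) / 2` on polynomials; it maps `t ^ m` to
`((m + e) / 2) t ^ (m + 1)`. -/
def polyOp (e : ℕ) : Polynomial k →ₗ[k] Polynomial k :=
  (2⁻¹ : k) • (LinearMap.mulLeft k (Polynomial.X ^ 2) ∘ₗ Polynomial.derivative
    + (e : k) • LinearMap.mulLeft k Polynomial.X)

theorem polyOp_mul (e : ℕ) (f h : Polynomial k) :
    polyOp k e (f * h) = polyOp k 0 f * h + f * polyOp k e h := by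
  simp only [polyOp, LinearMap.smul_apply, LinearMap.add_apply, LinearMap.comp_apply,
    LinearMap.mulLeft_apply, Polynomial.derivative_mul, Nat.cast_zero, zero_smul, add_zero,
    Polynomial.smul_eq_C_mul]
  ring

theorem dvd_polyOp_zero_X_pow (n : ℕ) :
    (Polynomial.X : Polynomial k) ^ (n + 1) ∣ polyOp k 0 (Polynomial.X ^ n) := by
  cases n with
  | zero => simp [polyOp]
  | succ n =>
    refine ⟨Polynomial.C (2⁻¹ * ((n : k) + 1)), ?_⟩
    simp [polyOp, Polynomial.smul_eq_C_mul]
    ring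

theorem dvd_polyOp (e n : ℕ) (f : Polynomial k) (hf : Polynomial.X ^ n ∣ f) :
    Polynomial.X ^ n ∣ polyOp k e f := by
  obtain ⟨h, rfl⟩ := hf
  rw [polyOp_mul]
  exact dvd_add (((pow_dvd_pow _ n.le_succ).trans (dvd_polyOp_zero_X_pow k n)).mul_right _)
    (dvd_mul_right _ _)

/-- The operator on `k[t]/(t ^ p)` that maps `t ^ m` to `((m + e) / 2) t ^ (m + 1)`. -/
def shiftOp (e : ℕ) : Trunc k p →ₗ[k] Trunc k p where
  toFun := Quotient.lift (fun f => AdjoinRoot.mk _ (polyOp k e f)) (by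
    intro f h hfh
    rw [AdjoinRoot.mk_eq_mk, ← map_sub]
    apply dvd_polyOp
    have := (Submodule.quotientRel_def _).1 hfh
    exact Ideal.mem_span_singleton.1 this)
  map_add' a b := by
    obtain ⟨a, rfl⟩ := AdjoinRoot.mk_surjective a
    obtain ⟨b, rfl⟩ := AdjoinRoot.mk_surjective b
    change AdjoinRoot.mk _ (polyOp k e (a + b)) = _
    rw [map_add, map_add]; rfl
  map_smul' c a := by
    obtain ⟨a, rfl⟩ := AdjoinRoot.mk_surjective a
    change AdjoinRoot.mk _ (polyOp k e (c • a)) = _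
    rw [map_smul, ← AdjoinRoot.smul_mk]; rfl

theorem shiftOp_mk (e : ℕ) (f : Polynomial k) :
    shiftOp k p e (AdjoinRoot.mk _ f) = AdjoinRoot.mk _ (polyOp k e f) := rfl

theorem shiftOp_pow_eq_zero (e : ℕ) : shiftOp k p e ^ p = 0 := by
  have key : ∀ (n : ℕ) (f : Polynomial k), ∃ h : Polynomial k, Polynomial.X ^ n ∣ h ∧
      (shiftOp k p e ^ n) (AdjoinRoot.mk _ f) = AdjoinRoot.mk _ h := by
    intro n f
    induction n with
    | zero => exact ⟨f, by simp, rfl⟩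
    | succ n ih =>
      obtain ⟨_, ⟨h, rfl⟩, hh⟩ := ih
      refine ⟨_, ?_, by rw [pow_succ', Module.End.mul_apply, hh, shiftOp_mk]⟩
      rw [polyOp_mul]
      refine dvd_add ((dvd_polyOp_zero_X_pow k n).mul_right _) ?_
      rw [pow_succ]
      refine mul_dvd_mul_left _ ⟨Polynomial.C 2⁻¹ * (Polynomial.X * Polynomial.derivative h
        + (e : Polynomial k) * h), ?_⟩
      simp [polyOp, Polynomial.smul_eq_C_mul]
      ring
  ext a
  obtain ⟨f, rfl⟩ := AdjoinRoot.mk_surjective a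
  obtain ⟨h, hd, hh⟩ := key p f
  rw [hh, LinearMap.zero_apply, AdjoinRoot.mk_eq_zero]
  exact hd

theorem shiftOp_mul_root (e : ℕ) (a : Trunc k p) :
    shiftOp k p e (root k p * a) =
      root k p * shiftOp k p e a + (2⁻¹ : k) • (root k p * (root k p * a)) := by
  obtain ⟨f, rfl⟩ := AdjoinRoot.mk_surjective a
  rw [shiftOp_mk, root, AdjoinRoot.root, ← map_mul, shiftOp_mk, ← map_mul, ← map_mul,
    AdjoinRoot.smul_mk, ← map_add, polyOp_mul]
  congr 1
  simp [polyOp, Polynomial.smul_eq_C_mul]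
  ring

theorem root_pow : root k p ^ p = 0 := by
  rw [root, AdjoinRoot.root, ← map_pow, AdjoinRoot.mk_self]

/-- Multiplication by `x` on `P_i(A) = A`. -/
def xMul (i : ℕ) : Module.End k (PA k p i) := LinearMap.mulLeft k (root k p)

/-- Multiplication by `y` on `P_j(B) = B`. -/
def yMul (j : ℕ) : Module.End k (PB k p j) := LinearMap.mulLeft k (root k p)

/-- The operator on `P_i(A) = A` that maps `x ^ m` to `(m / 2) x ^ (m + 1)` if `i` is even, and to
`((m + 1) / 2) x ^ (m + 1)` if `i` is odd. -/
def delta (i : ℕ) : Module.End k (PA k p i) := shiftOp k p (i % 2)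

theorem xMul_pow (i : ℕ) : xMul k p i ^ p = 0 := by
  change (LinearMap.mulLeft k (root k p)) ^ p = 0
  rw [LinearMap.pow_mulLeft, root_pow, LinearMap.mulLeft_zero_eq_zero]

theorem yMul_pow (j : ℕ) : yMul k p j ^ p = 0 := by
  change (LinearMap.mulLeft k (root k p)) ^ p = 0
  rw [LinearMap.pow_mulLeft, root_pow, LinearMap.mulLeft_zero_eq_zero]

theorem delta_pow (i : ℕ) : delta k p i ^ p = 0 := shiftOp_pow_eq_zero k p (i % 2)

theorem delta_mul_xMul (i : ℕ) :
    delta k p i * xMul k p i = xMul k p i * delta k p i + (2⁻¹ : k) • xMul k p i ^ 2 := by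
  apply LinearMap.ext
  intro a
  have h := shiftOp_mul_root k p (i % 2) a
  rw [pow_two]
  exact h

/-- The action of `x` on `P_i(A) ⊗ P_j(B) = A ⊗ B`. -/
def xAct (i j : ℕ) : Module.End k (PA k p i ⊗[k] PB k p j) := (xMul k p i).rTensor (PB k p j)

/-- The action of `y` on `P_i(A) ⊗ P_j(B) = A ⊗ B`, that is `a ⊗ b ↦ τ_i(y ⊗ a) (1 ⊗ b)`, where
`τ_i(y ⊗ x ^ m) = x ^ m ⊗ y + (m / 2) x ^ (m + 1) ⊗ 1` if `i` is even and
`τ_i(y ⊗ x ^ m) = x ^ m ⊗ y + ((m + 1) / 2) x ^ (m + 1) ⊗ 1` if `i` is odd. -/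
def yAct (i j : ℕ) : Module.End k (PA k p i ⊗[k] PB k p j) :=
  (yMul k p j).lTensor (PA k p i) + (delta k p i).rTensor (PB k p j)

/-- The `R`-module structure of `P_i(A) ⊗ P_j(B)`, as a homomorphism of algebras. -/
def actHom [Fact p.Prime] [CharP k p] (i j : ℕ) :
    R k p →ₐ[k] Module.End k (PA k p i ⊗[k] PB k p j) :=
  lift k p (xAct k p i j) (yAct k p i j)
    (by rw [xAct, LinearMap.rTensor_pow, xMul_pow, LinearMap.rTensor_zero])
    (by
      have hc : Commute ((yMul k p j).lTensor (PA k p i)) ((delta k p i).rTensor (PB k p j)) := by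
        change LinearMap.comp _ _ = LinearMap.comp _ _
        rw [LinearMap.lTensor_comp_rTensor, LinearMap.rTensor_comp_lTensor]
      rw [yAct, add_pow_of_commute k p hc, LinearMap.rTensor_pow, LinearMap.lTensor_pow,
        yMul_pow, delta_pow, LinearMap.rTensor_zero, LinearMap.lTensor_zero, add_zero])
    (by
      have hc : Commute ((yMul k p j).lTensor (PA k p i)) ((xMul k p i).rTensor (PB k p j)) := by
        change LinearMap.comp _ _ = LinearMap.comp _ _
        rw [LinearMap.lTensor_comp_rTensor, LinearMap.rTensor_comp_lTensor]
      rw [yAct, xAct, add_mul, mul_add, hc.eq, ← LinearMap.rTensor_mul, delta_mul_xMul,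
        LinearMap.rTensor_add, LinearMap.rTensor_smul, LinearMap.rTensor_mul, LinearMap.rTensor_pow,
        add_assoc])

instance [Fact p.Prime] [CharP k p] (i j : ℕ) : Module (R k p) (PA k p i ⊗[k] PB k p j) :=
  Module.compHom _ (actHom k p i j).toRingHom

instance [Fact p.Prime] [CharP k p] (i j : ℕ) :
    IsScalarTower k (R k p) (PA k p i ⊗[k] PB k p j) where
  smul_assoc c r z := by
    change actHom k p i j (c • r) z = c • actHom k p i j r z
    rw [map_smul]; rfl

/-- `K_n = ⨁_{i + j = n} P_i(A) ⊗ P_j(B)`, a module over `R` through the `R`-module structures of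
the summands. -/
abbrev K (n : ℕ) : Type u := Tot k (PA k p) (PB k p) n

/-- The differential of `K`. -/
def dK (n : ℕ) : K k p (n + 1) →ₗ[k] K k p n := totD k (dA k p) (dB k p) n

/-- The augmentation of `K`. -/
def augK [Fact p.Prime] : K k p 0 →ₗ[k] k :=
  totAug k (C := PA k p) (D := PB k p) (augTrunc k p).toLinearMap (augTrunc k p).toLinearMap

/-- The generator `φ_{i,j} = 1 ⊗ 1` of `P_i(A) ⊗ P_j(B)`, as an element of `K_n` where `n = i + j`.
It is `0` if `i` or `j` is negative. -/
def phi (n : ℕ) (i j : ℤ) : K k p n := fun ab =>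
  if (ab.1.1 : ℤ) = i ∧ (ab.1.2 : ℤ) = j then xPow k p ab.1.1 0 ⊗ₜ yPow k p ab.1.2 0 else 0

/-- The coefficient of `φ_{i-1,j}` in `d(φ_{i,j})`. -/
def coeffX (i : ℕ) : R k p := if Even i then x k p ^ (p - 1) else x k p

/-- The coefficient of `φ_{i,j-1}` in `d(φ_{i,j})`. -/
def coeffY (i j : ℕ) : R k p :=
  if Even i then (if Even j then y k p ^ (p - 1) else y k p)
  else if Even j then -(y k p ^ (p - 1) + (2⁻¹ : k) • (x k p * y k p ^ (p - 2)))
  else -(y k p - (2⁻¹ : k) • x k p)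

/-- The element
`α = -y^{p-2} + ∑_{i=1}^{p-2} (-1)^{i+1} ((i+1)! / 2^{i+1}) x^i y^{p-2-i}` of `R`. -/
def alpha : R k p :=
  -y k p ^ (p - 2) + ∑ i ∈ Finset.Icc 1 (p - 2),
    ((-1 : k) ^ (i + 1) * ((i + 1).factorial : k) / 2 ^ (i + 1)) •
      (x k p ^ i * y k p ^ (p - 2 - i))

/-! ### The complex `Y = Tot(K ⊗ P(kG))` over `R # kG` -/

/-- `P_l(kG)`. -/
def PG (_l : ℕ) : Type u := MonoidAlgebra k (G q)

instance (l : ℕ) : AddCommGroup (PG k q l) := inferInstanceAs (AddCommGroup (MonoidAlgebra k (G q)))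
instance (l : ℕ) : Module k (PG k q l) := inferInstanceAs (Module k (MonoidAlgebra k (G q)))

/-- The free generator `φ_l = 1` of `P_l(kG) = kG`. -/
def genPG (l : ℕ) : PG k q l := (1 : MonoidAlgebra k (G q))

/-- The differential from degree `l + 1` to degree `l` of `P(kG)`: multiplication by `g - 1` if
`l + 1` is odd, by `∑_{s < q} g ^ s` if `l + 1` is even. -/
def dG (l : ℕ) : PG k q (l + 1) →ₗ[k] PG k q l :=
  LinearMap.mulLeft k (if Odd (l + 1) then MonoidAlgebra.of k (G q) (g q) - 1
    else ∑ s ∈ Finset.range q, MonoidAlgebra.of k (G q) (g q ^ s))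

/-- The augmentation `g ↦ 1` of `kG`. -/
def augG : PG k q 0 →ₗ[k] k := (MonoidAlgebra.lift k k (G q) (1 : G q →* k)).toLinearMap

/-- The left regular action of `G` on `P_l(kG) = kG`. -/
def regG (l : ℕ) : Representation k (G q) (PG k q l) :=
  MonoidHom.comp
    ((Algebra.lmul k (MonoidAlgebra k (G q))).toRingHom.toMonoidHom :
      MonoidAlgebra k (G q) →* Module.End k (MonoidAlgebra k (G q)))
    (MonoidAlgebra.of k (G q))

section Y

variable {k p q} [Fact p.Prime] [CharP k p] [Fact (p ∣ q)]

/-- The summand `K_a ⊗ P_b(kG)` of `Y`, with the `R # kG`-module structure that comes from the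
`G`-action `E` on `K`. -/
def YSummand (_E : EquivariantAction k (R k p) (G q) (K k p) (dK k p)) (a b : ℕ) : Type u :=
  K k p a ⊗[k] PG k q b

variable (E : EquivariantAction k (R k p) (G q) (K k p) (dK k p))

instance (a b : ℕ) : AddCommGroup (YSummand E a b) :=
  inferInstanceAs (AddCommGroup (K k p a ⊗[k] PG k q b))
instance (a b : ℕ) : Module k (YSummand E a b) :=
  inferInstanceAs (Module k (K k p a ⊗[k] PG k q b))

/-- The twisted action `(r h) (z ⊗ v) = r (ʰz) ⊗ h v` of `R # kG` on `K_a ⊗ P_b(kG)`. -/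
def smashHom (a b : ℕ) : Bos k p q →ₐ[k] Module.End k (K k p a ⊗[k] PG k q b) :=
  SkewMonoidAlgebra.liftNCAlgHom
    ((Module.End.rTensorAlgHom k (K k p a) (PG k q b)).comp (Algebra.lsmul k k (K k p a)))
    ((E.rho a).tprod (regG k q b)) (by
      intro r h
      apply TensorProduct.ext'
      intro z v
      change (((h • r) • E.rho a h z) ⊗ₜ[k] regG k q b h v) = E.rho a h (r • z) ⊗ₜ regG k q b h v
      rw [E.semilinear])

instance (a b : ℕ) : Module (Bos k p q) (YSummand E a b) :=
  (Module.compHom (K k p a ⊗[k] PG k q b) (smashHom E a b).toRingHom :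
    Module (Bos k p q) (K k p a ⊗[k] PG k q b))

/-- `Y_n = ⨁_{a + b = n} K_a ⊗ P_b(kG)`, as a module over `R # kG`; its underlying vector space is
degree `n` of the total complex of `K` and `P(kG)`. -/
abbrev Y (n : ℕ) : Type u := (ab : Pairs n) → YSummand E ab.1.1 ab.1.2

/-- The differential of the total complex `Y`. -/
def dY (n : ℕ) : Y E (n + 1) →ₗ[k] Y E n := totD k (dK k p) (dG k q) n

/-- The augmentation of `Y`. -/
def augY : Y E 0 →ₗ[k] k := totAug k (C := K k p) (D := PG k q) (augK k p) (augG k q)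

/-- The generator `φ_{i,j,l} = φ_{i,j} ⊗ φ_l` of `K_{i+j} ⊗ P_l(kG)`, as an element of `Y_n` where
`n = i + j + l`. It is `0` if one of `i`, `j`, `l` is negative. -/
def phi3 (n : ℕ) (i j l : ℤ) : Y E n := fun ab =>
  if (ab.1.2 : ℤ) = l then
    (phi k p ab.1.1 i j ⊗ₜ[k] genPG k q ab.1.2 : K k p ab.1.1 ⊗[k] PG k q ab.1.2)
  else 0

variable (k p q)

/-- The coefficient of `φ_{i,j,l-1}` in `(-1)^{i+j} d(φ_{i,j,l})`. -/
def coeffG (l : ℕ) : Bos k p q :=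
  if Odd l then ofG k p q (g q) - 1 else ∑ s ∈ Finset.range q, ofG k p q (g q ^ s)

/-- The coefficient of `-φ_{i+1,j-1,l-1}` in `(-1)^{i+j} d(φ_{i,j,l})`. -/
def coeffTwist (i j l : ℕ) : Bos k p q :=
  if Odd i then 0
  else if Odd l then
    (if Odd j then ofG k p q (g q) else ofR k p q (alpha k p) * ofG k p q (g q))
  else
    (if Odd j then ∑ s ∈ Finset.range q, (s : k) • ofG k p q (g q ^ s)
    else ∑ s ∈ Finset.Ico 1 q,
      ofR k p q (∑ t ∈ Finset.range s, g q ^ t • alpha k p) * ofG k p q (g q ^ s))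

end Y

/-- `H^n(R # kG, k) = Ext^n_{R # kG}(k, k)`. -/
abbrev H [Fact p.Prime] [CharP k p] [Fact (p ∣ q)] (n : ℕ) : ModuleCat k :=
  ((Ext k (ModuleCat.{u} (Bos k p q)) n).obj
    (Opposite.op (ModuleCat.of (Bos k p q) (Triv k)))).obj (ModuleCat.of (Bos k p q) (Triv k))

end JordanBosonization

end

open JordanBosonization

/-! Forgetting the module structures, `K` is the tensor product of two periodic resolutions of `k`,
and `Y` is the tensor product of `K` with a third. Over a field such products are exact by the
Künneth theorem (`IsAcyclic.tot`), so the twisting of the actions does not enter into exactness. It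
enters in freeness and in linearity of the differentials. The summand `P_i(A) ⊗ P_j(B)` is generated
by `1 ⊗ 1`, because `y` raises the power of `y` up to terms already reached, and it has the
dimension `p ^ 2` of `R` (`toSpanSingleton_gen_bijective`). The parity shift in the action of `y` is
exactly what makes it commute with the differential of `P(A)` (`dTrunc_shiftOp`). Over `R # kG`,
freeness of `K_a ⊗ kG` comes from `z ⊗ h = h (h⁻¹ z ⊗ 1)`.

The main content is the `G`-action on `K`. The generator `g` is prescribed on the basis by `φ_{i,j}
↦ φ_{i,j} + c φ_{i+1,j-1}` and extended semilinearly. Here `c = 0` for odd `i`, so the correction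
terms are themselves fixed and powers of `g` merely add up translates of `c`. Commutation with the
differential reduces to identities for `x α`, `α x`, `(y + x) α` and `α (y - x / 2)`. All of them
rest on one expansion (`add_smul_pow_mul_x_pow`): left multiplication by `y + c x` is the sum of two
commuting operators, right multiplication by `y` and an operator that sends `x ^ l` to a multiple of
`x ^ (l + 1)`. The relation `g ^ q = 1` holds on `K` because the translates of `α` sum to zero
(`sum_sigma_alpha`): the coefficients are polynomials of degree below `p - 1` in the exponent of
`g`, and their sums over the prime field vanish.

For cohomology, a homomorphism into `k` sees only the augmentations of the coefficients of `d`. They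
all vanish, except that the twist coefficient `g`, for `i` even and `j`, `l` odd, has augmentation
`1`; its companion `∑ s g ^ s` dies since `∑ s = 0` for `p > 2`. Hence `d^*` maps some dual basis
vectors injectively to dual basis vectors and kills the others. A parity count shows that in even
degrees every cochain is a cocycle, while in odd degrees every coboundary is zero. -/

noncomputable section

namespace JordanBosonization

set_option linter.unusedSectionVars false

/-! ### Commutation formulas in `R` and the identities satisfied by `α` -/

section Algebra

variable (k : Type u) [Field k] (p : ℕ)

/-- The value of `[ad y + c x]^t` on `x ^ l`. -/
theorem mulLeft_sub_mulRight_pow_apply (c : k) (l t : ℕ) :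
    ((LinearMap.mulLeft k (y k p + c • x k p) - LinearMap.mulRight k (y k p) :
      Module.End k (R k p)) ^ t) (x k p ^ l) =
      (∏ s ∈ Finset.range t, (c + ((l + s : ℕ) : k) * 2⁻¹)) • x k p ^ (l + t) := by
  induction t with
  | zero => simp
  | succ t ih =>
    rw [pow_succ', Module.End.mul_apply, ih, map_smul, Finset.prod_range_succ, mul_smul]
    congr 1
    simp only [LinearMap.sub_apply, LinearMap.mulLeft_apply, LinearMap.mulRight_apply,
      add_mul, y_mul_x_pow, smul_mul_assoc, ← pow_succ', add_smul, ← add_assoc]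
    abel

/-- Left multiplication by `y + c x` is the sum of the commuting operators `L_{y + c x} - R_y` and
`R_y`, so the binomial theorem applies to its powers. The case `c = 0` is the twisting map; the case
`l = 0` expands `(y + c x) ^ m` in monomials and feeds every computation with `α`. -/
theorem add_smul_pow_mul_x_pow (c : k) (m l : ℕ) :
    (y k p + c • x k p) ^ m * x k p ^ l = ∑ t ∈ Finset.range (m + 1),
      ((m.choose t : k) * ∏ s ∈ Finset.range t, (c + ((l + s : ℕ) : k) * 2⁻¹)) •
        (x k p ^ (l + t) * y k p ^ (m - t)) := by
  have hl : Commute (LinearMap.mulLeft k (y k p + c • x k p) : Module.End k (R k p))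
      (LinearMap.mulRight k (y k p)) := LinearMap.commute_mulLeft_right _ _
  have hc := hl.sub_left (Commute.refl _)
  have h := congrArg (fun f : Module.End k (R k p) => f (x k p ^ l)) (hc.add_pow m)
  simp only [sub_add_cancel, LinearMap.pow_mulLeft, LinearMap.mulLeft_apply] at h
  rw [h, LinearMap.sum_apply]
  refine Finset.sum_congr rfl fun t _ => ?_
  rw [(hc.pow_pow _ _).eq, Module.End.mul_apply, Module.End.natCast_apply, map_nsmul,
    Module.End.mul_apply, mulLeft_sub_mulRight_pow_apply, map_smul, LinearMap.pow_mulRight,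
    LinearMap.mulRight_apply, ← Nat.cast_smul_eq_nsmul k, smul_smul]

theorem y_pow_mul_x_pow (r l : ℕ) : y k p ^ r * x k p ^ l = ∑ t ∈ Finset.range (r + 1),
    ((r.choose t : k) * (2⁻¹ : k) ^ t * (l.ascFactorial t : k)) •
      (x k p ^ (l + t) * y k p ^ (r - t)) := by
  have h := add_smul_pow_mul_x_pow k p 0 r l
  rw [zero_smul, add_zero] at h
  rw [h]
  refine Finset.sum_congr rfl fun t _ => ?_
  congr 1
  rw [mul_assoc]
  congr 1
  simp only [zero_add, Finset.prod_mul_distrib, Finset.prod_const, Finset.card_range,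
    Nat.ascFactorial_eq_prod_range, Nat.cast_prod]
  rw [mul_comm]

theorem add_smul_pow_eq_sum (c : k) (m : ℕ) :
    (y k p + c • x k p) ^ m = ∑ t ∈ Finset.range (m + 1),
      ((m.choose t : k) * ∏ s ∈ Finset.range t, (c + (s : k) * 2⁻¹)) •
        (x k p ^ t * y k p ^ (m - t)) := by
  simpa using add_smul_pow_mul_x_pow k p c m 0

/-- The coefficients of `α` in the basis `x ^ i * y ^ j`. -/
def alphaCoeff (i : ℕ) : k :=
  if i = 0 then -1 else (-1 : k) ^ (i + 1) * ((i + 1).factorial : k) / 2 ^ (i + 1)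

variable {p} in
theorem alpha_eq_sum (hp : 2 < p) : alpha k p = ∑ i ∈ Finset.range (p - 1),
    alphaCoeff k i • (x k p ^ i * y k p ^ (p - 2 - i)) := by
  rw [Finset.range_eq_Ico, Finset.sum_eq_sum_Ico_succ_bot (by omega), alpha]
  congr 1
  · simp [alphaCoeff]
  · have : Finset.Ico (0 + 1) (p - 1) = Finset.Icc 1 (p - 2) := by ext; simp; omega
    rw [this]
    refine Finset.sum_congr rfl fun i hi => ?_
    rw [alphaCoeff, if_neg]
    have := (Finset.mem_Icc.1 hi).1
    omega


theorem two_ne_zero_of_lt [CharP k p] (hp : 2 < p) : (2 : k) ≠ 0 := by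
  have h : ((2 : ℕ) : k) ≠ 0 := by
    rw [Ne, CharP.cast_eq_zero_iff k p]
    exact fun h => absurd (Nat.le_of_dvd two_pos h) (by omega)
  simpa using h

/-- Induction on elements of `R`, through its generators. -/
theorem R_induction {P : R k p → Prop} (algebraMap : ∀ c : k, P (algebraMap k (R k p) c))
    (hx : P (x k p)) (hy : P (y k p)) (mul : ∀ a b, P a → P b → P (a * b))
    (add : ∀ a b, P a → P b → P (a + b)) (r : R k p) : P r := by
  obtain ⟨f, rfl⟩ : ∃ f, toR k p f = r := RingQuot.mkAlgHom_surjective k _ r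
  induction f using FreeAlgebra.induction with
  | grade0 c => rw [AlgHom.commutes]; exact algebraMap c
  | grade1 i => fin_cases i; exacts [hx, hy]
  | mul a b ha hb => rw [map_mul]; exact mul _ _ ha hb
  | add a b ha hb => rw [map_add]; exact add _ _ ha hb

variable [Fact p.Prime] [CharP k p]

theorem sigma_x (c : k) : sigma k p c (x k p) = x k p := lift_x ..

theorem sigma_y (c : k) : sigma k p c (y k p) = y k p + c • x k p := lift_y ..

theorem sigma_add_smul (c c' : k) :
    sigma k p c (y k p + c' • x k p) = y k p + (c' + c) • x k p := by
  rw [map_add, map_smul, sigma_x, sigma_y, add_smul]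
  abel

/-- The element `x` is normal: moving it across `r` is an algebra automorphism, so the generators
suffice. This converts formulas for `x α` into formulas for `α x`. -/
theorem mul_x_eq_x_mul_sigma (r : R k p) : r * x k p = x k p * sigma k p 2⁻¹ r := by
  induction r using R_induction with
  | algebraMap c => rw [AlgHom.commutes, Algebra.commutes]
  | hx => rw [sigma_x]
  | hy => rw [sigma_y, mul_add, y_mul_x, mul_smul_comm, pow_two]
  | mul a b ha hb => rw [mul_assoc, hb, ← mul_assoc, ha, map_mul, mul_assoc]
  | add a b ha hb => rw [add_mul, ha, hb, map_add, mul_add]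

/-- Pascal's rule and the vanishing of `p.choose (t + 1)` modulo `p` force consecutive values to be
opposite. -/
theorem cast_choose_pred (t : ℕ) (ht : t < p) : ((p - 1).choose t : k) = (-1) ^ t := by
  have hp := (Fact.out : p.Prime).pos
  induction t with
  | zero => simp
  | succ t ih =>
    have h : ((p.choose (t + 1) : ℕ) : k) = 0 :=
      (CharP.cast_eq_zero_iff k p _).2 ((Fact.out : p.Prime).dvd_choose_self (by omega) ht)
    obtain ⟨n, rfl⟩ : ∃ n, p = n + 1 := ⟨p - 1, by omega⟩
    rw [Nat.choose_succ_succ, Nat.cast_add] at h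
    rw [Nat.add_sub_cancel] at ih ⊢
    rw [ih (by omega)] at h
    rw [eq_neg_of_add_eq_zero_right h, pow_succ]
    ring

theorem prod_range_half (t : ℕ) :
    ∏ s ∈ Finset.range t, ((2⁻¹ : k) + (s : k) * 2⁻¹) = (t.factorial : k) / 2 ^ t := by
  induction t with
  | zero => simp
  | succ t ih =>
    rw [Finset.prod_range_succ, ih, Nat.factorial_succ]
    push_cast
    rw [pow_succ, div_eq_mul_inv, div_eq_mul_inv, mul_inv]
    ring

variable {p}

/-- For `c = -1/2` the factor with `s = 1` in the coefficient product is zero, so only the terms of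
degree `0` and `1` in `x` survive. This explains the unusual coefficient in the differential for `i`
odd and `j` even. -/
theorem sub_half_pow (hp : 2 < p) : (y k p + (-2⁻¹ : k) • x k p) ^ (p - 1) =
    y k p ^ (p - 1) + (2⁻¹ : k) • (x k p * y k p ^ (p - 2)) := by
  obtain ⟨n, rfl⟩ : ∃ n, p = n + 3 := ⟨p - 3, by omega⟩
  rw [add_smul_pow_eq_sum, show n + 3 - 1 + 1 = n + 1 + 1 + 1 by omega, Finset.sum_range_succ',
    Finset.sum_range_succ', Finset.sum_eq_zero]
  · rw [cast_choose_pred k (n + 3) (0 + 1) (by omega)]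
    simp [add_comm]
  · intro t _
    rw [Finset.prod_eq_zero (i := 1) (by simp) (by simp)]
    simp

/-- In degree at least `2` in `x`, only the first power contributes, and its coefficients `(-1) ^ t
t! / 2 ^ t` are those of `α` shifted by one. In degree `1` the two powers give `-1/2 - 1/2 = -1`,
the leading coefficient of `α`; in degree `0` they cancel. -/
theorem x_mul_alpha (hp : 2 < p) : x k p * alpha k p =
    (y k p + (2⁻¹ : k) • x k p) ^ (p - 1) - (y k p + (-2⁻¹ : k) • x k p) ^ (p - 1) := by
  have h2 := two_ne_zero_of_lt k p hp
  rw [sub_half_pow k hp, alpha_eq_sum k hp, add_smul_pow_eq_sum, Finset.mul_sum,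
    Finset.sum_range_succ']
  obtain ⟨n, rfl⟩ : ∃ n, p = n + 3 := ⟨p - 3, by omega⟩
  rw [show n + 3 - 1 = n + 1 + 1 by omega, Finset.sum_range_succ', Finset.sum_range_succ' _ (n + 1)]
  have h : ∀ i ∈ Finset.range (n + 1), x k (n + 3) * alphaCoeff k (i + 1) •
      (x k (n + 3) ^ (i + 1) * y k (n + 3) ^ (n + 3 - 2 - (i + 1))) =
      (((n + 1 + 1).choose (i + 1 + 1) : k) *
        ∏ s ∈ Finset.range (i + 1 + 1), ((2⁻¹ : k) + (s : k) * 2⁻¹)) •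
        (x k (n + 3) ^ (i + 1 + 1) * y k (n + 3) ^ (n + 1 + 1 - (i + 1 + 1))) := by
    intro i hi
    rw [Finset.mem_range] at hi
    rw [mul_smul_comm, ← mul_assoc, ← pow_succ', prod_range_half]
    congr 1
    · rw [show n + 1 + 1 = n + 3 - 1 by omega, cast_choose_pred k (n + 3) _ (by omega), alphaCoeff,
        if_neg (by omega), mul_div_assoc]
    · congr 2
      omega
  rw [Finset.sum_congr rfl h]
  have h1 : ((n + 1 + 1).choose (0 + 1) : k) = -1 := by
    rw [show n + 1 + 1 = n + 3 - 1 by omega, cast_choose_pred k (n + 3) _ (by omega)]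
    simp
  rw [h1]
  simp only [alphaCoeff, Finset.prod_range_succ, Finset.prod_range_zero]
  have h3 : (-1 : k) * 2⁻¹ - 2⁻¹ = -1 := by field_simp; norm_num
  have h4 : -(x k (n + 3) * y k (n + 3) ^ (n + 1)) =
      ((-1 : k) * 2⁻¹) • (x k (n + 3) * y k (n + 3) ^ (n + 1)) -
        (2⁻¹ : k) • (x k (n + 3) * y k (n + 3) ^ (n + 1)) := by
    rw [← sub_smul, h3, neg_one_smul]
  simp [show n + 3 - 2 = n + 1 by omega]
  rw [h4]
  simp
  abel

/-- The recursion that makes `(y + x) α` telescope. The defect at `i = 0` arises because the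
constant coefficient `-1` is twice what the general formula would give, and it produces the term `x
y ^ (p - 2) / 2`. -/
theorem alphaCoeff_mul (hp : 2 < p) (i : ℕ) : alphaCoeff k i * ((i : k) * 2⁻¹ + 1) =
    -alphaCoeff k (i + 1) - if i = 0 then 2⁻¹ else 0 := by
  have h2 := two_ne_zero_of_lt k p hp
  rcases Nat.eq_zero_or_pos i with rfl | hi
  · simp only [alphaCoeff, Nat.factorial]
    simp only [if_true]
    have h4 : (4 : k) ≠ 0 := by
      rw [show (4 : k) = 2 * 2 by norm_num]
      exact mul_ne_zero h2 h2
    norm_num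
    field_simp
    norm_num
  · simp only [alphaCoeff, if_neg hi.ne', if_neg (Nat.succ_ne_zero i),
      Nat.factorial_succ (i + 1)]
    push_cast
    field_simp
    ring

/-- Moving `y` past `x ^ i` turns each term into a difference `c i - c (i + 1)`, up to the defect at
`i = 0`. The upper end `c (p - 1)` vanishes because its numerator is `p!`. -/
theorem y_add_x_mul_alpha (hp : 2 < p) : (y k p + x k p) * alpha k p =
    -(y k p + (-2⁻¹ : k) • x k p) ^ (p - 1) := by
  rw [sub_half_pow k hp, alpha_eq_sum k hp, Finset.mul_sum]
  set c : ℕ → R k p := fun i => alphaCoeff k i • (x k p ^ i * y k p ^ (p - 1 - i)) with hc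
  have h : ∀ i ∈ Finset.range (p - 1), (y k p + x k p) * alphaCoeff k i •
      (x k p ^ i * y k p ^ (p - 2 - i)) = (c i - c (i + 1)) -
        if i = 0 then (2⁻¹ : k) • (x k p * y k p ^ (p - 2)) else 0 := by
    intro i hi
    rw [Finset.mem_range] at hi
    have e : p - 1 - (i + 1) = p - 2 - i := by omega
    have e' : p - 1 - i = p - 2 - i + 1 := by omega
    simp only [hc, e, e']
    have h3 : (y k p + x k p) * (x k p ^ i * y k p ^ (p - 2 - i)) =
        x k p ^ i * y k p ^ (p - 2 - i + 1) +
          ((i : k) * 2⁻¹ + 1) • (x k p ^ (i + 1) * y k p ^ (p - 2 - i)) := by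
      rw [← mul_assoc, add_mul, y_mul_x_pow, add_mul, add_mul, mul_assoc, ← pow_succ', ← pow_succ',
        add_smul, one_smul, smul_mul_assoc]
      abel
    have h4 : (if i = 0 then (2⁻¹ : k) • (x k p * y k p ^ (p - 2)) else 0) =
        (if i = 0 then (2⁻¹ : k) else 0) • (x k p ^ (i + 1) * y k p ^ (p - 2 - i)) := by
      split_ifs with h
      · simp [h]
      · simp
    rw [mul_smul_comm, h3, smul_add, smul_smul, alphaCoeff_mul k hp, h4, sub_smul, neg_smul]
    abel
  rw [Finset.sum_congr rfl h, Finset.sum_sub_distrib, Finset.sum_range_sub',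
    Finset.sum_ite_eq' (Finset.range (p - 1)) 0, if_pos (Finset.mem_range.2 (by omega))]
  have h0 : c 0 = -y k p ^ (p - 1) := by simp [hc, alphaCoeff]
  have h1 : c (p - 1) = 0 := by
    simp only [hc, alphaCoeff, if_neg (show p - 1 ≠ 0 by omega)]
    rw [Nat.sub_add_cancel (by omega), (CharP.cast_eq_zero_iff k p _).2
      (Nat.dvd_factorial (by omega) le_rfl)]
    simp
  rw [h0, h1]
  abel

theorem alpha_mul_x (hp : 2 < p) : alpha k p * x k p =
    (y k p + x k p) ^ (p - 1) - y k p ^ (p - 1) := by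
  have h2 := two_ne_zero_of_lt k p hp
  have h := congrArg (sigma k p 2⁻¹) (x_mul_alpha k hp)
  -- Applying `y ↦ y + x / 2` to the formula for `x α` turns its left side into `α x` and moves the
  -- shifts `1/2`, `-1/2` to `1`, `0`.
  rw [map_mul, map_sub, map_pow, map_pow, sigma_x, sigma_add_smul, sigma_add_smul,
    ← mul_x_eq_x_mul_sigma, show (2⁻¹ : k) + 2⁻¹ = 1 by field_simp; norm_num] at h
  simpa using h

theorem prod_range_one_add_half (hp : 2 < p) (t : ℕ) :
    ∏ s ∈ Finset.range t, (1 + (s : k) * 2⁻¹) = ((t + 1).factorial : k) / 2 ^ t := by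
  have h2 := two_ne_zero_of_lt k p hp
  induction t with
  | zero => simp
  | succ t ih =>
    rw [Finset.prod_range_succ, ih, Nat.factorial_succ (t + 1)]
    push_cast
    field_simp
    ring

/-- The expansion of `(y + x) ^ (p - 1)` has coefficients `(-1) ^ t (t + 1)! / 2 ^ t`, which is `-2`
times those of `α` for `0 < t < p - 1`. The top one contains `p!` and vanishes; the constant one is
`1` instead of `2`, which the extra `y ^ (p - 1)` repairs. -/
theorem alpha_mul_y (hp : 2 < p) : (2 : k) • (alpha k p * y k p) =
    -((y k p + x k p) ^ (p - 1) + y k p ^ (p - 1)) := by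
  have h2 := two_ne_zero_of_lt k p hp
  have h := add_smul_pow_eq_sum k p 1 (p - 1)
  rw [one_smul] at h
  rw [h, Finset.sum_range_succ, alpha_eq_sum k hp, Finset.sum_mul, Finset.smul_sum,
    prod_range_one_add_half k hp, Nat.sub_add_cancel (by omega : 1 ≤ p),
    (CharP.cast_eq_zero_iff k p p.factorial).2 (Nat.dvd_factorial (by omega) le_rfl)]
  obtain ⟨n, rfl⟩ : ∃ n, p = n + 3 := ⟨p - 3, by omega⟩
  rw [show n + 3 - 1 = n + 1 + 1 by omega, Finset.sum_range_succ', Finset.sum_range_succ' _ (n + 1)]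
  have h : ∀ i ∈ Finset.range (n + 1), (2 : k) • (alphaCoeff k (i + 1) •
      (x k (n + 3) ^ (i + 1) * y k (n + 3) ^ (n + 3 - 2 - (i + 1))) * y k (n + 3)) =
      -((((n + 1 + 1).choose (i + 1) : k) *
        ∏ s ∈ Finset.range (i + 1), (1 + (s : k) * 2⁻¹)) •
        (x k (n + 3) ^ (i + 1) * y k (n + 3) ^ (n + 1 + 1 - (i + 1)))) := by
    intro i hi
    rw [Finset.mem_range] at hi
    rw [smul_mul_assoc, mul_assoc, ← pow_succ, prod_range_one_add_half k hp, smul_smul, ← neg_smul]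
    congr 1
    · rw [show n + 1 + 1 = n + 3 - 1 by omega, cast_choose_pred k (n + 3) _ (by omega), alphaCoeff,
        if_neg (by omega)]
      field_simp
      ring
    · congr 2
      omega
  rw [Finset.sum_congr rfl h, Finset.sum_neg_distrib]
  simp [show n + 3 - 2 = n + 1 by omega, alphaCoeff, two_smul, ← pow_succ]
  abel

theorem alpha_mul_y_sub_half_x (hp : 2 < p) :
    alpha k p * (y k p - (2⁻¹ : k) • x k p) = -(y k p + x k p) ^ (p - 1) := by
  have h2 := two_ne_zero_of_lt k p hp
  have h : (2 : k) • (alpha k p * (y k p - (2⁻¹ : k) • x k p)) =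
      (2 : k) • (-(y k p + x k p) ^ (p - 1)) := by
    rw [mul_sub, smul_sub, alpha_mul_y k hp, mul_smul_comm, smul_smul, mul_inv_cancel₀ h2, one_smul,
      alpha_mul_x k hp, two_smul]
    abel
  exact smul_right_injective _ h2 h

/-- The range splits into `q / p` blocks, each a copy of the prime field, where power sums of
exponent below `p - 1` vanish. -/
theorem sum_range_pow_eq_zero {q : ℕ} (hq : p ∣ q) (m : ℕ) (hm : m < p - 1) :
    ∑ t ∈ Finset.range q, (t : k) ^ m = 0 := by
  have h : ∑ t ∈ Finset.range p, (t : k) ^ m = 0 := by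
    have h1 := congrArg (ZMod.castHom dvd_rfl k) (FiniteField.sum_pow_lt_card_sub_one (ZMod p) m
      (by rwa [ZMod.card]))
    rw [map_sum, map_zero] at h1
    rw [← h1]
    refine Finset.sum_nbij' (fun t => (t : ZMod p)) ZMod.val (by simp) ?_ ?_ (by simp) ?_
    · intro a _; simpa using ZMod.val_lt a
    · intro a ha; exact ZMod.val_cast_of_lt (Finset.mem_range.1 ha)
    · intro a _; simp
  obtain ⟨n, rfl⟩ := hq
  induction n with
  | zero => simp
  | succ n ih =>
    rw [Nat.mul_succ, Finset.sum_range_add, ih, zero_add, ← h]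
    refine Finset.sum_congr rfl fun t _ => ?_
    simp

theorem sum_range_eval_eq_zero {q : ℕ} (hq : p ∣ q) (f : Polynomial k) (hf : f.natDegree < p - 1) :
    ∑ t ∈ Finset.range q, f.eval (t : k) = 0 := by
  simp_rw [Polynomial.eval_eq_sum_range]
  rw [Finset.sum_comm]
  refine Finset.sum_eq_zero fun m hm => ?_
  rw [← Finset.mul_sum, sum_range_pow_eq_zero k hq m, mul_zero]
  have := Finset.mem_range.1 hm
  omega

/-- This is what lets `g ^ q` act as the identity on `K`. In the translate by `t`, the coefficient
of each monomial is a polynomial in `t` of degree at most `p - 2`. -/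
theorem sum_sigma_alpha {q : ℕ} (hq : p ∣ q) (hp : 2 < p) :
    ∑ t ∈ Finset.range q, sigma k p (t : k) (alpha k p) = 0 := by
  simp_rw [alpha_eq_sum k hp, map_sum, map_smul, map_mul, map_pow, sigma_x, sigma_y,
    add_smul_pow_eq_sum]
  rw [Finset.sum_comm]
  refine Finset.sum_eq_zero fun i hi => ?_
  rw [← Finset.smul_sum, ← Finset.mul_sum, Finset.sum_comm, Finset.sum_eq_zero, mul_zero, smul_zero]
  intro m hm
  rw [Finset.mem_range] at hi hm
  rw [← Finset.sum_smul, ← Finset.mul_sum]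
  have h := sum_range_eval_eq_zero k hq
    (∏ s ∈ Finset.range m, (Polynomial.X + Polynomial.C ((s : k) * 2⁻¹))) (by
      rw [Polynomial.natDegree_prod_of_monic _ _ fun s _ => Polynomial.monic_X_add_C _]
      simp only [Polynomial.natDegree_X_add_C, Finset.sum_const, Finset.card_range, smul_eq_mul]
      omega)
  simp only [Polynomial.eval_prod, Polynomial.eval_add, Polynomial.eval_X, Polynomial.eval_C] at h
  rw [h, mul_zero, zero_smul]

end Algebra

/-! ### The modules `P_i(A) ⊗ P_j(B)`, the basis of `R`, and the differential of `K` -/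

section Modules

variable (k : Type u) [Field k] (p : ℕ)

theorem shiftOp_root_pow (e m : ℕ) :
    shiftOp k p e (root k p ^ m) = (2⁻¹ * ((m + e : ℕ) : k)) • root k p ^ (m + 1) := by
  rw [root, AdjoinRoot.root, ← map_pow, shiftOp_mk, ← map_pow, AdjoinRoot.smul_mk]
  congr 1
  cases m with
  | zero => simp [polyOp, Polynomial.smul_eq_C_mul, mul_assoc]
  | succ m =>
    simp [polyOp, Polynomial.smul_eq_C_mul]
    ring

theorem delta_xPow (i m : ℕ) :
    delta k p i (xPow k p i m) = (2⁻¹ * ((m + i % 2 : ℕ) : k)) • xPow k p i (m + 1) :=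
  shiftOp_root_pow k p (i % 2) m

theorem xMul_xPow (i m : ℕ) : xMul k p i (xPow k p i m) = xPow k p i (m + 1) :=
  (pow_succ' (root k p) m).symm

theorem yMul_yPow (j m : ℕ) : yMul k p j (yPow k p j m) = yPow k p j (m + 1) :=
  (pow_succ' (root k p) m).symm

theorem yMul_pow_yPow (j r m : ℕ) :
    (yMul k p j ^ r) (yPow k p j m) = yPow k p j (r + m) := by
  induction r with
  | zero => simp
  | succ r ih => rw [pow_succ', Module.End.mul_apply, ih, yMul_yPow]; congr 1; omega

theorem delta_pow_xPow (i m t : ℕ) : (delta k p i ^ t) (xPow k p i m) =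
    ((2⁻¹ : k) ^ t * ((m + i % 2).ascFactorial t : k)) • xPow k p i (m + t) := by
  induction t with
  | zero => simp
  | succ t ih =>
    rw [pow_succ', Module.End.mul_apply, ih, map_smul, delta_xPow, smul_smul,
      Nat.ascFactorial_succ, ← add_assoc]
    congr 1
    push_cast
    ring

/-- The powers of the variable form a basis of `k[t]/(t ^ p)`. -/
def truncBasis : Module.Basis (Fin p) k (Trunc k p) :=
  (AdjoinRoot.powerBasisAux' (Polynomial.monic_X_pow p)).reindex
    (finCongr (Polynomial.natDegree_X_pow p))

theorem truncBasis_apply (i : Fin p) : truncBasis k p i = root k p ^ (i : ℕ) := by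
  rw [truncBasis, Module.Basis.reindex_apply]
  exact (AdjoinRoot.powerBasis' (Polynomial.monic_X_pow p)).basis_eq_pow _

variable [Fact p.Prime] [CharP k p]

theorem x_smul (i j : ℕ) (z : PA k p i ⊗[k] PB k p j) : x k p • z = xAct k p i j z := by
  change actHom k p i j (x k p) z = _
  rw [actHom, lift_x]

theorem y_smul (i j : ℕ) (z : PA k p i ⊗[k] PB k p j) : y k p • z = yAct k p i j z := by
  change actHom k p i j (y k p) z = _
  rw [actHom, lift_y]

theorem x_smul_tmul (i j : ℕ) (a : PA k p i) (b : PB k p j) :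
    x k p • (a ⊗ₜ[k] b) = xMul k p i a ⊗ₜ b := by
  rw [x_smul]; rfl

theorem y_smul_tmul (i j : ℕ) (a : PA k p i) (b : PB k p j) :
    y k p • (a ⊗ₜ[k] b) = a ⊗ₜ yMul k p j b + delta k p i a ⊗ₜ b := by
  rw [y_smul]; rfl

theorem x_pow_smul_tmul (i j l m : ℕ) (b : PB k p j) :
    x k p ^ l • (xPow k p i m ⊗ₜ[k] b) = xPow k p i (l + m) ⊗ₜ b := by
  induction l with
  | zero => simp
  | succ l ih => rw [pow_succ', mul_smul, ih, x_smul_tmul, xMul_xPow]; congr 2; omega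

/-- The operator of `y` is the sum of `δ ⊗ 1` and `1 ⊗ y`, which commute, so its powers are given by
the binomial theorem. -/
theorem x_pow_mul_y_pow_smul (i j l r m s : ℕ) :
    (x k p ^ l * y k p ^ r) • (xPow k p i m ⊗ₜ[k] yPow k p j s) =
      ∑ t ∈ Finset.range (r + 1),
        ((r.choose t : k) * (2⁻¹ : k) ^ t * ((m + i % 2).ascFactorial t : k)) •
          (xPow k p i (l + (m + t)) ⊗ₜ[k] yPow k p j (r - t + s)) := by
  have hc : Commute ((delta k p i).rTensor (PB k p j)) ((yMul k p j).lTensor (PA k p i)) := by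
    change LinearMap.comp _ _ = LinearMap.comp _ _
    rw [LinearMap.lTensor_comp_rTensor, LinearMap.rTensor_comp_lTensor]
  have h : ∀ z : PA k p i ⊗[k] PB k p j, y k p ^ r • z = (yAct k p i j ^ r) z := by
    intro z
    change actHom k p i j (y k p ^ r) z = _
    rw [map_pow, actHom, lift_y]
  rw [mul_smul, h, yAct, add_comm, hc.add_pow, LinearMap.sum_apply, Finset.smul_sum]
  refine Finset.sum_congr rfl fun t _ => ?_
  rw [Module.End.mul_apply, Module.End.natCast_apply, map_nsmul, Module.End.mul_apply,
    LinearMap.lTensor_pow, LinearMap.rTensor_pow, LinearMap.lTensor_tmul, LinearMap.rTensor_tmul,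
    yMul_pow_yPow, delta_pow_xPow, ← TensorProduct.smul_tmul', ← Nat.cast_smul_eq_nsmul k,
    smul_smul, smul_comm, x_pow_smul_tmul, mul_assoc]

/-- The generator `1 ⊗ 1` of `P_i(A) ⊗ P_j(B)`. -/
abbrev gen (i j : ℕ) : PA k p i ⊗[k] PB k p j := xPow k p i 0 ⊗ₜ yPow k p j 0

/-- On the generator in even degree all correction terms carry the factor `[0]^{[t]}`, which is `0`
for `t > 0`. Thus monomials of `R` hit the tensor basis, which proves their independence. -/
theorem x_pow_mul_y_pow_smul_gen (l r : ℕ) :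
    (x k p ^ l * y k p ^ r) • gen k p 0 0 = xPow k p 0 l ⊗ₜ yPow k p 0 r := by
  rw [x_pow_mul_y_pow_smul, Finset.sum_range_succ', Finset.sum_eq_zero]
  · simp
  · intro t _
    simp [Nat.zero_ascFactorial]

/-- The basis `x ^ l` of `P_i(A)`. -/
def basisPA (i : ℕ) : Module.Basis (Fin p) k (PA k p i) := truncBasis k p

theorem basisPA_apply (i : ℕ) (l : Fin p) : basisPA k p i l = xPow k p i l :=
  truncBasis_apply k p l

/-- The basis `y ^ r` of `P_j(B)`. -/
def basisPB (j : ℕ) : Module.Basis (Fin p) k (PB k p j) := truncBasis k p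

theorem basisPB_apply (j : ℕ) (r : Fin p) : basisPB k p j r = yPow k p j r :=
  truncBasis_apply k p r

/-- The basis `x ^ l ⊗ y ^ r` of `P_i(A) ⊗ P_j(B)`. -/
def tensorBasis (i j : ℕ) : Module.Basis (Fin p × Fin p) k (PA k p i ⊗[k] PB k p j) :=
  (basisPA k p i).tensorProduct (basisPB k p j)

theorem tensorBasis_apply (i j : ℕ) (lr : Fin p × Fin p) :
    tensorBasis k p i j lr = xPow k p i lr.1 ⊗ₜ yPow k p j lr.2 := by
  rw [tensorBasis, Module.Basis.tensorProduct_apply', basisPA_apply, basisPB_apply]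

/-- The span contains `1` and is stable under left multiplication by `x` and `y`, hence by all of
`R`. -/
theorem mem_span_monomials (r : R k p) : r ∈ Submodule.span k
    (Set.range fun ij : Fin p × Fin p => x k p ^ (ij.1 : ℕ) * y k p ^ (ij.2 : ℕ)) := by
  set S := Submodule.span k
    (Set.range fun ij : Fin p × Fin p => x k p ^ (ij.1 : ℕ) * y k p ^ (ij.2 : ℕ)) with hS
  have hmem : ∀ i j : ℕ, x k p ^ i * y k p ^ j ∈ S := by
    intro i j
    by_cases hi : i < p
    · by_cases hj : j < p
      · exact Submodule.subset_span ⟨(⟨i, hi⟩, ⟨j, hj⟩), rfl⟩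
      · rw [pow_eq_zero_of_le (not_lt.1 hj) (y_pow k p), mul_zero]; exact S.zero_mem
    · rw [pow_eq_zero_of_le (not_lt.1 hi) (x_pow k p), zero_mul]; exact S.zero_mem
  have key : ∀ a : R k p, (∀ i j : ℕ, a * (x k p ^ i * y k p ^ j) ∈ S) → ∀ s ∈ S, a * s ∈ S := by
    intro a ha s hs
    have : S ≤ S.comap (LinearMap.mulLeft k a) := by
      rw [hS, Submodule.span_le]
      rintro _ ⟨ij, rfl⟩
      exact ha _ _
    exact this hs
  suffices h : ∀ s ∈ S, r * s ∈ S by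
    have := h 1 (by simpa using hmem 0 0)
    rwa [mul_one] at this
  induction r using R_induction with
  | algebraMap c => intro s hs; rw [← Algebra.smul_def]; exact S.smul_mem c hs
  | hx => exact key _ fun i j => by rw [← mul_assoc, ← pow_succ']; exact hmem _ _
  | hy =>
    refine key _ fun i j => ?_
    rw [← mul_assoc, y_mul_x_pow, add_mul, mul_assoc, ← pow_succ', smul_mul_assoc]
    exact S.add_mem (hmem _ _) (S.smul_mem _ (hmem _ _))
  | mul a b ha hb => intro s hs; rw [mul_assoc]; exact ha _ (hb _ hs)
  | add a b ha hb => intro s hs; rw [add_mul]; exact S.add_mem (ha _ hs) (hb _ hs)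

/-- The basis `x ^ i * y ^ j` of `R`. -/
def monomialBasis : Module.Basis (Fin p × Fin p) k (R k p) :=
  Module.Basis.mk (v := fun ij : Fin p × Fin p => x k p ^ (ij.1 : ℕ) * y k p ^ (ij.2 : ℕ))
    (by
      -- Independence is tested by letting the monomials act on `1 ⊗ 1` in `P_0(A) ⊗ P_0(B)`.
      refine LinearIndependent.of_comp
        ((LinearMap.toSpanSingleton (R k p) _ (gen k p 0 0)).restrictScalars k) ?_
      have : (LinearMap.toSpanSingleton (R k p) _ (gen k p 0 0)).restrictScalars k ∘
          (fun ij : Fin p × Fin p => x k p ^ (ij.1 : ℕ) * y k p ^ (ij.2 : ℕ)) =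
          tensorBasis k p 0 0 := by
        funext ij
        rw [tensorBasis_apply, ← x_pow_mul_y_pow_smul_gen]; rfl
      rw [this]
      exact (tensorBasis k p 0 0).linearIndependent)
    (fun r _ => mem_span_monomials k p r)

theorem monomialBasis_apply (ij : Fin p × Fin p) :
    monomialBasis k p ij = x k p ^ (ij.1 : ℕ) * y k p ^ (ij.2 : ℕ) := by
  rw [monomialBasis, Module.Basis.mk_apply]

/-- Induction on the exponent of `y`: applying `y` to `x ^ l ⊗ y ^ r` gives `x ^ l ⊗ y ^ (r + 1)`
plus a multiple of `x ^ (l + 1) ⊗ y ^ r`, already in the submodule. -/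
theorem toSpanSingleton_gen_surjective (i j : ℕ) :
    Function.Surjective (LinearMap.toSpanSingleton (R k p) _ (gen k p i j)) := by
  set N := LinearMap.range (LinearMap.toSpanSingleton (R k p) _ (gen k p i j)) with hN
  have hmem : ∀ r l : ℕ, xPow k p i l ⊗ₜ[k] yPow k p j r ∈ N := by
    intro r
    induction r with
    | zero => exact fun l => ⟨x k p ^ l, by
        rw [LinearMap.toSpanSingleton_apply, x_pow_smul_tmul, add_zero]⟩
    | succ r ih =>
      intro l
      have h := y_smul_tmul k p i j (xPow k p i l) (yPow k p j r)
      rw [yMul_yPow, delta_xPow] at h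
      rw [eq_sub_of_add_eq h.symm, ← TensorProduct.smul_tmul', ← algebraMap_smul (R k p)]
      exact N.sub_mem (N.smul_mem _ (ih l)) (N.smul_mem _ (ih (l + 1)))
  have htop : N.restrictScalars k = ⊤ := by
    rw [eq_top_iff, ← (tensorBasis k p i j).span_eq, Submodule.span_le]
    rintro _ ⟨lr, rfl⟩
    rw [tensorBasis_apply]
    exact hmem _ _
  intro z
  have : z ∈ N.restrictScalars k := htop ▸ Submodule.mem_top
  exact this

theorem toSpanSingleton_gen_bijective (i j : ℕ) :
    Function.Bijective (LinearMap.toSpanSingleton (R k p) _ (gen k p i j)) := by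
  have hs := toSpanSingleton_gen_surjective k p i j
  refine ⟨?_, hs⟩
  have := (monomialBasis k p).finiteDimensional_of_finite
  have := (tensorBasis k p i j).finiteDimensional_of_finite
  -- Both sides have dimension `p ^ 2` over `k`.
  exact (LinearMap.injective_iff_surjective_of_finrank_eq_finrank
    (f := (LinearMap.toSpanSingleton (R k p) _ (gen k p i j)).restrictScalars k) (by
      rw [Module.finrank_eq_card_basis (monomialBasis k p),
        Module.finrank_eq_card_basis (tensorBasis k p i j)])).2 hs

/-- `P_i(A) ⊗ P_j(B)` is free of rank one over `R`. -/
def genEquiv (i j : ℕ) : R k p ≃ₗ[R k p] PA k p i ⊗[k] PB k p j :=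
  LinearEquiv.ofBijective _ (toSpanSingleton_gen_bijective k p i j)

theorem genEquiv_apply (i j : ℕ) (r : R k p) : genEquiv k p i j r = r • gen k p i j := rfl

instance (n : ℕ) : Finite (Pairs n) :=
  Finite.of_injective (fun ij => (⟨ij.1.1, by have := ij.2; omega⟩ : Fin (n + 1))) (by
    rintro ⟨⟨a, b⟩, h⟩ ⟨⟨a', b'⟩, h'⟩ e
    simp only [Fin.mk.injEq] at e h h'
    ext <;> simp <;> omega)

/-- The basis `φ_{i,j}` of `K_n` over `R`. -/
def basisK (n : ℕ) : Module.Basis (Pairs n) (R k p) (K k p n) :=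
  Module.Basis.ofEquivFun (LinearEquiv.piCongrRight fun ij => (genEquiv k p ij.1.1 ij.1.2).symm)

theorem phi_apply (n : ℕ) (i j : ℤ) (ab : Pairs n) : phi k p n i j ab =
    if (ab.1.1 : ℤ) = i ∧ (ab.1.2 : ℤ) = j then gen k p ab.1.1 ab.1.2 else 0 := rfl

theorem basisK_apply (n : ℕ) (ij : Pairs n) :
    basisK k p n ij = phi k p n ij.1.1 ij.1.2 := by
  classical
  rw [basisK, Module.Basis.coe_ofEquivFun]
  funext ab
  change genEquiv k p _ _ ((Pi.single ij 1 : Pairs n → R k p) ab) = _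
  rw [phi_apply, Pi.single_apply]
  by_cases h : ab = ij
  · subst h; simp [genEquiv_apply]
  · rw [if_neg h, if_neg, map_zero]
    rintro ⟨h1, h2⟩
    exact h (Subtype.ext (Prod.ext (by exact_mod_cast h1) (by exact_mod_cast h2)))

theorem rTensor_dA_x_smul (i j : ℕ) (z : PA k p (i + 1) ⊗[k] PB k p j) :
    (dA k p i).rTensor (PB k p j) (x k p • z) = x k p • (dA k p i).rTensor (PB k p j) z := by
  induction z with
  | zero => simp
  | add a b ha hb => simp only [smul_add, map_add, ha, hb]
  | tmul a b =>
    rw [x_smul_tmul, LinearMap.rTensor_tmul, LinearMap.rTensor_tmul, x_smul_tmul]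
    congr 1
    exact mul_left_comm (G := Trunc k p) _ _ _

/-- The reason for the parity shift `e_i`. Across multiplication by `x` the exponent grows by one
while `e` drops by one in passing to lower degree, so the coefficients agree. Across multiplication
by `x ^ (p - 1)` they differ by `p / 2 = 0`. -/
theorem dTrunc_shiftOp (i : ℕ) (a : Trunc k p) :
    shiftOp k p (i % 2) (dTrunc k p i a) = dTrunc k p i (shiftOp k p ((i + 1) % 2) a) := by
  have key : shiftOp k p (i % 2) ∘ₗ dTrunc k p i = dTrunc k p i ∘ₗ shiftOp k p ((i + 1) % 2) := by
    refine (truncBasis k p).ext fun m => ?_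
    rw [truncBasis_apply, LinearMap.comp_apply, LinearMap.comp_apply, shiftOp_root_pow, map_smul,
      dTrunc, LinearMap.mulLeft_apply, LinearMap.mulLeft_apply]
    split_ifs with h
    · rw [← pow_succ', ← pow_succ', shiftOp_root_pow]
      have h1 : i % 2 = 0 := by rw [Nat.odd_iff] at h; omega
      have h2 : (i + 1) % 2 = 1 := by omega
      rw [h1, h2]
    · have h1 : i % 2 = 1 := by rw [Nat.odd_iff] at h; omega
      have h2 : (i + 1) % 2 = 0 := by omega
      have hp := (Fact.out : p.Prime).pos
      rw [← pow_add, ← pow_add, shiftOp_root_pow, h1, h2,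
        show p - 1 + (m : ℕ) + 1 = p + m by omega, show p - 1 + ((m : ℕ) + 1) = p + m by omega]
      simp
  exact LinearMap.congr_fun key a

theorem rTensor_dA_y_smul (i j : ℕ) (z : PA k p (i + 1) ⊗[k] PB k p j) :
    (dA k p i).rTensor (PB k p j) (y k p • z) = y k p • (dA k p i).rTensor (PB k p j) z := by
  induction z with
  | zero => simp
  | add a b ha hb => simp only [smul_add, map_add, ha, hb]
  | tmul a b =>
    rw [y_smul_tmul, map_add, LinearMap.rTensor_tmul, LinearMap.rTensor_tmul,
      LinearMap.rTensor_tmul, y_smul_tmul]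
    congr 2
    exact (dTrunc_shiftOp k p i a).symm

theorem lTensor_dB_x_smul (i j : ℕ) (z : PA k p i ⊗[k] PB k p (j + 1)) :
    (dB k p j).lTensor (PA k p i) (x k p • z) = x k p • (dB k p j).lTensor (PA k p i) z := by
  induction z with
  | zero => simp
  | add a b ha hb => simp only [smul_add, map_add, ha, hb]
  | tmul a b => rw [x_smul_tmul, LinearMap.lTensor_tmul, LinearMap.lTensor_tmul, x_smul_tmul]

theorem lTensor_dB_y_smul (i j : ℕ) (z : PA k p i ⊗[k] PB k p (j + 1)) :
    (dB k p j).lTensor (PA k p i) (y k p • z) = y k p • (dB k p j).lTensor (PA k p i) z := by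
  induction z with
  | zero => simp
  | add a b ha hb => simp only [smul_add, map_add, ha, hb]
  | tmul a b =>
    rw [y_smul_tmul, map_add, LinearMap.lTensor_tmul, LinearMap.lTensor_tmul,
      LinearMap.lTensor_tmul, y_smul_tmul]
    congr 2
    exact mul_left_comm (G := Trunc k p) _ _ _

/-- A `k`-linear map that commutes with `x` and `y` is `R`-linear. -/
theorem map_R_smul {M N : Type*} [AddCommGroup M] [Module k M] [Module (R k p) M]
    [IsScalarTower k (R k p) M] [AddCommGroup N] [Module k N] [Module (R k p) N]
    [IsScalarTower k (R k p) N] (f : M →ₗ[k] N) (hx : ∀ z, f (x k p • z) = x k p • f z)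
    (hy : ∀ z, f (y k p • z) = y k p • f z) (r : R k p) (z : M) : f (r • z) = r • f z := by
  induction r using R_induction generalizing z with
  | algebraMap c => rw [algebraMap_smul, algebraMap_smul, map_smul]
  | hx => exact hx z
  | hy => exact hy z
  | mul a b ha hb => rw [mul_smul, ha, hb, mul_smul]
  | add a b ha hb => rw [add_smul, map_add, ha, hb, add_smul]

theorem dK_apply (n : ℕ) (z : K k p (n + 1)) (ij : Pairs n) : dK k p n z ij =
    (dA k p ij.1.1).rTensor (PB k p ij.1.2)
        (z ⟨(ij.1.1 + 1, ij.1.2), by have := ij.2; dsimp only; omega⟩) +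
      (-1 : k) ^ ij.1.1 • (dB k p ij.1.2).lTensor (PA k p ij.1.1)
        (z ⟨(ij.1.1, ij.1.2 + 1), by have := ij.2; dsimp only; omega⟩) := rfl

/-- The differential of `K` as an `R`-linear map. -/
def dKR (n : ℕ) : K k p (n + 1) →ₗ[R k p] K k p n where
  __ := dK k p n
  map_smul' r z := by
    refine map_R_smul k p (dK k p n) ?_ ?_ r z <;> intro z <;> funext ij
    · rw [dK_apply, Pi.smul_apply, Pi.smul_apply, rTensor_dA_x_smul, lTensor_dB_x_smul,
        Pi.smul_apply, dK_apply, smul_add, smul_comm (x k p) ((-1 : k) ^ ij.1.1)]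
    · rw [dK_apply, Pi.smul_apply, Pi.smul_apply, rTensor_dA_y_smul, lTensor_dB_y_smul,
        Pi.smul_apply, dK_apply, smul_add, smul_comm (y k p) ((-1 : k) ^ ij.1.1)]

theorem augTrunc_root_mul (a : Trunc k p) : augTrunc k p (root k p * a) = 0 := by
  rw [map_mul, augTrunc, AdjoinRoot.liftAlgHom_root, zero_mul]

theorem augTrunc_shiftOp (e : ℕ) (a : Trunc k p) : augTrunc k p (shiftOp k p e a) = 0 := by
  have key : (augTrunc k p).toLinearMap ∘ₗ shiftOp k p e = 0 := by
    refine (truncBasis k p).ext fun m => ?_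
    rw [truncBasis_apply, LinearMap.comp_apply, shiftOp_root_pow, map_smul,
      AlgHom.toLinearMap_apply, pow_succ', augTrunc_root_mul, smul_zero, LinearMap.zero_apply]
  exact LinearMap.congr_fun key a

/-- The augmentation of `P(A)`. -/
def augPA : PA k p 0 →ₗ[k] k := (augTrunc k p).toLinearMap

/-- The augmentation of `P(B)`. -/
def augPB : PB k p 0 →ₗ[k] k := (augTrunc k p).toLinearMap

theorem augK_smul (r : R k p) (z : K k p 0) :
    augK k p (r • z) = augR k p (Fact.out : p.Prime).ne_zero r * augK k p z := by
  have hx : ∀ w : PA k p 0 ⊗[k] PB k p 0, LinearMap.mul' k k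
      (TensorProduct.map (augPA k p) (augPB k p) (x k p • w)) = 0 := by
    intro w
    induction w with
    | zero => simp
    | add a b ha hb => simp only [smul_add, map_add, ha, hb, add_zero]
    | tmul a b =>
      rw [x_smul_tmul, TensorProduct.map_tmul, LinearMap.mul'_apply,
        show augPA k p (xMul k p 0 a) = 0 from augTrunc_root_mul k p a, zero_mul]
  have hy : ∀ w : PA k p 0 ⊗[k] PB k p 0, LinearMap.mul' k k
      (TensorProduct.map (augPA k p) (augPB k p) (y k p • w)) = 0 := by
    intro w
    induction w with
    | zero => simp
    | add a b ha hb => simp only [smul_add, map_add, ha, hb, add_zero]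
    | tmul a b =>
      rw [y_smul_tmul, map_add, map_add, TensorProduct.map_tmul, TensorProduct.map_tmul,
        LinearMap.mul'_apply, LinearMap.mul'_apply,
        show augPB k p (yMul k p 0 b) = 0 from augTrunc_root_mul k p b,
        show augPA k p (delta k p 0 a) = 0 from augTrunc_shiftOp k p _ a, zero_mul, mul_zero,
        add_zero]
  induction r using R_induction generalizing z with
  | algebraMap c => rw [algebraMap_smul, map_smul, AlgHom.commutes]; rfl
  | hx => rw [augR, lift_x, zero_mul]; exact hx _
  | hy => rw [augR, lift_y, zero_mul]; exact hy _
  | mul a b ha hb => rw [mul_smul, ha, hb, map_mul, mul_assoc]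
  | add a b ha hb => rw [add_smul, map_add, ha, hb, map_add, add_mul]

theorem R_smul_triv (r : R k p) (c : k) :
    r • toTriv k c = toTriv k (augR k p (Fact.out : p.Prime).ne_zero r * c) := rfl

/-- The augmentation of `K` as an `R`-linear map. -/
def augKR : K k p 0 →ₗ[R k p] Triv k where
  toFun z := toTriv k (augK k p z)
  map_add' a b := by rw [map_add, map_add]
  map_smul' r z := by rw [augK_smul, RingHom.id_apply, R_smul_triv]

theorem dA_xPow_zero (i j : ℕ) : dA k p i (xPow k p (i + 1) 0) ⊗ₜ yPow k p j 0 =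
    coeffX k p (i + 1) • gen k p i j := by
  rw [coeffX]
  have h : ∀ m : ℕ, xPow k p i m ⊗ₜ[k] yPow k p j 0 = x k p ^ m • gen k p i j := by
    intro m; rw [x_pow_smul_tmul, add_zero]
  split_ifs with hi
  · rw [← h]
    congr 1
    change (if Odd (i + 1) then root k p else root k p ^ (p - 1)) * 1 = _
    rw [if_neg (Nat.not_odd_iff_even.2 hi), mul_one]; rfl
  · rw [← pow_one (x k p), ← h]
    congr 1
    change (if Odd (i + 1) then root k p else root k p ^ (p - 1)) * 1 = _
    rw [if_pos (Nat.not_even_iff_odd.1 hi), mul_one, ← pow_one (root k p)]; rfl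

theorem pow_smul_gen_of_even (i j s : ℕ) (hi : Even i) :
    y k p ^ s • gen k p i j = xPow k p i 0 ⊗ₜ yPow k p j s := by
  induction s with
  | zero => simp
  | succ s ih =>
    rw [pow_succ', mul_smul, ih, y_smul_tmul, yMul_yPow, delta_xPow, Nat.even_iff.1 hi]
    simp

/-- For odd `i` the action of `y` on `1 ⊗ y ^ s` picks up `x / 2`, so it is `y - x / 2` that acts as
plain multiplication on the second factor. Hence the coefficients of the differential in odd columns
are powers of `y - x / 2`. -/
theorem pow_smul_gen_of_odd (i j s : ℕ) (hi : Odd i) :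
    (y k p + (-2⁻¹ : k) • x k p) ^ s • gen k p i j = xPow k p i 0 ⊗ₜ yPow k p j s := by
  induction s with
  | zero => simp
  | succ s ih =>
    rw [pow_succ', mul_smul, ih, add_smul, y_smul_tmul, yMul_yPow, delta_xPow, Nat.odd_iff.1 hi,
      smul_assoc, x_smul_tmul, xMul_xPow]
    simp [← TensorProduct.smul_tmul']

theorem dB_yPow_zero (hp : 2 < p) (i j : ℕ) :
    (-1 : k) ^ i • (xPow k p i 0 ⊗ₜ[k] dB k p j (yPow k p (j + 1) 0)) =
      coeffY k p i (j + 1) • gen k p i j := by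
  have hodd : Odd (j + 1) → dB k p j (yPow k p (j + 1) 0) = yPow k p j 1 := by
    intro h
    change (if Odd (j + 1) then root k p else root k p ^ (p - 1)) * 1 = root k p ^ 1
    rw [if_pos h, mul_one, pow_one]
  have heven : ¬ Odd (j + 1) → dB k p j (yPow k p (j + 1) 0) = yPow k p j (p - 1) := by
    intro h
    change (if Odd (j + 1) then root k p else root k p ^ (p - 1)) * 1 = root k p ^ (p - 1)
    rw [if_neg h, mul_one]
  rw [coeffY]
  split_ifs with hi hj hj
  · rw [heven (Nat.not_odd_iff_even.2 hj), hi.neg_one_pow, one_smul, pow_smul_gen_of_even k p i j _ hi]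
  · rw [hodd (Nat.not_even_iff_odd.1 hj), hi.neg_one_pow, one_smul,
      ← pow_smul_gen_of_even k p i j _ hi, pow_one]
  · have hi := Nat.not_even_iff_odd.1 hi
    rw [heven (Nat.not_odd_iff_even.2 hj), hi.neg_one_pow, ← sub_half_pow k hp, neg_smul, neg_smul,
      one_smul, pow_smul_gen_of_odd k p i j _ hi]
  · have hi := Nat.not_even_iff_odd.1 hi
    rw [hodd (Nat.not_even_iff_odd.1 hj), hi.neg_one_pow, neg_smul, neg_smul, one_smul,
      ← pow_smul_gen_of_odd k p i j _ hi, pow_one, neg_smul, sub_eq_add_neg]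

theorem dK_phi (hp : 2 < p) (n i j : ℕ) (h : i + j = n + 1) :
    dK k p n (phi k p (n + 1) i j) =
      coeffX k p i • phi k p n (i - 1) j + coeffY k p i j • phi k p n i (j - 1) := by
  funext ab
  rw [dK_apply, Pi.add_apply, Pi.smul_apply, Pi.smul_apply, phi_apply, phi_apply, phi_apply,
    phi_apply]
  have hab := ab.2
  congr 1
  · by_cases h1 : ab.1.1 + 1 = i ∧ ab.1.2 = j
    · obtain ⟨rfl, rfl⟩ := h1
      rw [if_pos (by simp), if_pos (by simp), LinearMap.rTensor_tmul]
      exact dA_xPow_zero k p _ _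
    · rw [if_neg (by dsimp only; omega), if_neg (by omega), map_zero, smul_zero]
  · by_cases h1 : ab.1.1 = i ∧ ab.1.2 + 1 = j
    · obtain ⟨rfl, rfl⟩ := h1
      rw [if_pos (by simp), if_pos (by simp), LinearMap.lTensor_tmul]
      exact dB_yPow_zero k p hp _ _
    · rw [if_neg (by dsimp only; omega), if_neg (by omega), map_zero, smul_zero, smul_zero]

end Modules

/-! ### Exactness of the total complex of two resolutions of `k` -/

section Kunneth

variable (k : Type*) [Field k]

/-- `⋯ → C 1 → C 0 → k → 0` is an exact sequence of vector spaces. -/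
structure IsAcyclic (C : ℕ → Type*) [∀ i, AddCommGroup (C i)] [∀ i, Module k (C i)]
    (d : ∀ i, C (i + 1) →ₗ[k] C i) (ε : C 0 →ₗ[k] k) : Prop where
  exact_succ : ∀ n, Function.Exact (d (n + 1)) (d n)
  exact_zero : Function.Exact (d 0) ε
  surjective : Function.Surjective ε

/-- A contraction of an augmented complex of vector spaces onto `k`. -/
structure Contraction (C : ℕ → Type*) [∀ i, AddCommGroup (C i)] [∀ i, Module k (C i)]
    (d : ∀ i, C (i + 1) →ₗ[k] C i) (ε : C 0 →ₗ[k] k) where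
  s : ∀ i, C i →ₗ[k] C (i + 1)
  unit : k →ₗ[k] C 0
  aug_unit : ε ∘ₗ unit = LinearMap.id
  d_s_zero : d 0 ∘ₗ s 0 = LinearMap.id - unit ∘ₗ ε
  d_s_succ : ∀ i, d (i + 1) ∘ₗ s (i + 1) = LinearMap.id - s i ∘ₗ d i

variable {k}

/-- A linear map between vector spaces has a generalized inverse. -/
theorem exists_section_on_range {V W : Type*} [AddCommGroup V] [Module k V] [AddCommGroup W]
    [Module k W] (f : V →ₗ[k] W) :
    ∃ g : W →ₗ[k] V, ∀ w ∈ LinearMap.range f, f (g w) = w := by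
  obtain ⟨g, hg⟩ := f.rangeRestrict.exists_rightInverse_of_surjective f.range_rangeRestrict
  obtain ⟨g', hg'⟩ := LinearMap.exists_extend g
  refine ⟨g', fun w hw => ?_⟩
  have h1 : g' w = g ⟨w, hw⟩ := LinearMap.congr_fun hg' ⟨w, hw⟩
  have h2 := congrArg Subtype.val (LinearMap.congr_fun hg ⟨w, hw⟩)
  rw [h1]
  exact h2

theorem IsAcyclic.exists_contraction {C : ℕ → Type*} [∀ i, AddCommGroup (C i)]
    [∀ i, Module k (C i)] {d : ∀ i, C (i + 1) →ₗ[k] C i} {ε : C 0 →ₗ[k] k}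
    (h : IsAcyclic k C d ε) : Nonempty (Contraction k C d ε) := by
  obtain ⟨η, hη⟩ := ε.exists_rightInverse_of_surjective (LinearMap.range_eq_top.2 h.surjective)
  choose g hg using fun i => exists_section_on_range (d i)
  -- The homotopy is `g (1 - s d)` with `g` a section of `d` on its range. The identity one degree
  -- below shows that `1 - s d` takes values in cycles, hence by exactness in that range.
  let s : ∀ i, C i →ₗ[k] C (i + 1) := fun i => Nat.rec (motive := fun i => C i →ₗ[k] C (i + 1))
    (g 0 ∘ₗ (LinearMap.id - η ∘ₗ ε)) (fun i si => g (i + 1) ∘ₗ (LinearMap.id - si ∘ₗ d i)) i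
  have h0 : d 0 ∘ₗ s 0 = LinearMap.id - η ∘ₗ ε := by
    ext c
    refine hg 0 _ ((h.exact_zero _).1 ?_)
    have := LinearMap.congr_fun hη (ε c)
    simp only [LinearMap.comp_apply, LinearMap.id_apply] at this
    simp [this]
  refine ⟨⟨s, η, hη, h0, fun i => ?_⟩⟩
  induction i with
  | zero =>
    ext c
    refine hg 1 _ ((h.exact_succ 0 _).1 ?_)
    have h1 := LinearMap.congr_fun h0 (d 0 c)
    simp only [LinearMap.comp_apply, LinearMap.sub_apply, LinearMap.id_apply,
      h.exact_zero.apply_apply_eq_zero, map_zero, sub_zero] at h1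
    change d 0 (c - s 0 (d 0 c)) = 0
    rw [map_sub, h1, sub_self]
  | succ i ih =>
    ext c
    refine hg (i + 2) _ ((h.exact_succ (i + 1) _).1 ?_)
    have h1 := LinearMap.congr_fun ih (d (i + 1) c)
    simp only [LinearMap.comp_apply, LinearMap.sub_apply, LinearMap.id_apply,
      (h.exact_succ i).apply_apply_eq_zero, map_zero, sub_zero] at h1
    change d (i + 1) (c - s (i + 1) (d (i + 1) c)) = 0
    rw [map_sub, h1, sub_self]

variable {C D : ℕ → Type*} [∀ i, AddCommGroup (C i)] [∀ i, Module k (C i)]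
  [∀ i, AddCommGroup (D i)] [∀ i, Module k (D i)]
  {dC : ∀ i, C (i + 1) →ₗ[k] C i} {dD : ∀ j, D (j + 1) →ₗ[k] D j}
  {εC : C 0 →ₗ[k] k} {εD : D 0 →ₗ[k] k}

theorem map_sub_right {V W V' W' : Type*} [AddCommGroup V] [Module k V] [AddCommGroup W]
    [Module k W] [AddCommGroup V'] [Module k V'] [AddCommGroup W'] [Module k W']
    (f : V →ₗ[k] V') (g g' : W →ₗ[k] W') :
    TensorProduct.map f (g - g') = TensorProduct.map f g - TensorProduct.map f g' := by
  rw [eq_sub_iff_add_eq, ← TensorProduct.map_add_right, sub_add_cancel]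

theorem totD_apply (n : ℕ) (z : Tot k C D (n + 1)) (i j : ℕ) (h : i + j = n) :
    totD k dC dD n z ⟨(i, j), h⟩ =
      (dC i).rTensor (D j) (z ⟨(i + 1, j), by dsimp only; omega⟩) +
      (-1 : k) ^ i • (dD j).lTensor (C i) (z ⟨(i, j + 1), by dsimp only; omega⟩) := rfl

theorem totD_totD (hC : ∀ n, dC n ∘ₗ dC (n + 1) = 0) (hD : ∀ n, dD n ∘ₗ dD (n + 1) = 0) (n : ℕ)
    (z : Tot k C D (n + 2)) : totD k dC dD n (totD k dC dD (n + 1) z) = 0 := by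
  funext ij
  obtain ⟨⟨i, j⟩, h⟩ := ij
  rw [totD_apply, totD_apply, totD_apply]
  simp only [map_add, map_smul, pow_succ, mul_neg, mul_one, neg_smul, map_neg,
    ← LinearMap.comp_apply, ← LinearMap.rTensor_comp, ← LinearMap.lTensor_comp, hC, hD,
    LinearMap.rTensor_comp_lTensor, LinearMap.lTensor_comp_rTensor, LinearMap.rTensor_zero,
    LinearMap.lTensor_zero, LinearMap.zero_apply, smul_zero, add_zero, zero_add, neg_add_cancel,
    Pi.zero_apply]

/-- The contraction of a total complex, `c ⊗ d ↦ s c ⊗ d + η (ε c) ⊗ t d`. -/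
def totContraction (s : Contraction k C dC εC) (t : Contraction k D dD εD) {n : ℕ}
    (z : Tot k C D n) : Tot k C D (n + 1)
  | ⟨(0, 0), _⟩ => 0
  | ⟨(0, j + 1), h⟩ => TensorProduct.map (s.unit ∘ₗ εC) (t.s j)
      (z ⟨(0, j), by dsimp only at h ⊢; omega⟩)
  | ⟨(i + 1, j), h⟩ => (s.s i).rTensor (D j) (z ⟨(i, j), by dsimp only at h ⊢; omega⟩)

theorem IsAcyclic.d_comp_d {d : ∀ i, C (i + 1) →ₗ[k] C i} (h : IsAcyclic k C d εC) (n : ℕ) :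
    d n ∘ₗ d (n + 1) = 0 :=
  (h.exact_succ n).linearMap_comp_eq_zero

/-- The total homotopy contracts the first factor in every column and, after projecting the first
factor onto `k`, the second factor in column zero. A preimage of a cycle is its image under this
homotopy. -/
theorem IsAcyclic.tot_exact_succ (hC : IsAcyclic k C dC εC) (hD : IsAcyclic k D dD εD) (n : ℕ) :
    Function.Exact (totD k dC dD (n + 1)) (totD k dC dD n) := by
  obtain ⟨s⟩ := hC.exists_contraction
  obtain ⟨t⟩ := hD.exists_contraction
  intro z
  refine ⟨fun hz => ⟨totContraction s t z, ?_⟩, ?_⟩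
  · funext ij
    obtain ⟨⟨i, j⟩, h⟩ := ij
    cases i with
    | succ i =>
      have hij : i + j = n := by dsimp only at h; omega
      -- The cycle condition replaces `s d_C z` by a term in `d_D z` with the opposite sign, which
      -- cancels the vertical contribution since `s ⊗ 1` and `1 ⊗ d_D` commute.
      have h1 := congrArg ((s.s i).rTensor (D j)) (congrFun hz ⟨(i, j), hij⟩)
      rw [totD_apply, map_add, map_smul, Pi.zero_apply, map_zero, ← LinearMap.comp_apply,
        ← LinearMap.rTensor_comp] at h1
      rw [totD_apply]
      simp only [totContraction]
      rw [← LinearMap.comp_apply, ← LinearMap.rTensor_comp, s.d_s_succ, LinearMap.rTensor_sub,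
        LinearMap.sub_apply, LinearMap.rTensor_id, LinearMap.id_apply, eq_neg_of_add_eq_zero_left h1,
        sub_neg_eq_add, add_assoc]
      convert add_zero _
      rw [pow_succ, mul_neg, mul_one, neg_smul, ← LinearMap.comp_apply, ← LinearMap.comp_apply,
        LinearMap.rTensor_comp_lTensor, LinearMap.lTensor_comp_rTensor, add_neg_cancel]
    | zero =>
      obtain ⟨j, rfl⟩ : ∃ j', j = j' + 1 := ⟨j - 1, by dsimp only at h; omega⟩
      have hij : 0 + j = n := by dsimp only at h; omega
      -- In column zero the first contraction leaves the defect `η ε ⊗ 1`; the second one removes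
      -- it, and `ε d_C = 0` disposes of the neighbouring column.
      have h1 := congrArg (TensorProduct.map (s.unit ∘ₗ εC) (t.s j)) (congrFun hz ⟨(0, j), hij⟩)
      rw [totD_apply, map_add, map_smul, Pi.zero_apply, map_zero, pow_zero, one_smul,
        ← LinearMap.comp_apply, ← LinearMap.comp_apply, LinearMap.map_comp_rTensor,
        LinearMap.map_comp_lTensor, LinearMap.comp_assoc,
        hC.exact_zero.linearMap_comp_eq_zero, LinearMap.comp_zero, TensorProduct.map_zero_left,
        LinearMap.zero_apply, zero_add] at h1
      rw [totD_apply]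
      simp only [totContraction]
      rw [pow_zero, one_smul, ← LinearMap.comp_apply, ← LinearMap.comp_apply,
        ← LinearMap.rTensor_comp, LinearMap.lTensor_comp_map, s.d_s_zero, t.d_s_succ,
        map_sub_right, LinearMap.rTensor_sub, LinearMap.sub_apply,
        LinearMap.sub_apply, h1, LinearMap.rTensor_id, LinearMap.id_apply]
      simp [LinearMap.rTensor]
  · rintro ⟨w, rfl⟩
    exact totD_totD hC.d_comp_d hD.d_comp_d n w

theorem IsAcyclic.tot_exact_zero (hC : IsAcyclic k C dC εC) (hD : IsAcyclic k D dD εD) :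
    Function.Exact (totD k dC dD 0) (totAug k εC εD) := by
  obtain ⟨s⟩ := hC.exists_contraction
  obtain ⟨t⟩ := hD.exists_contraction
  intro z
  refine ⟨fun hz => ⟨totContraction s t z, ?_⟩, ?_⟩
  · funext ij
    obtain ⟨⟨i, j⟩, h⟩ := ij
    obtain rfl : i = 0 := by dsimp only at h; omega
    obtain rfl : j = 0 := by dsimp only at h; omega
    have h1 : TensorProduct.map εC εD (z ⟨(0, 0), h⟩) = 0 := by
      apply (TensorProduct.lid k k).injective
      rw [map_zero]
      exact hz
    have h2 := congrArg (TensorProduct.map s.unit t.unit) h1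
    rw [map_zero, ← LinearMap.comp_apply, ← TensorProduct.map_comp] at h2
    rw [totD_apply]
    simp only [totContraction]
    rw [pow_zero, one_smul, ← LinearMap.comp_apply, ← LinearMap.comp_apply,
      ← LinearMap.rTensor_comp, LinearMap.lTensor_comp_map, s.d_s_zero, t.d_s_zero,
      map_sub_right, LinearMap.rTensor_sub, LinearMap.sub_apply,
      LinearMap.sub_apply, h2, LinearMap.rTensor_id, LinearMap.id_apply]
    simp [LinearMap.rTensor]
  · rintro ⟨w, rfl⟩
    change LinearMap.mul' k k (TensorProduct.map εC εD (totD k dC dD 0 w ⟨(0, 0), rfl⟩)) = 0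
    rw [totD_apply, pow_zero, one_smul, map_add, ← LinearMap.comp_apply, ← LinearMap.comp_apply,
      LinearMap.map_comp_rTensor, LinearMap.map_comp_lTensor,
      hC.exact_zero.linearMap_comp_eq_zero, hD.exact_zero.linearMap_comp_eq_zero,
      TensorProduct.map_zero_left, TensorProduct.map_zero_right]
    simp

/-- The Künneth theorem for resolutions of `k`. -/
theorem IsAcyclic.tot (hC : IsAcyclic k C dC εC) (hD : IsAcyclic k D dD εD) :
    IsAcyclic k (Tot k C D) (totD k dC dD) (totAug k εC εD) where
  exact_succ := hC.tot_exact_succ hD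
  exact_zero := hC.tot_exact_zero hD
  surjective c := by
    obtain ⟨a, ha⟩ := hC.surjective c
    obtain ⟨b, hb⟩ := hD.surjective 1
    refine ⟨fun | ⟨(0, 0), _⟩ => a ⊗ₜ b | _ => 0, ?_⟩
    change LinearMap.mul' k k (TensorProduct.map εC εD (a ⊗ₜ b)) = c
    rw [TensorProduct.map_tmul, LinearMap.mul'_apply, ha, hb, mul_one]

end Kunneth

/-! ### Exactness of the three periodic complexes, of `K`, and freeness of `K` -/

section Periodic

variable (k : Type u) [Field k] (p q : ℕ)

theorem exact_mulLeft_root_pow {a b : ℕ} (h : a + b = p) :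
    Function.Exact (LinearMap.mulLeft k (root k p ^ a)) (LinearMap.mulLeft k (root k p ^ b)) := by
  intro z
  refine ⟨fun hz => ?_, ?_⟩
  · obtain ⟨f, rfl⟩ := AdjoinRoot.mk_surjective z
    rw [LinearMap.mulLeft_apply, root, AdjoinRoot.root, ← map_pow, ← map_mul,
      AdjoinRoot.mk_eq_zero, ← h, add_comm, pow_add,
      mul_dvd_mul_iff_left (pow_ne_zero _ Polynomial.X_ne_zero)] at hz
    obtain ⟨f, rfl⟩ := hz
    exact ⟨AdjoinRoot.mk _ f, by rw [map_mul, map_pow]; rfl⟩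
  · rintro ⟨w, rfl⟩
    rw [LinearMap.mulLeft_apply, LinearMap.mulLeft_apply, ← mul_assoc, ← pow_add, add_comm, h,
      root_pow, zero_mul]

theorem dTrunc_eq (i : ℕ) :
    dTrunc k p i = LinearMap.mulLeft k (root k p ^ (if Odd (i + 1) then 1 else p - 1)) := by
  rw [dTrunc]
  split_ifs <;> simp

theorem exact_dTrunc [Fact p.Prime] (n : ℕ) :
    Function.Exact (dTrunc k p (n + 1)) (dTrunc k p n) := by
  rw [dTrunc_eq, dTrunc_eq]
  apply exact_mulLeft_root_pow
  have hp := (Fact.out : p.Prime).pos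
  rcases Nat.even_or_odd (n + 1) with h | h
  · rw [if_pos h.add_one, if_neg (Nat.not_odd_iff_even.2 h)]
    omega
  · rw [if_neg (Nat.not_odd_iff_even.2 h.add_one), if_pos h]
    omega

theorem exact_dTrunc_augTrunc [Fact p.Prime] :
    Function.Exact (dTrunc k p 0) (augTrunc k p).toLinearMap := by
  rw [dTrunc, if_pos (by simp)]
  intro z
  refine ⟨fun hz => ?_, ?_⟩
  · obtain ⟨f, rfl⟩ := AdjoinRoot.mk_surjective z
    rw [AlgHom.toLinearMap_apply, augTrunc, AdjoinRoot.liftAlgHom_mk] at hz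
    have h1 : Polynomial.X ∣ f := by
      rw [Polynomial.X_dvd_iff, Polynomial.coeff_zero_eq_eval_zero]
      exact hz
    obtain ⟨f, rfl⟩ := h1
    exact ⟨AdjoinRoot.mk _ f, by rw [map_mul]; rfl⟩
  · rintro ⟨w, rfl⟩
    rw [AlgHom.toLinearMap_apply, LinearMap.mulLeft_apply, map_mul, augTrunc,
      AdjoinRoot.liftAlgHom_root, zero_mul]

theorem augTrunc_surjective [Fact p.Prime] : Function.Surjective (augTrunc k p).toLinearMap :=
  fun c => ⟨algebraMap k _ c, (augTrunc k p).commutes c⟩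

theorem isAcyclic_PA [Fact p.Prime] : IsAcyclic k (PA k p) (dA k p) (augPA k p) where
  exact_succ := exact_dTrunc k p
  exact_zero := exact_dTrunc_augTrunc k p
  surjective := augTrunc_surjective k p

theorem isAcyclic_PB [Fact p.Prime] : IsAcyclic k (PB k p) (dB k p) (augPB k p) where
  exact_succ := exact_dTrunc k p
  exact_zero := exact_dTrunc_augTrunc k p
  surjective := augTrunc_surjective k p

/-- Exactness concerns only the underlying vector spaces, so the twisted `R`-action is irrelevant
here. -/
theorem isAcyclic_K [Fact p.Prime] : IsAcyclic k (K k p) (dK k p) (augK k p) :=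
  (isAcyclic_PA k p).tot (isAcyclic_PB k p)

theorem isFreeResolution_K [Fact p.Prime] [CharP k p] :
    IsFreeResolution (R k p) (K k p) (dKR k p) (augKR k p) where
  free n := Module.Free.of_basis (basisK k p n)
  exact_succ := (isAcyclic_K k p).exact_succ
  exact_zero := (isAcyclic_K k p).exact_zero
  surjective := (isAcyclic_K k p).surjective

section Group

theorem g_pow_val [NeZero q] (h : G q) : g q ^ (h.toAdd.val) = h := by
  rw [g, ← ofAdd_nsmul, nsmul_one, ZMod.natCast_zmod_val]
  rfl

theorem g_pow_q : g q ^ q = 1 := by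
  rw [g, ← ofAdd_nsmul, nsmul_one, ZMod.natCast_self]
  rfl

variable [NeZero q]

/-- The norm element of `kG`. -/
def normG : MonoidAlgebra k (G q) := ∑ h : G q, MonoidAlgebra.of k (G q) h

theorem sum_range_eq_sum_G {M : Type*} [AddCommMonoid M] (f : G q → M) :
    ∑ s ∈ Finset.range q, f (g q ^ s) = ∑ h : G q, f h := by
  refine Finset.sum_nbij' (fun s => g q ^ s) (fun h => h.toAdd.val) (by simp) ?_ ?_ ?_ (by simp)
  · intro h _; simpa using ZMod.val_lt _
  · intro s hs
    rw [g, ← ofAdd_nsmul, nsmul_one]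
    exact ZMod.val_cast_of_lt (Finset.mem_range.1 hs)
  · intro h _; exact g_pow_val q h

theorem sum_range_of_eq_normG :
    ∑ s ∈ Finset.range q, MonoidAlgebra.of k (G q) (g q ^ s) = normG k q :=
  sum_range_eq_sum_G q _

theorem coeff_normG (h : G q) : (normG k q).coeff h = 1 := by
  classical
  simp [normG, MonoidAlgebra.of_apply, Finsupp.single_apply]

theorem normG_ne_zero : normG k q ≠ 0 := by
  intro h
  have := coeff_normG k q 1
  rw [h] at this
  simp at this

/-- The augmentation of `kG` as an algebra homomorphism. -/
def augMonoidAlgebra : MonoidAlgebra k (G q) →ₐ[k] k := MonoidAlgebra.lift k k (G q) 1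

theorem augMonoidAlgebra_of (h : G q) : augMonoidAlgebra k q (MonoidAlgebra.of k (G q) h) = 1 := by
  simp [augMonoidAlgebra]

theorem of_mul_normG (h : G q) : MonoidAlgebra.of k (G q) h * normG k q = normG k q := by
  simp only [normG, Finset.mul_sum, ← map_mul]
  exact Equiv.sum_comp (Equiv.mulLeft h) fun h => MonoidAlgebra.of k (G q) h

theorem normG_mul (f : MonoidAlgebra k (G q)) :
    normG k q * f = augMonoidAlgebra k q f • normG k q := by
  rw [mul_comm]
  induction f using MonoidAlgebra.induction_on with
  | of h => rw [of_mul_normG, augMonoidAlgebra_of, one_smul]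
  | add a b ha hb => rw [add_mul, ha, hb, map_add, add_smul]
  | smul c a ha => rw [smul_mul_assoc, ha, map_smul, smul_assoc]

/-- By linearity it is enough to treat group elements, where `g - 1` divides `g ^ s - 1`. -/
theorem of_g_sub_one_dvd (f : MonoidAlgebra k (G q)) :
    MonoidAlgebra.of k (G q) (g q) - 1 ∣ f - algebraMap k _ (augMonoidAlgebra k q f) := by
  induction f using MonoidAlgebra.induction_on with
  | of h =>
    rw [augMonoidAlgebra_of, map_one, ← g_pow_val q h, map_pow]
    simpa using sub_dvd_pow_sub_pow (MonoidAlgebra.of k (G q) (g q)) 1 h.toAdd.val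
  | add a b ha hb =>
    rw [map_add, map_add, add_sub_add_comm]
    exact dvd_add ha hb
  | smul c a ha =>
    rw [map_smul, smul_eq_mul, map_mul, ← Algebra.smul_def, ← smul_sub]
    exact dvd_smul_of_dvd c ha

theorem normG_mul_of_g_sub_one : normG k q * (MonoidAlgebra.of k (G q) (g q) - 1) = 0 := by
  rw [normG_mul, map_sub, augMonoidAlgebra_of, map_one, sub_self, zero_smul]

theorem exact_of_g_sub_one_aug : Function.Exact
    (LinearMap.mulLeft k (MonoidAlgebra.of k (G q) (g q) - 1))
    (augMonoidAlgebra k q).toLinearMap := by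
  intro f
  refine ⟨fun hf => ?_, ?_⟩
  · obtain ⟨w, hw⟩ := of_g_sub_one_dvd k q f
    rw [AlgHom.toLinearMap_apply] at hf
    rw [hf, map_zero, sub_zero] at hw
    exact ⟨w, hw.symm⟩
  · rintro ⟨w, rfl⟩
    rw [AlgHom.toLinearMap_apply, LinearMap.mulLeft_apply, map_mul, map_sub, augMonoidAlgebra_of,
      map_one, sub_self, zero_mul]

/-- Since `N f = ε(f) N` and `N ≠ 0`, the norm and the augmentation have the same kernel. -/
theorem exact_of_g_sub_one_normG : Function.Exact
    (LinearMap.mulLeft k (MonoidAlgebra.of k (G q) (g q) - 1))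
    (LinearMap.mulLeft k (normG k q)) := by
  intro f
  rw [← exact_of_g_sub_one_aug k q f, LinearMap.mulLeft_apply, normG_mul,
    smul_eq_zero_iff_left (normG_ne_zero k q)]
  rfl

/-- An element fixed by `g` has all its coefficients equal, so it is a scalar multiple of the norm.
-/
theorem exact_normG_of_g_sub_one : Function.Exact (LinearMap.mulLeft k (normG k q))
    (LinearMap.mulLeft k (MonoidAlgebra.of k (G q) (g q) - 1)) := by
  intro f
  refine ⟨fun hf => ⟨algebraMap k _ (f.coeff 1), ?_⟩, ?_⟩
  · rw [LinearMap.mulLeft_apply, sub_mul, one_mul, sub_eq_zero] at hf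
    have hs : ∀ s : ℕ, MonoidAlgebra.of k (G q) (g q ^ s) * f = f := by
      intro s
      induction s with
      | zero => rw [pow_zero, map_one, one_mul]
      | succ s ih => rw [pow_succ, map_mul, mul_assoc, hf, ih]
    have hc : ∀ h : G q, f.coeff h = f.coeff 1 := by
      intro h
      conv_lhs => rw [← hs h.toAdd.val, g_pow_val q, MonoidAlgebra.of_apply,
        MonoidAlgebra.coeff_single_mul_apply]
      simp
    rw [LinearMap.mulLeft_apply, mul_comm, ← Algebra.smul_def]
    ext h
    rw [hc h, MonoidAlgebra.coeff_smul, Finsupp.smul_apply, coeff_normG, smul_eq_mul, mul_one]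
  · rintro ⟨w, rfl⟩
    rw [LinearMap.mulLeft_apply, LinearMap.mulLeft_apply, ← mul_assoc, mul_comm _ (normG k q),
      normG_mul_of_g_sub_one, zero_mul]

theorem isAcyclic_PG : IsAcyclic k (PG k q) (dG k q) (augG k q) where
  exact_succ n := by
    rw [dG, dG]
    rw [sum_range_of_eq_normG]
    rcases Nat.even_or_odd (n + 1) with h | h
    · rw [if_pos h.add_one, if_neg (Nat.not_odd_iff_even.2 h)]
      exact exact_of_g_sub_one_normG k q
    · rw [if_neg (Nat.not_odd_iff_even.2 h.add_one), if_pos h]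
      exact exact_normG_of_g_sub_one k q
  exact_zero := by
    rw [dG, if_pos (by simp)]
    exact exact_of_g_sub_one_aug k q
  surjective c := ⟨algebraMap k (MonoidAlgebra k (G q)) c, (augMonoidAlgebra k q).commutes c⟩

end Group

end Periodic

/-! ### Semilinear maps determined by a basis -/

section Semilinear

variable {k : Type*} [Field k] {S : Type*} [Ring S] [Algebra k S] {ι M : Type*} [Fintype ι]
  [AddCommGroup M] [Module k M] [Module S M] [IsScalarTower k S M]

/-- The semilinear endomorphism, with respect to `σ`, with prescribed values on a basis. -/
def semilinearExt (b : Module.Basis ι S M) (σ : S →ₐ[k] S) (v : ι → M) : M →ₗ[k] M where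
  toFun z := ∑ i, σ (b.repr z i) • v i
  map_add' z w := by simp [add_smul, Finset.sum_add_distrib]
  map_smul' c z := by
    rw [← algebraMap_smul S c z]
    simp only [map_smul, Finsupp.smul_apply, smul_eq_mul, map_mul, AlgHom.commutes, mul_smul,
      Finset.smul_sum, RingHom.id_apply]
    simp only [algebraMap_smul]

theorem semilinearExt_smul (b : Module.Basis ι S M) (σ : S →ₐ[k] S) (v : ι → M) (r : S) (z : M) :
    semilinearExt b σ v (r • z) = σ r • semilinearExt b σ v z := by
  simp [semilinearExt, mul_smul, Finset.smul_sum]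

theorem semilinearExt_basis (b : Module.Basis ι S M) (σ : S →ₐ[k] S) (v : ι → M) (i : ι) :
    semilinearExt b σ v (b i) = v i := by
  classical
  change ∑ j, σ (b.repr (b i) j) • v j = v i
  rw [Finset.sum_eq_single i]
  · simp
  · intro j _ hj
    rw [b.repr_self, Finsupp.single_eq_of_ne hj, map_zero, zero_smul]
  · simp

/-- Stated for bare functions, so that it covers composites of semilinear maps with the
differential, powers of `g`, and the augmentation. -/
theorem eq_of_semilinear {N : Type*} [AddCommGroup N] [Module S N] (b : Module.Basis ι S M)
    (σ : S → S) (f f' : M → N) (hadd : ∀ z w, f (z + w) = f z + f w)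
    (hadd' : ∀ z w, f' (z + w) = f' z + f' w) (hf : ∀ r z, f (r • z) = σ r • f z)
    (hf' : ∀ r z, f' (r • z) = σ r • f' z) (h : ∀ i, f (b i) = f' (b i)) (z : M) : f z = f' z := by
  induction b.mem_span z using Submodule.span_induction with
  | zero =>
    have h0 := hadd 0 0
    have h0' := hadd' 0 0
    rw [add_zero, left_eq_add] at h0 h0'
    rw [h0, h0']
  | mem _ hz => obtain ⟨i, rfl⟩ := hz; exact h i
  | add a c _ _ ha hc => rw [hadd, hadd', ha, hc]
  | smul r a _ ha => rw [hf, hf', ha]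

end Semilinear

/-! ### The action of `G` on `K` -/

section Equivariance

variable (k : Type u) [Field k] (p q : ℕ) [Fact p.Prime] [CharP k p] [Fact (p ∣ q)]

theorem g_pow_smul (s : ℕ) (r : R k p) : g q ^ s • r = sigma k p (s : k) r := by
  change sigma k p (ZMod.castHom (Fact.out : p ∣ q) k (g q ^ s).toAdd) r = _
  rw [g, toAdd_pow, toAdd_ofAdd, nsmul_one, map_natCast]

theorem g_smul (r : R k p) : g q • r = sigma k p 1 r := by
  have := g_pow_smul k p q 1 r
  rwa [pow_one, Nat.cast_one] at this

/-- The coefficient of `φ_{i+1,j-1}` in `ᵍφ_{i,j}`. -/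
def twist (i j : ℤ) : R k p := if Odd i then 0 else if Odd j then 1 else alpha k p

instance (n : ℕ) : Fintype (Pairs n) := Fintype.ofFinite _

/-- The action of `g` on `K_n`. -/
def gAct (n : ℕ) : Module.End k (K k p n) :=
  semilinearExt (basisK k p n) (sigma k p 1) fun ij =>
    phi k p n ij.1.1 ij.1.2 + twist k p ij.1.1 ij.1.2 • phi k p n (ij.1.1 + 1) (ij.1.2 - 1)

theorem gAct_smul (n : ℕ) (r : R k p) (z : K k p n) :
    gAct k p n (r • z) = sigma k p 1 r • gAct k p n z := semilinearExt_smul ..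

theorem phi_eq_zero (n : ℕ) (i j : ℤ) (h : i < 0 ∨ j < 0 ∨ i + j ≠ n) : phi k p n i j = 0 := by
  funext ab
  rw [phi_apply, if_neg, Pi.zero_apply]
  have := ab.2
  omega

theorem gAct_phi (n : ℕ) (i j : ℤ) : gAct k p n (phi k p n i j) =
    phi k p n i j + twist k p i j • phi k p n (i + 1) (j - 1) := by
  by_cases h : i < 0 ∨ j < 0 ∨ i + j ≠ n
  · rw [phi_eq_zero k p n i j h, map_zero, zero_add]
    -- Only for `i = -1` can `φ_{i+1,j-1}` be nonzero while `φ_{i,j}` is zero; there the twist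
    -- vanishes because `-1` is odd.
    by_cases hi : i = -1
    · rw [twist, if_pos (by rw [hi]; decide), zero_smul]
    · rw [phi_eq_zero k p n _ _ (by omega), smul_zero]
  · obtain ⟨a, rfl⟩ := Int.eq_ofNat_of_zero_le (show 0 ≤ i by omega)
    obtain ⟨b, rfl⟩ := Int.eq_ofNat_of_zero_le (show 0 ≤ j by omega)
    have hab : a + b = n := by omega
    have := semilinearExt_basis (basisK k p n) (sigma k p 1) (fun ij =>
      phi k p n ij.1.1 ij.1.2 + twist k p ij.1.1 ij.1.2 • phi k p n (ij.1.1 + 1) (ij.1.2 - 1))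
      ⟨(a, b), hab⟩
    rwa [basisK_apply] at this

theorem gAct_phi_of_odd (n : ℕ) (i j : ℤ) (hi : Odd i) :
    gAct k p n (phi k p n i j) = phi k p n i j := by
  rw [gAct_phi, twist, if_pos hi, zero_smul, add_zero]

theorem gAct_pow_smul (n s : ℕ) (r : R k p) (z : K k p n) :
    (gAct k p n ^ s) (r • z) = (g q ^ s • r) • (gAct k p n ^ s) z := by
  induction s with
  | zero => simp
  | succ s ih =>
    rw [pow_succ', Module.End.mul_apply, ih, gAct_smul, ← Module.End.mul_apply, ← g_smul k p q,
      ← mul_smul, ← pow_succ']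

/-- If the twist is nonzero then `i + 1` is odd and `φ_{i+1,j-1}` is fixed, so each further
application of `g` only translates the old sum and adds one more twist. -/
theorem gAct_pow_phi (n s : ℕ) (i j : ℤ) : (gAct k p n ^ s) (phi k p n i j) =
    phi k p n i j + (∑ t ∈ Finset.range s, g q ^ t • twist k p i j) • phi k p n (i + 1) (j - 1) := by
  induction s with
  | zero => simp
  | succ s ih =>
    rw [pow_succ', Module.End.mul_apply, ih, map_add, gAct_smul, gAct_phi, Finset.sum_range_succ',
      pow_zero, one_smul, ← g_smul k p q, Finset.smul_sum]
    simp_rw [← mul_smul, ← pow_succ']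
    by_cases hi : Odd i
    · simp [twist, hi]
    · rw [gAct_phi_of_odd k p n (i + 1) _ (Int.not_odd_iff_even.1 hi).add_one, add_smul]
      abel

theorem sum_smul_one (s : ℕ) : ∑ t ∈ Finset.range s, g q ^ t • (1 : R k p) = ((s : k)) • 1 := by
  simp [Nat.cast_smul_eq_nsmul]

theorem sum_range_q_twist (hp : 2 < p) (i j : ℤ) :
    ∑ t ∈ Finset.range q, g q ^ t • twist k p i j = 0 := by
  rw [twist]
  split_ifs
  · simp
  · rw [sum_smul_one, (CharP.cast_eq_zero_iff k p q).2 Fact.out, zero_smul]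
  · simp_rw [g_pow_smul]
    exact sum_sigma_alpha k Fact.out hp

theorem gAct_pow_q (hp : 2 < p) (n : ℕ) : gAct k p n ^ q = 1 := by
  refine LinearMap.ext fun z => ?_
  refine eq_of_semilinear (basisK k p n) (fun r => g q ^ q • r) _ _ (map_add _) (map_add _)
    (gAct_pow_smul k p q n q) ?_ ?_ z
  · intro r z
    rw [g_pow_q, one_smul]; rfl
  · intro ij
    rw [basisK_apply, gAct_pow_phi k p q, sum_range_q_twist k p q hp, zero_smul, add_zero]; rfl

theorem sigma_coeffX (c : k) (i : ℕ) : sigma k p c (coeffX k p i) = coeffX k p i := by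
  rw [coeffX]
  split_ifs
  · rw [map_pow, sigma_x]
  · rw [sigma_x]

theorem coeffY_eq_of_odd_of_even (hp : 2 < p) (i j : ℕ) (hi : Odd i) (hj : Even j) :
    coeffY k p i j = -(y k p + (-2⁻¹ : k) • x k p) ^ (p - 1) := by
  rw [coeffY, if_neg (Nat.not_even_iff_odd.2 hi), if_pos hj, sub_half_pow k hp]

/-- Equality of the coefficients of `φ_{i,j-1}` in `d (g φ_{i,j})` and `g (d φ_{i,j})`. When `j` is
even it is the formula for `α x` (`i` even) or for `x α` (`i` odd); when `j` is odd it is linear in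
`x` and `y`. -/
theorem coeffY_add_twist_mul (hp : 2 < p) (i j : ℕ) :
    coeffY k p i j + twist k p i j * coeffX k p (i + 1) =
      coeffX k p i * twist k p (i - 1) j + sigma k p 1 (coeffY k p i j) := by
  have h2 := two_ne_zero_of_lt k p hp
  have hh : (-2⁻¹ : k) + 1 = 2⁻¹ := by field_simp; norm_num
  rcases Nat.even_or_odd i with hi | hi
  · have hi' : ¬ Odd (i : ℤ) := by simpa using hi
    have hi1 : Odd ((i : ℤ) - 1) := by
      rw [Int.odd_sub]; simpa using hi
    rw [twist, twist, if_pos hi1, if_neg hi', coeffX, if_neg (Nat.not_even_iff_odd.2 hi.add_one),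
      coeffY, if_pos hi, mul_zero, zero_add]
    rcases Nat.even_or_odd j with hj | hj
    · rw [if_pos hj, if_neg (by simpa using hj), alpha_mul_x k hp, map_pow, sigma_y, one_smul]
      abel
    · rw [if_neg (Nat.not_even_iff_odd.2 hj), if_pos (by simpa using hj), one_mul, sigma_y, one_smul]
  · have hi' : Odd (i : ℤ) := by simpa using hi
    have hi1 : ¬ Odd ((i : ℤ) - 1) := by
      rw [Int.odd_sub]; simpa using hi
    rw [twist, twist, if_neg hi1, if_pos hi', zero_mul, add_zero, coeffX,
      if_neg (Nat.not_even_iff_odd.2 hi)]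
    rcases Nat.even_or_odd j with hj | hj
    · rw [coeffY_eq_of_odd_of_even k p hp i j hi hj, if_neg (by simpa using hj), x_mul_alpha k hp,
        map_neg, map_pow, sigma_add_smul, hh]
      abel
    · rw [coeffY, if_neg (Nat.not_even_iff_odd.2 hi), if_neg (Nat.not_even_iff_odd.2 hj),
        if_pos (by simpa using hj), mul_one, sub_eq_add_neg, ← neg_smul, map_neg, sigma_add_smul, hh]
      have : x k p = (2⁻¹ : k) • x k p + (2⁻¹ : k) • x k p := by
        rw [← add_smul, show (2⁻¹ : k) + 2⁻¹ = 1 by field_simp; norm_num, one_smul]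
      nth_rw 2 [this]
      rw [neg_smul]
      abel

/-- Equality of the coefficients of `φ_{i+1,j-1}` in `d (g φ_{i,j+1})` and `g (d φ_{i,j+1})`. For
even `i` it is the formula for `(y + x) α` or for `α (y - x / 2)`, according to the parity of `j`.
-/
theorem twist_mul_coeffY (hp : 2 < p) (i j : ℕ) :
    twist k p i (j + 1) * coeffY k p (i + 1) j =
      sigma k p 1 (coeffY k p i (j + 1)) * twist k p i j := by
  rcases Nat.even_or_odd i with hi | hi
  · have hi' : ¬ Odd (i : ℤ) := by simpa using hi
    rw [twist, twist, if_neg hi', if_neg hi', coeffY, coeffY, if_pos hi,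
      if_neg (Nat.not_even_iff_odd.2 hi.add_one)]
    rcases Nat.even_or_odd j with hj | hj
    · have hj1 : Odd ((j : ℤ) + 1) := by exact_mod_cast hj.add_one
      have hj' : ¬ Odd (j : ℤ) := by simpa using hj
      rw [if_pos hj1, if_neg hj', if_pos hj, if_neg (Nat.not_even_iff_odd.2 hj.add_one), sigma_y,
        one_smul, y_add_x_mul_alpha k hp, sub_half_pow k hp, one_mul]
    · have hj1 : ¬ Odd ((j : ℤ) + 1) := by
        rw [Int.not_odd_iff_even]; exact_mod_cast hj.add_one
      have hj' : Odd (j : ℤ) := by simpa using hj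
      rw [if_neg hj1, if_pos hj', if_neg (Nat.not_even_iff_odd.2 hj), if_pos hj.add_one, map_pow,
        sigma_y, one_smul, mul_neg, alpha_mul_y_sub_half_x k hp, neg_neg, mul_one]
  · have hi' : Odd (i : ℤ) := by simpa using hi
    rw [twist, twist, if_pos hi', if_pos hi', zero_mul, mul_zero]

theorem dK_smul (n : ℕ) (r : R k p) (z : K k p (n + 1)) :
    dK k p n (r • z) = r • dK k p n z := (dKR k p n).map_smul r z

theorem dK_gAct_phi (hp : 2 < p) (n i j : ℕ) (h : i + j = n + 1) :
    dK k p n (gAct k p (n + 1) (phi k p (n + 1) i j)) =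
      gAct k p n (dK k p n (phi k p (n + 1) i j)) := by
  rw [gAct_phi, map_add, dK_smul, dK_phi k p hp n i j h, map_add, gAct_smul, gAct_smul, gAct_phi,
    gAct_phi, sigma_coeffX, sub_add_cancel]
  have e1 := coeffY_add_twist_mul k p hp i j
  cases j with
  | zero =>
    rw [phi_eq_zero k p (n + 1) _ _ (by omega), phi_eq_zero k p n i _ (by omega),
      phi_eq_zero k p n (i + 1) _ (by omega)]
    simp
  | succ j =>
    have e2 := twist_mul_coeffY k p hp i j
    have h3 := dK_phi k p hp n (i + 1) j (by omega)
    push_cast at h3 e1 e2 ⊢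
    rw [add_sub_cancel_right] at h3 ⊢
    rw [h3]
    simp only [smul_add, ← mul_smul, e2]
    rw [eq_sub_of_add_eq' e1]
    simp only [sub_smul, add_smul, mul_smul]
    abel

theorem dK_gAct (hp : 2 < p) (n : ℕ) (z : K k p (n + 1)) :
    dK k p n (gAct k p (n + 1) z) = gAct k p n (dK k p n z) := by
  refine eq_of_semilinear (basisK k p (n + 1)) (sigma k p 1) (fun z => dK k p n (gAct k p (n + 1) z))
    (fun z => gAct k p n (dK k p n z)) ?_ ?_ ?_ ?_ ?_ z
  · intro z w; simp only [map_add]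
  · intro z w; simp only [map_add]
  · intro r z; simp only [gAct_smul, dK_smul]
  · intro r z; simp only [gAct_smul, dK_smul]
  · intro ij
    simp only [basisK_apply]
    exact dK_gAct_phi k p hp n _ _ ij.2

theorem dK_gAct_pow (hp : 2 < p) (n s : ℕ) (z : K k p (n + 1)) :
    dK k p n ((gAct k p (n + 1) ^ s) z) = (gAct k p n ^ s) (dK k p n z) := by
  induction s with
  | zero => rfl
  | succ s ih => rw [pow_succ', pow_succ', Module.End.mul_apply, Module.End.mul_apply,
      dK_gAct k p hp, ih]

variable [NeZero q]

/-- The representation of `G` on `K_n`. -/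
def rhoK (hp : 2 < p) (n : ℕ) : Representation k (G q) (K k p n) where
  toFun h := gAct k p n ^ h.toAdd.val
  map_one' := by simp
  map_mul' a b := by
    rw [toAdd_mul, ZMod.val_add, ← pow_eq_pow_mod _ (gAct_pow_q k p q hp n), pow_add]

theorem rhoK_g_pow (hp : 2 < p) (n s : ℕ) : rhoK k p q hp n (g q ^ s) = gAct k p n ^ s := by
  change gAct k p n ^ (g q ^ s).toAdd.val = _
  rw [g, toAdd_pow, toAdd_ofAdd, nsmul_one, ZMod.val_natCast,
    ← pow_eq_pow_mod _ (gAct_pow_q k p q hp n)]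

/-- The `G`-equivariant structure of `K`. -/
def equivariantK (hp : 2 < p) : EquivariantAction k (R k p) (G q) (K k p) (dK k p) where
  rho := rhoK k p q hp
  semilinear n h r z := by
    rw [← g_pow_val q h, rhoK_g_pow, gAct_pow_smul k p q]
  comm_d n h z := by
    rw [← g_pow_val q h, rhoK_g_pow, rhoK_g_pow, dK_gAct_pow k p hp]

theorem equivariantK_phi (hp : 2 < p) (n s : ℕ) (i j : ℤ) :
    (equivariantK k p q hp).rho n (g q ^ s) (phi k p n i j) = phi k p n i j +
      (∑ t ∈ Finset.range s, g q ^ t • twist k p i j) • phi k p n (i + 1) (j - 1) := by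
  change rhoK k p q hp n (g q ^ s) _ = _
  rw [rhoK_g_pow, gAct_pow_phi k p q]

theorem equivariantK_phi_of_odd (hp : 2 < p) (n : ℕ) (h : G q) (i j : ℤ) (hi : Odd i) :
    (equivariantK k p q hp).rho n h (phi k p n i j) = phi k p n i j := by
  rw [← g_pow_val q h, equivariantK_phi, twist, if_pos hi]
  simp

theorem equivariantK_inv_phi (hp : 2 < p) (n s : ℕ) (i j : ℤ) :
    (equivariantK k p q hp).rho n (g q ^ s)⁻¹ (phi k p n i j) = phi k p n i j -
      (∑ t ∈ Finset.Icc 1 s, (g q ^ t)⁻¹ • twist k p i j) • phi k p n (i + 1) (j - 1) := by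
  set E := equivariantK k p q hp
  by_cases hi : Odd i
  · rw [equivariantK_phi_of_odd k p q hp n _ i j hi, twist, if_pos hi]
    simp
  · have hi1 := (Int.not_odd_iff_even.1 hi).add_one
    have h := congrArg (E.rho n (g q ^ s)⁻¹) (equivariantK_phi k p q hp n s i j)
    rw [← Module.End.mul_apply, ← map_mul, inv_mul_cancel, map_one, Module.End.one_apply, map_add,
      E.semilinear, equivariantK_phi_of_odd k p q hp n _ _ _ hi1] at h
    rw [eq_sub_iff_add_eq]
    suffices hs : ∑ t ∈ Finset.Icc 1 s, (g q ^ t)⁻¹ • twist k p i j =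
        (g q ^ s)⁻¹ • ∑ t ∈ Finset.range s, g q ^ t • twist k p i j by rw [hs, ← h]
    rw [Finset.smul_sum]
    -- Translating by `g ^ (-s)` turns the exponents `0, …, s - 1` into `-s, …, -1`, whence the
    -- reflection and the range starting at `1`.
    refine Finset.sum_nbij' (fun t => s - t) (fun t => s - t) ?_ ?_ ?_ ?_ ?_
    · intro t ht; simp at ht ⊢; omega
    · intro t ht; simp at ht ⊢; omega
    · intro t ht; simp at ht ⊢; omega
    · intro t ht; simp at ht ⊢; omega
    · intro t ht
      rw [Finset.mem_Icc] at ht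
      rw [← mul_smul]
      congr 1
      rw [eq_inv_mul_iff_mul_eq, mul_inv_eq_iff_eq_mul, ← pow_add, Nat.sub_add_cancel ht.2]

end Equivariance

/-! ### The complex `Y` over `R # kG`: linear differentials, bases, exactness -/

section Smash

variable {k : Type u} [Field k] {p q : ℕ} [Fact p.Prime] [CharP k p] [Fact (p ∣ q)]
  (E : EquivariantAction k (R k p) (G q) (K k p) (dK k p))

/-- The element `z ⊗ v` of `K_a ⊗ P_b(kG)`. -/
def ytmul (a b : ℕ) : K k p a →ₗ[k] PG k q b →ₗ[k] YSummand E a b :=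
  TensorProduct.mk k (K k p a) (PG k q b)

/-- The element `h` of `P_b(kG) = kG`. -/
def ofPG (k : Type u) [Field k] (q b : ℕ) (h : G q) : PG k q b := MonoidAlgebra.of k (G q) h

theorem regG_genPG (b : ℕ) (h : G q) : regG k q b h (genPG k q b) = ofPG k q b h :=
  mul_one (MonoidAlgebra.of k (G q) h)

theorem YSummand.induction {a b : ℕ} {P : YSummand E a b → Prop}
    (tmul : ∀ z v, P (ytmul E a b z v)) (add : ∀ w w', P w → P w' → P (w + w'))
    (w : YSummand E a b) : P w :=
  TensorProduct.induction_on w (by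
    have h := tmul 0 0
    rw [map_zero] at h
    exact h) tmul add

theorem PG_induction {b : ℕ} {P : PG k q b → Prop} (of : ∀ h, P (ofPG k q b h))
    (add : ∀ v v', P v → P v' → P (v + v')) (smul : ∀ (c : k) v, P v → P (c • v))
    (v : PG k q b) : P v :=
  MonoidAlgebra.induction_on (motive := P) v of add smul

theorem single_smul_ytmul (a b : ℕ) (h : G q) (r : R k p) (z : K k p a) (v : PG k q b) :
    (SkewMonoidAlgebra.single h r : Bos k p q) • ytmul E a b z v =
      ytmul E a b (r • E.rho a h z) (regG k q b h v) := by
  change smashHom E a b (SkewMonoidAlgebra.single h r) (z ⊗ₜ v) = _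
  rw [smashHom]
  erw [SkewMonoidAlgebra.liftNC_single]
  rfl

theorem ofR_smul_ytmul (a b : ℕ) (r : R k p) (z : K k p a) (v : PG k q b) :
    ofR k p q r • ytmul E a b z v = ytmul E a b (r • z) v := by
  rw [ofR, single_smul_ytmul, map_one, map_one]; rfl

theorem ofG_smul_ytmul (a b : ℕ) (h : G q) (z : K k p a) (v : PG k q b) :
    ofG k p q h • ytmul E a b z v = ytmul E a b (E.rho a h z) (regG k q b h v) := by
  rw [ofG, single_smul_ytmul, one_smul]

instance (a b : ℕ) : IsScalarTower k (Bos k p q) (YSummand E a b) where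
  smul_assoc c s w := by
    change smashHom E a b (c • s) w = c • smashHom E a b s w
    rw [map_smul]; rfl

/-- A map on `R # kG`-modules is linear if it commutes with the elements `r h`. -/
theorem map_Bos_smul {M N : Type*} [AddCommGroup M] [Module (Bos k p q) M]
    [AddCommGroup N] [Module (Bos k p q) N] (f : M →+ N)
    (hf : ∀ (h : G q) (r : R k p) z, f ((SkewMonoidAlgebra.single h r : Bos k p q) • z) =
      (SkewMonoidAlgebra.single h r : Bos k p q) • f z) (s : Bos k p q) (z : M) :
    f (s • z) = s • f z := by
  induction s using SkewMonoidAlgebra.induction_on with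
  | zero => simp
  | single h r => exact hf h r z
  | add a b ha hb => rw [add_smul, map_add, ha, hb, add_smul]

/-- The differential `d ⊗ 1` on the summands of `Y` as a `k`-linear map. -/
def dKYLinear (a b : ℕ) : YSummand E (a + 1) b →ₗ[k] YSummand E a b :=
  (dK k p a).rTensor (PG k q b)

/-- The differential `d ⊗ 1` on the summands of `Y`. -/
def dKY (a b : ℕ) : YSummand E (a + 1) b →ₗ[Bos k p q] YSummand E a b where
  __ := dKYLinear E a b
  map_smul' s w := by
    refine map_Bos_smul (dKYLinear E a b).toAddMonoidHom ?_ s w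
    intro h r w
    induction w using YSummand.induction with
    | add w w' hw hw' => rw [smul_add, map_add, hw, hw', map_add, smul_add]
    | tmul z v =>
      rw [single_smul_ytmul]
      change ytmul E a b (dK k p a (r • E.rho (a + 1) h z)) (regG k q b h v) =
        (SkewMonoidAlgebra.single h r : Bos k p q) • ytmul E a b (dK k p a z) v
      rw [single_smul_ytmul, dK_smul, E.comm_d]

theorem dKY_ytmul (a b : ℕ) (z : K k p (a + 1)) (v : PG k q b) :
    dKY E a b (ytmul E (a + 1) b z v) = ytmul E a b (dK k p a z) v := rfl

theorem dG_regG (b : ℕ) (h : G q) (v : PG k q (b + 1)) :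
    dG k q b (regG k q (b + 1) h v) = regG k q b h (dG k q b v) :=
  mul_left_comm (G := MonoidAlgebra k (G q)) _ _ _

/-- The differential `1 ⊗ d` on the summands of `Y` as a `k`-linear map. -/
def dGYLinear (a b : ℕ) : YSummand E a (b + 1) →ₗ[k] YSummand E a b :=
  (dG k q b).lTensor (K k p a)

/-- The differential `1 ⊗ d` on the summands of `Y`. -/
def dGY (a b : ℕ) : YSummand E a (b + 1) →ₗ[Bos k p q] YSummand E a b where
  __ := dGYLinear E a b
  map_smul' s w := by
    refine map_Bos_smul (dGYLinear E a b).toAddMonoidHom ?_ s w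
    intro h r w
    induction w using YSummand.induction with
    | add w w' hw hw' => rw [smul_add, map_add, hw, hw', map_add, smul_add]
    | tmul z v =>
      rw [single_smul_ytmul]
      change ytmul E a b (r • E.rho a h z) (dG k q b (regG k q (b + 1) h v)) =
        (SkewMonoidAlgebra.single h r : Bos k p q) • ytmul E a b z (dG k q b v)
      rw [single_smul_ytmul, dG_regG]

theorem dGY_ytmul (a b : ℕ) (z : K k p a) (v : PG k q (b + 1)) :
    dGY E a b (ytmul E a (b + 1) z v) = ytmul E a b z (dG k q b v) := rfl

/-- The differential of `Y` as an `R # kG`-linear map. -/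
def dYB (n : ℕ) : Y E (n + 1) →ₗ[Bos k p q] Y E n :=
  LinearMap.pi fun ab =>
    dKY E ab.1.1 ab.1.2 ∘ₗ LinearMap.proj (R := Bos k p q)
        (φ := fun ab : Pairs (n + 1) => YSummand E ab.1.1 ab.1.2)
        ⟨(ab.1.1 + 1, ab.1.2), by have := ab.2; dsimp only; omega⟩ +
      (-1 : k) ^ ab.1.1 • (dGY E ab.1.1 ab.1.2 ∘ₗ LinearMap.proj (R := Bos k p q)
        (φ := fun ab : Pairs (n + 1) => YSummand E ab.1.1 ab.1.2)
        ⟨(ab.1.1, ab.1.2 + 1), by have := ab.2; dsimp only; omega⟩)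

theorem dYB_eq (n : ℕ) (z : Y E (n + 1)) : dYB E n z = dY E n z := rfl

theorem dYB_apply (n : ℕ) (z : Y E (n + 1)) (ab : Pairs n) : dYB E n z ab =
    dKY E ab.1.1 ab.1.2 (z ⟨(ab.1.1 + 1, ab.1.2), by have := ab.2; dsimp only; omega⟩) +
      (-1 : k) ^ ab.1.1 •
        dGY E ab.1.1 ab.1.2 (z ⟨(ab.1.1, ab.1.2 + 1), by have := ab.2; dsimp only; omega⟩) := rfl

theorem Bos_smul_triv (s : Bos k p q) (c : k) :
    s • toTriv k c = toTriv k (augBos k p q s * c) := rfl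

theorem augBos_single (h : G q) (r : R k p) : augBos k p q (SkewMonoidAlgebra.single h r) =
    augR k p (Fact.out : p.Prime).ne_zero r := by
  rw [augBos]
  erw [SkewMonoidAlgebra.liftNC_single]
  exact mul_one _

/-- The augmentation on the summand `K_0 ⊗ P_0(kG)`. -/
def augYSummand : YSummand E 0 0 →ₗ[k] k :=
  LinearMap.mul' k k ∘ₗ TensorProduct.map (augK k p) (augG k q)

theorem augYSummand_ytmul (z : K k p 0) (v : PG k q 0) :
    augYSummand E (ytmul E 0 0 z v) = augK k p z * augG k q v := rfl

theorem augG_regG (h : G q) (v : PG k q 0) : augG k q (regG k q 0 h v) = augG k q v := by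
  have key : ∀ f : MonoidAlgebra k (G q), augMonoidAlgebra k q (MonoidAlgebra.of k (G q) h * f) =
      augMonoidAlgebra k q f := by
    intro f
    rw [map_mul]
    simp [augMonoidAlgebra]
  exact key v

/-- The augmentation of `Y` as an `R # kG`-linear map. -/
def augYB (hE : ∀ h z, augK k p (E.rho 0 h z) = augK k p z) : Y E 0 →ₗ[Bos k p q] Triv k where
  toFun z := toTriv k (augY E z)
  map_add' a b := by rw [map_add, map_add]
  map_smul' s z := by
    refine map_Bos_smul ((toTriv k).toLinearMap ∘ₗ augY E).toAddMonoidHom ?_ s z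
    intro h r z
    change toTriv k (augYSummand E ((SkewMonoidAlgebra.single h r : Bos k p q) • z ⟨(0, 0), rfl⟩)) =
      (SkewMonoidAlgebra.single h r : Bos k p q) • toTriv k (augYSummand E (z ⟨(0, 0), rfl⟩))
    rw [Bos_smul_triv, augBos_single]
    congr 1
    induction z ⟨(0, 0), rfl⟩ using YSummand.induction with
    | add w w' hw hw' => rw [smul_add, map_add, hw, hw', map_add, mul_add]
    | tmul z v =>
      rw [single_smul_ytmul, augYSummand_ytmul, augYSummand_ytmul, augK_smul, hE, augG_regG,
        mul_assoc]

/-- The coefficient of `h` in an element of `K_a ⊗ kG`. -/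
def coeffAt (a b : ℕ) (h : G q) : YSummand E a b →ₗ[k] K k p a :=
  (TensorProduct.rid k (K k p a)).toLinearMap ∘ₗ LinearMap.lTensor (K k p a)
    ({ toFun := fun v : MonoidAlgebra k (G q) => v.coeff h
       map_add' := fun _ _ => rfl
       map_smul' := fun _ _ => rfl } : PG k q b →ₗ[k] k)

theorem coeffAt_ytmul_ofPG (a b : ℕ) (h h' : G q) (z : K k p a) [Decidable (h' = h)] :
    coeffAt E a b h (ytmul E a b z (ofPG k q b h')) = if h' = h then z else 0 := by
  change (MonoidAlgebra.of k (G q) h').coeff h • z = _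
  rw [MonoidAlgebra.of_apply, MonoidAlgebra.coeff_single, Finsupp.single_apply]
  split_ifs <;> simp

/-- The group component of `z ⊗ 1` records which `h` has acted, so the coefficients of `s` can be
read off one at a time. -/
theorem coeffAt_smul (a b : ℕ) (h : G q) (s : Bos k p q) (z : K k p a) :
    coeffAt E a b h (s • ytmul E a b z (genPG k q b)) = s.coeff h • E.rho a h z := by
  classical
  induction s using SkewMonoidAlgebra.induction_on with
  | zero => simp
  | single h' r =>
    rw [single_smul_ytmul, regG_genPG, coeffAt_ytmul_ofPG, SkewMonoidAlgebra.coeff_single,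
      Finsupp.single_apply]
    split_ifs with hh
    · rw [hh]
    · simp
  | add s t hs ht =>
    rw [add_smul, map_add, hs, ht, SkewMonoidAlgebra.coeff_add, Finsupp.add_apply, add_smul]

/-- Taking the coefficient at `h` of a relation and applying `h⁻¹` undoes the twist and leaves an
`R`-linear relation among the basis of `K_a`, with coefficients translated by `h⁻¹`. -/
theorem linearIndependent_ytmul {ι : Type*} [Fintype ι] {a : ℕ} (c : Module.Basis ι (R k p) (K k p a))
    (b : ℕ) : LinearIndependent (Bos k p q) fun i => ytmul E a b (c i) (genPG k q b) := by
  rw [Fintype.linearIndependent_iff]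
  intro s hs i
  ext h
  have h1 := congrArg (fun w => E.rho a h⁻¹ (coeffAt E a b h w)) hs
  simp only [map_sum, coeffAt_smul, E.semilinear, map_zero, ← Module.End.mul_apply, ← map_mul,
    inv_mul_cancel, map_one, Module.End.one_apply] at h1
  have h2 := Fintype.linearIndependent_iff.1 c.linearIndependent _ h1 i
  rwa [smul_eq_zero_iff_eq] at h2

/-- Every tensor `z ⊗ h` equals `h (h⁻¹ z ⊗ 1)`, and `R` acts on `z ⊗ 1` through the first factor
only. -/
theorem span_ytmul {ι : Type*} {a : ℕ} (c : Module.Basis ι (R k p) (K k p a)) (b : ℕ) :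
    ⊤ ≤ Submodule.span (Bos k p q) (Set.range fun i => ytmul E a b (c i) (genPG k q b)) := by
  set N := Submodule.span (Bos k p q) (Set.range fun i => ytmul E a b (c i) (genPG k q b))
  have h1 : ∀ z, ytmul E a b z (genPG k q b) ∈ N := by
    intro z
    induction c.mem_span z using Submodule.span_induction with
    | zero => rw [map_zero]; exact N.zero_mem
    | mem _ hz => obtain ⟨i, rfl⟩ := hz; exact Submodule.subset_span ⟨i, rfl⟩
    | add _ _ _ _ ha hb => rw [map_add]; exact N.add_mem ha hb
    | smul r _ _ ha => rw [← ofR_smul_ytmul]; exact N.smul_mem _ ha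
  intro w hw
  clear hw
  induction w using YSummand.induction with
  | add _ _ ha hb => exact N.add_mem ha hb
  | tmul z v =>
    induction v using PG_induction with
    | of h =>
      have h2 := ofG_smul_ytmul E a b h (E.rho a h⁻¹ z) (genPG k q b)
      rw [← Module.End.mul_apply, ← map_mul, mul_inv_cancel, map_one, Module.End.one_apply,
        regG_genPG] at h2
      rw [← h2]
      exact N.smul_mem _ (h1 _)
    | add _ _ ha hb => rw [map_add]; exact N.add_mem ha hb
    | smul c _ ha => rw [map_smul, ← algebraMap_smul (Bos k p q)]; exact N.smul_mem _ ha

/-- The basis `φ_{i,j} ⊗ φ_b` of `K_a ⊗ P_b(kG)` over `R # kG`. -/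
def basisYSummand (a b : ℕ) : Module.Basis (Pairs a) (Bos k p q) (YSummand E a b) :=
  Module.Basis.mk (linearIndependent_ytmul E (basisK k p a) b) (span_ytmul E (basisK k p a) b)

theorem basisYSummand_apply (a b : ℕ) (ij : Pairs a) :
    basisYSummand E a b ij = ytmul E a b (phi k p a ij.1.1 ij.1.2) (genPG k q b) := by
  rw [basisYSummand, Module.Basis.mk_apply, basisK_apply]

/-- A triple is a pair whose first entry is split into a pair. -/
def sigmaPairsEquiv (n : ℕ) : (Σ ab : Pairs n, Pairs ab.1.1) ≃ Triples n where
  toFun s := ⟨(s.2.1.1, s.2.1.2, s.1.1.2), by have := s.1.2; have := s.2.2; dsimp only; omega⟩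
  invFun t := ⟨⟨(t.1.1 + t.1.2.1, t.1.2.2), t.2⟩, ⟨(t.1.1, t.1.2.1), rfl⟩⟩
  left_inv := by
    rintro ⟨⟨⟨a, b⟩, h⟩, ⟨⟨i, j⟩, h'⟩⟩
    dsimp only at h'
    subst h'
    rfl
  right_inv _ := rfl

/-- The basis `φ_{i,j,l}` of `Y_n` over `R # kG`. -/
def basisY (n : ℕ) : Module.Basis (Triples n) (Bos k p q) (Y E n) :=
  (Pi.basis fun ab : Pairs n => basisYSummand E ab.1.1 ab.1.2).reindex (sigmaPairsEquiv n)

theorem phi3_apply (n : ℕ) (i j l : ℤ) (ab : Pairs n) : phi3 E n i j l ab =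
    if (ab.1.2 : ℤ) = l then ytmul E ab.1.1 ab.1.2 (phi k p ab.1.1 i j) (genPG k q ab.1.2)
    else 0 := rfl

theorem basisY_apply (n : ℕ) (t : Triples n) :
    basisY E n t = phi3 E n t.1.1 t.1.2.1 t.1.2.2 := by
  classical
  rw [basisY, Module.Basis.reindex_apply, Pi.basis_apply]
  funext ab
  rw [phi3_apply]
  by_cases h : (ab.1.2 : ℤ) = t.1.2.2
  · have hab : ab = ((sigmaPairsEquiv n).symm t).1 := by
      have h1 := ab.2
      have h2 := t.2
      refine Subtype.ext (Prod.ext ?_ ?_) <;> simp [sigmaPairsEquiv] <;> omega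
    subst hab
    rw [if_pos h, Pi.single_eq_same, basisYSummand_apply]
    rfl
  · rw [if_neg h, Pi.single_eq_of_ne]
    rintro rfl
    exact h rfl

theorem isFreeResolution_Y [NeZero q] (hE : ∀ h z, augK k p (E.rho 0 h z) = augK k p z) :
    IsFreeResolution (Bos k p q) (Y E) (dYB E) (augYB E hE) where
  free n := Module.Free.of_basis (basisY E n)
  exact_succ := ((isAcyclic_K k p).tot (isAcyclic_PG k q)).exact_succ
  exact_zero := ((isAcyclic_K k p).tot (isAcyclic_PG k q)).exact_zero
  surjective := ((isAcyclic_K k p).tot (isAcyclic_PG k q)).surjective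

end Smash

/-! ### Linear maps that send basis vectors to basis vectors or to zero -/

section LinearAlgebra

variable {k V W ι κ : Type*} [Field k] [AddCommGroup V] [Module k V] [AddCommGroup W] [Module k W]
  (u : Module.Basis ι k V) (w : Module.Basis κ k W) (f : V →ₗ[k] W) (e : ι → κ) (S : Set ι)

theorem ker_eq_span_of_basis (he : Set.InjOn e S) (h : ∀ t ∈ S, f (u t) = w (e t))
    (h' : ∀ t ∉ S, f (u t) = 0) : LinearMap.ker f = Submodule.span k (u '' Sᶜ) := by
  classical
  apply le_antisymm
  · intro v hv
    rw [u.mem_span_image]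
    intro t ht htS
    -- Injectivity of `e` on `S` makes the coordinate at `t` visible after applying `f`; on the
    -- kernel it must therefore vanish.
    have key : w.coord (e t) ∘ₗ f = u.coord t := by
      refine u.ext fun t' => ?_
      rw [LinearMap.comp_apply, Module.Basis.coord_apply, Module.Basis.coord_apply, u.repr_self,
        Finsupp.single_apply]
      by_cases ht' : t' ∈ S
      · rw [h t' ht', w.repr_self, Finsupp.single_apply]
        simp only [he.eq_iff ht' htS]
      · rw [h' t' ht', map_zero, if_neg (by rintro rfl; exact ht' htS)]
        rfl
    have h1 := LinearMap.congr_fun key v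
    rw [LinearMap.comp_apply, LinearMap.mem_ker.1 hv, map_zero] at h1
    exact Finsupp.mem_support_iff.1 ht h1.symm
  · rw [Submodule.span_le]
    rintro _ ⟨t, ht, rfl⟩
    exact h' t ht

theorem range_eq_span_of_basis (h : ∀ t ∈ S, f (u t) = w (e t))
    (h' : ∀ t ∉ S, f (u t) = 0) : LinearMap.range f = Submodule.span k (w '' (e '' S)) := by
  apply le_antisymm
  · rw [LinearMap.range_eq_map, ← u.span_eq, Submodule.map_span, Submodule.span_le]
    rintro _ ⟨_, ⟨t, rfl⟩, rfl⟩
    by_cases ht : t ∈ S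
    · rw [h t ht]
      exact Submodule.subset_span ⟨_, ⟨t, ht, rfl⟩, rfl⟩
    · rw [h' t ht]
      exact Submodule.zero_mem _
  · rw [Submodule.span_le]
    rintro _ ⟨_, ⟨t, ht, rfl⟩, rfl⟩
    exact ⟨u t, h t ht⟩

/-- The span of a set of basis vectors and the span of the remaining ones are complements. -/
theorem isCompl_span_image : IsCompl (Submodule.span k (u '' S)) (Submodule.span k (u '' Sᶜ)) := by
  constructor
  · exact u.linearIndependent.disjoint_span_image disjoint_compl_right
  · rw [codisjoint_iff, ← Submodule.span_union, ← Set.image_union, Set.union_compl_self,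
      Set.image_univ, u.span_eq]

end LinearAlgebra

/-! ### The differential of `Y` on its basis -/

section Differential

variable {k : Type u} [Field k] {p q : ℕ} [Fact p.Prime] [CharP k p] [Fact (p ∣ q)] [NeZero q]
  (hp : 2 < p)

theorem augK_equivariantK (h : G q) (z : K k p 0) :
    augK k p ((equivariantK k p q hp).rho 0 h z) = augK k p z := by
  set E := equivariantK k p q hp
  have hφ : E.rho 0 h (phi k p 0 0 0) = phi k p 0 0 0 := by
    rw [← g_pow_val q h, equivariantK_phi, phi_eq_zero k p 0 (0 + 1) _ (by omega), smul_zero,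
      add_zero]
  have haug : ∀ r : R k p, augR k p (Fact.out : p.Prime).ne_zero (h • r) =
      augR k p (Fact.out : p.Prime).ne_zero r := by
    intro r
    rw [← g_pow_val q h, g_pow_smul, ← AlgHom.comp_apply]
    congr 1
    apply hom_ext <;> simp [augR, sigma, lift_x, lift_y]
  refine eq_of_semilinear (N := Triv k) (basisK k p 0) id (fun z => toTriv k (augK k p (E.rho 0 h z)))
    (fun z => toTriv k (augK k p z)) ?_ ?_ ?_ ?_ ?_ z
  · intro z w; simp only [map_add]
  · intro z w; simp only [map_add]
  · intro r z; rw [E.semilinear, augK_smul, haug, id, R_smul_triv]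
  · intro r z; rw [augK_smul, id, R_smul_triv]
  · intro ij
    have h1 : ij.1.1 = 0 := by have := ij.2; omega
    have h2 : ij.1.2 = 0 := by have := ij.2; omega
    rw [basisK_apply, h1, h2]
    exact congrArg (fun z => toTriv k (augK k p z)) hφ

/-- The elements of `R # kG` that express `φ_{i,j} ⊗ g ^ s` through the basis of `Y`. -/
def twistSum (k : Type u) [Field k] (p q : ℕ) [Fact p.Prime] [CharP k p] [Fact (p ∣ q)]
    (i j : ℤ) (s : ℕ) : Bos k p q :=
  ofR k p q (∑ t ∈ Finset.range s, g q ^ t • twist k p i j) * ofG k p q (g q ^ s)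

/-- Since `g ^ s` acts diagonally, `g ^ s (φ_{i,j} ⊗ 1)` is `φ_{i,j} ⊗ g ^ s` plus a multiple of
`φ_{i+1,j-1} ⊗ g ^ s`. The excess is subtracted by means of `φ_{i+1,j-1}`, which is fixed when the
twist is nonzero. -/
theorem ofG_smul_sub_twistSum_smul (a b s : ℕ) (i j : ℤ) :
    ofG k p q (g q ^ s) • ytmul (equivariantK k p q hp) a b (phi k p a i j) (genPG k q b) -
      twistSum k p q i j s •
        ytmul (equivariantK k p q hp) a b (phi k p a (i + 1) (j - 1)) (genPG k q b) =
      ytmul (equivariantK k p q hp) a b (phi k p a i j) (ofPG k q b (g q ^ s)) := by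
  rw [twistSum, mul_smul, ofG_smul_ytmul, ofG_smul_ytmul, ofR_smul_ytmul, regG_genPG,
    equivariantK_phi]
  by_cases hi : Odd i
  · simp [twist, hi]
  · rw [equivariantK_phi_of_odd k p q hp a _ _ _ (Int.not_odd_iff_even.1 hi).add_one, map_add,
      LinearMap.add_apply, add_sub_cancel_right]

theorem ofR_one : ofR k p q 1 = 1 := rfl

theorem ofR_zero : ofR k p q 0 = 0 := SkewMonoidAlgebra.single_zero_right 1

theorem ofR_smul (c : k) (r : R k p) : ofR k p q (c • r) = c • ofR k p q r :=
  (SkewMonoidAlgebra.smul_single c 1 r).symm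

theorem coeffTwist_of_odd (i j l : ℕ) (hl : Odd l) :
    coeffTwist k p q i j l = twistSum k p q i j 1 := by
  rw [coeffTwist, twistSum, twist, if_pos hl, Finset.sum_range_one, pow_zero, one_smul, pow_one]
  simp only [Int.odd_coe_nat]
  split_ifs
  · rw [ofR_zero, zero_mul]
  · rw [ofR_one, one_mul]
  · rfl

theorem coeffTwist_of_even (i j l : ℕ) (hl : Even l) :
    coeffTwist k p q i j l = ∑ s ∈ Finset.range q, twistSum k p q i j s := by
  rw [coeffTwist, if_neg (Nat.not_odd_iff_even.2 hl)]
  simp only [twistSum, twist, Int.odd_coe_nat]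
  split_ifs
  · simp [ofR_zero]
  · refine Finset.sum_congr rfl fun s _ => ?_
    rw [sum_smul_one, ofR_smul, ofR_one, smul_mul_assoc, one_mul]
  -- The term `s = 0` has an empty inner sum, so it may be dropped.
  · rw [Finset.range_eq_Ico, Finset.sum_eq_sum_Ico_succ_bot (NeZero.pos q)]
    simp [ofR_zero]

theorem dG_genPG_of_odd (b : ℕ) (hb : Odd (b + 1)) :
    dG k q b (genPG k q (b + 1)) = ofPG k q b (g q) - genPG k q b := by
  change (if Odd (b + 1) then MonoidAlgebra.of k (G q) (g q) - 1
    else ∑ s ∈ Finset.range q, MonoidAlgebra.of k (G q) (g q ^ s)) * 1 = _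
  rw [if_pos hb, mul_one]
  rfl

theorem dG_genPG_of_even (b : ℕ) (hb : Even (b + 1)) :
    dG k q b (genPG k q (b + 1)) = ∑ s ∈ Finset.range q, ofPG k q b (g q ^ s) := by
  change (if Odd (b + 1) then MonoidAlgebra.of k (G q) (g q) - 1
    else ∑ s ∈ Finset.range q, MonoidAlgebra.of k (G q) (g q ^ s)) * 1 = _
  rw [if_neg (Nat.not_odd_iff_even.2 hb), mul_one]
  rfl

/-- The untwisted differential yields elements `φ_{i,j} ⊗ g ^ s`; expressing each through the `R #
kG`-basis produces the coefficients `c_{i,j,l}`. -/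
theorem ytmul_dG_genPG (a b i j : ℕ) :
    ytmul (equivariantK k p q hp) a b (phi k p a i j) (dG k q b (genPG k q (b + 1))) =
      coeffG k p q (b + 1) •
          ytmul (equivariantK k p q hp) a b (phi k p a i j) (genPG k q b) -
        coeffTwist k p q i j (b + 1) •
          ytmul (equivariantK k p q hp) a b (phi k p a (i + 1) (j - 1)) (genPG k q b) := by
  rcases Nat.even_or_odd (b + 1) with hb | hb
  · rw [coeffTwist_of_even i j _ hb, coeffG, if_neg (Nat.not_odd_iff_even.2 hb), Finset.sum_smul,
      Finset.sum_smul, ← Finset.sum_sub_distrib, dG_genPG_of_even b hb, map_sum]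
    exact Finset.sum_congr rfl fun s _ => (ofG_smul_sub_twistSum_smul hp a b s i j).symm
  · have h := ofG_smul_sub_twistSum_smul (k := k) (q := q) hp a b 1 i j
    rw [pow_one] at h
    rw [coeffTwist_of_odd i j _ hb, coeffG, if_pos hb, sub_smul, one_smul, dG_genPG_of_odd b hb,
      map_sub, ← h]
    abel

theorem dYB_phi3 (n i j l : ℕ) (h : i + j + l = n + 1) :
    dYB (equivariantK k p q hp) n (phi3 (equivariantK k p q hp) (n + 1) i j l) =
      (ofR k p q (coeffX k p i) • phi3 (equivariantK k p q hp) n (i - 1) j l +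
        ofR k p q (coeffY k p i j) • phi3 (equivariantK k p q hp) n i (j - 1) l) +
      (-1 : k) ^ (i + j) •
        (coeffG k p q l • phi3 (equivariantK k p q hp) n i j (l - 1) -
          coeffTwist k p q i j l • phi3 (equivariantK k p q hp) n (i + 1) (j - 1) (l - 1)) := by
  funext ab
  have hab := ab.2
  simp only [dYB_apply, Pi.add_apply, Pi.smul_apply, Pi.sub_apply, phi3_apply]
  congr 1
  · by_cases hl : ab.1.2 = l
    · subst hl
      rw [if_pos rfl, if_pos rfl, if_pos rfl, dKY_ytmul, ofR_smul_ytmul, ofR_smul_ytmul,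
        dK_phi k p hp ab.1.1 i j (by omega), map_add, LinearMap.add_apply]
    · rw [if_neg (by omega), if_neg (by omega), if_neg (by omega), map_zero, smul_zero, smul_zero,
        add_zero]
  · by_cases hl : ab.1.2 + 1 = l
    · subst hl
      rw [if_pos rfl, if_pos (by push_cast; ring), if_pos (by push_cast; ring), dGY_ytmul,
        ytmul_dG_genPG, show ab.1.1 = i + j by omega]
    · rw [if_neg (by push_cast; omega), if_neg (by omega), if_neg (by omega), map_zero, smul_zero,
        smul_zero, smul_zero, sub_zero, smul_zero]

end Differential

/-! ### The dual basis of `Hom(Y_n, k)` -/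

section Dual

variable {k : Type u} [Field k] {p q : ℕ} [Fact p.Prime] [CharP k p] [Fact (p ∣ q)]
  (E : EquivariantAction k (R k p) (G q) (K k p) (dK k p))

instance (n : ℕ) : Finite (Triples n) := Finite.of_equiv _ (sigmaPairsEquiv n)

/-- The basis `φ^*_{i,j,l}` of `Hom_{R # kG}(Y_n, k)`. -/
def dualY (n : ℕ) : Module.Basis (Triples n) k (Y E n →ₗ[Bos k p q] Triv k) :=
  Module.Basis.ofEquivFun (((basisY E n).constr k).symm.trans
    (LinearEquiv.piCongrRight fun _ => (toTriv k).symm))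

theorem dualY_basisY (n : ℕ) (t t' : Triples n) :
    dualY E n t (basisY E n t') = toTriv k (if t = t' then 1 else 0) := by
  classical
  rw [dualY, Module.Basis.coe_ofEquivFun]
  change (basisY E n).constr k (fun t' => toTriv k ((Pi.single t 1 : Triples n → k) t')) _ = _
  rw [Module.Basis.constr_basis, Pi.single_apply]
  simp only [eq_comm]

theorem phi3_eq_zero (n : ℕ) (i j l : ℤ) (h : i < 0 ∨ j < 0 ∨ l < 0) : phi3 E n i j l = 0 := by
  funext ab
  rw [phi3_apply]
  split_ifs with hl
  · rw [phi_eq_zero k p _ i j (by omega), map_zero]; rfl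
  · rfl

theorem dualY_phi3 (n : ℕ) (t : Triples n) (i j l : ℤ) (h : i + j + l = n) :
    dualY E n t (phi3 E n i j l) =
      toTriv k (if (t.1.1 : ℤ) = i ∧ (t.1.2.1 : ℤ) = j ∧ (t.1.2.2 : ℤ) = l then 1 else 0) := by
  by_cases h' : i < 0 ∨ j < 0 ∨ l < 0
  · rw [phi3_eq_zero E n i j l h', map_zero, if_neg (by omega), map_zero]
  · obtain ⟨a, rfl⟩ := Int.eq_ofNat_of_zero_le (show 0 ≤ i by omega)
    obtain ⟨b, rfl⟩ := Int.eq_ofNat_of_zero_le (show 0 ≤ j by omega)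
    obtain ⟨c, rfl⟩ := Int.eq_ofNat_of_zero_le (show 0 ≤ l by omega)
    have hn : a + b + c = n := by omega
    have h1 := basisY_apply E n ⟨(a, b, c), hn⟩
    dsimp only at h1
    rw [← h1, dualY_basisY]
    congr 1
    simp only [Nat.cast_inj, Subtype.ext_iff, Prod.ext_iff]

end Dual

/-! ### Augmentations of the coefficients of the differential -/

section Augmentation

variable {k : Type u} [Field k] {p q : ℕ} [Fact p.Prime] [CharP k p] [Fact (p ∣ q)]

theorem augBos_ofR (r : R k p) :
    augBos k p q (ofR k p q r) = augR k p (Fact.out : p.Prime).ne_zero r := augBos_single 1 r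

theorem augBos_ofG (h : G q) : augBos k p q (ofG k p q h) = 1 := by
  rw [ofG, augBos_single, map_one]

theorem augR_x : augR k p (Fact.out : p.Prime).ne_zero (x k p) = 0 := lift_x ..

theorem augR_y : augR k p (Fact.out : p.Prime).ne_zero (y k p) = 0 := lift_y ..

theorem augR_sigma (c : k) (r : R k p) : augR k p (Fact.out : p.Prime).ne_zero (sigma k p c r) =
    augR k p (Fact.out : p.Prime).ne_zero r := by
  rw [← AlgHom.comp_apply]
  congr 1
  apply hom_ext <;> simp [augR, sigma, lift_x, lift_y]

theorem augR_alpha (hp : 2 < p) : augR k p (Fact.out : p.Prime).ne_zero (alpha k p) = 0 := by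
  rw [alpha, map_add, map_neg, map_pow, augR_y, zero_pow (by omega), neg_zero, zero_add, map_sum]
  refine Finset.sum_eq_zero fun i hi => ?_
  rw [map_smul, map_mul, map_pow, augR_x, zero_pow (by have := (Finset.mem_Icc.1 hi).1; omega),
    zero_mul, smul_zero]

theorem augR_coeffX (hp : 2 < p) (i : ℕ) :
    augR k p (Fact.out : p.Prime).ne_zero (coeffX k p i) = 0 := by
  rw [coeffX]
  split_ifs
  · rw [map_pow, augR_x, zero_pow (by omega)]
  · exact augR_x

theorem augR_coeffY (hp : 2 < p) (i j : ℕ) :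
    augR k p (Fact.out : p.Prime).ne_zero (coeffY k p i j) = 0 := by
  have h : p - 1 ≠ 0 := by omega
  rw [coeffY]
  split_ifs <;> simp [augR_x, augR_y, h]

theorem cast_q_eq_zero (k : Type u) [Field k] (p q : ℕ) [CharP k p] [Fact (p ∣ q)] :
    (q : k) = 0 := (CharP.cast_eq_zero_iff k p q).2 Fact.out

theorem augBos_coeffG (l : ℕ) : augBos k p q (coeffG k p q l) = 0 := by
  rw [coeffG]
  split_ifs
  · rw [map_sub, augBos_ofG, map_one, sub_self]
  · rw [map_sum]
    simp [augBos_ofG, cast_q_eq_zero k p q]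

/-- The only coefficient that can survive in the cochain complex. The terms with `α` die because `α`
and its translates lie in the augmentation ideal, and `∑ s g ^ s` dies because the power sum of
exponent `1 < p - 1` is zero. -/
theorem augBos_coeffTwist (hp : 2 < p) (i j l : ℕ) : augBos k p q (coeffTwist k p q i j l) =
    if Even i ∧ Odd j ∧ Odd l then 1 else 0 := by
  rw [coeffTwist]
  by_cases hi : Odd i
  · rw [if_pos hi, if_neg (fun h => Nat.not_odd_iff_even.2 h.1 hi), map_zero]
  rw [if_neg hi]
  have hi' := Nat.not_odd_iff_even.1 hi
  by_cases hl : Odd l <;> by_cases hj : Odd j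
  · rw [if_pos hl, if_pos hj, if_pos ⟨hi', hj, hl⟩, augBos_ofG]
  · rw [if_pos hl, if_neg hj, if_neg (fun h => hj h.2.1), map_mul, augBos_ofR, augR_alpha hp,
      zero_mul]
  · rw [if_neg hl, if_pos hj, if_neg (fun h => hl h.2.2), map_sum]
    simp only [map_smul, augBos_ofG, smul_eq_mul, mul_one]
    simpa using sum_range_pow_eq_zero k (Fact.out : p ∣ q) 1 (by omega)
  · rw [if_neg hl, if_neg hj, if_neg (fun h => hl h.2.2), map_sum]
    refine Finset.sum_eq_zero fun s _ => ?_
    rw [map_mul, augBos_ofR, map_sum, Finset.sum_eq_zero, zero_mul]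
    intro t _
    rw [g_pow_smul, augR_sigma, augR_alpha hp]

end Augmentation

/-! ### The cochain complex in the dual basis -/

section Coboundary

/-- The coboundary shifts the index `(i, j, l)` to `(i - 1, j + 1, l + 1)`. -/
def shiftTriple {n : ℕ} (t : Triples n) : Triples (n + 1) :=
  if h : 0 < t.1.1 then ⟨(t.1.1 - 1, t.1.2.1 + 1, t.1.2.2 + 1), by
    have := t.2; dsimp only; omega⟩
  -- A filler value: the shift is used only for odd first index, where the other branch applies.
  else ⟨(n + 1, 0, 0), rfl⟩

theorem shiftTriple_val {n : ℕ} (t : Triples n) (h : Odd t.1.1) :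
    (shiftTriple t).1 = (t.1.1 - 1, t.1.2.1 + 1, t.1.2.2 + 1) := by
  rw [shiftTriple, dif_pos h.pos]

theorem shiftTriple_injOn (n : ℕ) :
    Set.InjOn (shiftTriple (n := n)) {t | Odd t.1.1 ∧ Even t.1.2.1 ∧ Even t.1.2.2} := by
  intro t ht t' ht' h
  have h1 := congrArg Subtype.val h
  rw [shiftTriple_val t ht.1, shiftTriple_val t' ht'.1] at h1
  simp only [Prod.ext_iff] at h1
  have := ht.1.pos
  have := ht'.1.pos
  refine Subtype.ext (Prod.ext ?_ (Prod.ext ?_ ?_)) <;> omega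

theorem shiftTriple_image (n : ℕ) :
    shiftTriple (n := n) '' {t | Odd t.1.1 ∧ Even t.1.2.1 ∧ Even t.1.2.2} =
      {t | Even t.1.1 ∧ Odd t.1.2.1 ∧ Odd t.1.2.2} := by
  ext t
  constructor
  · rintro ⟨t, ⟨h1, h2, h3⟩, rfl⟩
    have := h1.pos
    simp only [Set.mem_ofPred_eq, shiftTriple_val t h1]
    simp only [Nat.even_iff, Nat.odd_iff] at h1 h2 h3 ⊢
    omega
  · obtain ⟨⟨i, j, l⟩, h⟩ := t
    rintro ⟨h1, h2, h3⟩
    dsimp only at h h1 h2 h3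
    have := h2.pos
    have := h3.pos
    have ho : Odd (i + 1) := h1.add_one
    refine ⟨⟨(i + 1, j - 1, l - 1), by dsimp only; omega⟩, ⟨ho, ?_, ?_⟩, ?_⟩
    · simp only [Nat.even_iff, Nat.odd_iff] at h2 ⊢; omega
    · simp only [Nat.even_iff, Nat.odd_iff] at h3 ⊢; omega
    · refine Subtype.ext ?_
      rw [shiftTriple_val _ ho]
      refine Prod.ext ?_ (Prod.ext ?_ ?_) <;> dsimp only <;> omega

variable {k : Type u} [Field k] {p q : ℕ} [Fact p.Prime] [CharP k p] [Fact (p ∣ q)] [NeZero q]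
  (hp : 2 < p)

theorem dualY_dYB (n : ℕ) (t : Triples n) (t' : Triples (n + 1)) :
    dualY (equivariantK k p q hp) n t (dYB (equivariantK k p q hp) n
      (basisY (equivariantK k p q hp) (n + 1) t')) =
      toTriv k (if (Even t'.1.1 ∧ Odd t'.1.2.1 ∧ Odd t'.1.2.2) ∧
        t.1 = (t'.1.1 + 1, t'.1.2.1 - 1, t'.1.2.2 - 1) then 1 else 0) := by
  obtain ⟨⟨i, j, l⟩, ht'⟩ := t'
  dsimp only at ht'
  have hsum : (i : ℤ) + j + l = n + 1 := by exact_mod_cast ht'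
  rw [basisY_apply, dYB_phi3 hp n i j l ht']
  simp only [map_add, map_smul, map_sub, ← algebraMap_smul (Bos k p q) ((-1 : k) ^ (i + j))]
  rw [dualY_phi3 _ _ _ (i - 1) j l (by omega), dualY_phi3 _ _ _ i (j - 1) l (by omega),
    dualY_phi3 _ _ _ i j (l - 1) (by omega), dualY_phi3 _ _ _ (i + 1) (j - 1) (l - 1) (by omega)]
  simp only [Bos_smul_triv, augBos_ofR, augR_coeffX hp, augR_coeffY hp, augBos_coeffG,
    augBos_coeffTwist hp, zero_mul, ← map_add, ← map_sub, AlgHom.commutes]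
  congr 1
  by_cases h : Even i ∧ Odd j ∧ Odd l
  · have hij : Odd (i + j) := h.1.add_odd h.2.1
    have hj := h.2.1.pos
    have hl := h.2.2.pos
    -- Here `i + j` is odd, so the sign `(-1) ^ (i + j)` cancels the minus sign of the twist term
    -- and the value is `1`.
    rw [if_pos h, hij.neg_one_pow]
    simp only [h, true_and, and_self, Prod.ext_iff, Algebra.algebraMap_self, RingHom.id_apply]
    have hiff : ((t.1.1 : ℤ) = i + 1 ∧ (t.1.2.1 : ℤ) = j - 1 ∧ (t.1.2.2 : ℤ) = l - 1) ↔
        (t.1.1 = i + 1 ∧ t.1.2.1 = j - 1 ∧ t.1.2.2 = l - 1) := by omega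
    simp only [hiff]
    ring
  · simp [h]

theorem coboundary_dualY_of_odd (n : ℕ) (t : Triples n)
    (ht : Odd t.1.1 ∧ Even t.1.2.1 ∧ Even t.1.2.2) :
    coboundary k (S := Bos k p q) (Triv k) (dYB (equivariantK k p q hp) n)
      (dualY (equivariantK k p q hp) n t) =
      dualY (equivariantK k p q hp) (n + 1) (shiftTriple t) := by
  refine (basisY (equivariantK k p q hp) (n + 1)).ext fun t' => ?_
  change dualY (equivariantK k p q hp) n t (dYB (equivariantK k p q hp) n _) = _
  rw [dualY_dYB, dualY_basisY]
  congr 2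
  have h1 := ht.1.pos
  rw [Subtype.ext_iff, shiftTriple_val t ht.1, Prod.ext_iff, Prod.ext_iff, Prod.ext_iff,
    Prod.ext_iff]
  obtain ⟨ha, hb, hc⟩ := ht
  dsimp only
  rw [eq_iff_iff]
  simp only [Nat.even_iff, Nat.odd_iff] at ha hb hc ⊢
  omega

theorem coboundary_dualY_eq_zero (n : ℕ) (t : Triples n)
    (ht : ¬(Odd t.1.1 ∧ Even t.1.2.1 ∧ Even t.1.2.2)) :
    coboundary k (S := Bos k p q) (Triv k) (dYB (equivariantK k p q hp) n)
      (dualY (equivariantK k p q hp) n t) = 0 := by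
  refine (basisY (equivariantK k p q hp) (n + 1)).ext fun t' => ?_
  change dualY (equivariantK k p q hp) n t (dYB (equivariantK k p q hp) n _) = _
  rw [dualY_dYB, if_neg, map_zero]
  · rfl
  · rintro ⟨⟨h1, h2, h3⟩, h4⟩
    simp only [Prod.ext_iff] at h4
    simp only [Nat.even_iff, Nat.odd_iff] at ht h1 h2 h3
    omega

theorem ker_coboundary (n : ℕ) : LinearMap.ker (coboundary k (S := Bos k p q) (Triv k)
    (dYB (equivariantK k p q hp) n)) = Submodule.span k (dualY (equivariantK k p q hp) n ''
      {t | ¬(Odd t.1.1 ∧ Even t.1.2.1 ∧ Even t.1.2.2)}) :=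
  ker_eq_span_of_basis (dualY (equivariantK k p q hp) n) (dualY (equivariantK k p q hp) (n + 1)) _
    shiftTriple {t | Odd t.1.1 ∧ Even t.1.2.1 ∧ Even t.1.2.2} (shiftTriple_injOn n)
    (coboundary_dualY_of_odd hp n) (coboundary_dualY_eq_zero hp n)

theorem range_coboundary (n : ℕ) : LinearMap.range (coboundary k (S := Bos k p q) (Triv k)
    (dYB (equivariantK k p q hp) n)) = Submodule.span k (dualY (equivariantK k p q hp) (n + 1) ''
      {t | Even t.1.1 ∧ Odd t.1.2.1 ∧ Odd t.1.2.2}) := by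
  rw [← shiftTriple_image]
  exact range_eq_span_of_basis (dualY (equivariantK k p q hp) n)
    (dualY (equivariantK k p q hp) (n + 1)) _
    shiftTriple {t | Odd t.1.1 ∧ Even t.1.2.1 ∧ Even t.1.2.2}
    (coboundary_dualY_of_odd hp n) (coboundary_dualY_eq_zero hp n)

end Coboundary

/-! ### `Ext` computed from a free resolution -/

section ExtComputation

open CategoryTheory

/-- The homology of a short complex of vector spaces, through a complement of the image in the
kernel. -/
theorem nonempty_homology_equiv {k : Type u} [Field k] (S : ShortComplex (ModuleCat.{u} k))
    {V : Type*} [AddCommGroup V] [Module k V] (Φ : S.X₂ ≃ₗ[k] V) (Z B N : Submodule k V)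
    (hZ : ∀ v, S.g v = 0 ↔ Φ v ∈ Z) (hB : ∀ v, (∃ w, S.f w = v) ↔ Φ v ∈ B)
    (hBN : Disjoint B N) (hsup : B ⊔ N = Z) : Nonempty (S.homology ≃ₗ[k] N) := by
  have hNZ : N ≤ Z := hsup ▸ le_sup_right
  -- The complement `N` maps to cycles modulo boundaries; this is injective since `N` meets `B`
  -- trivially and surjective since `B` and `N` together span `Z`.
  let L : N →ₗ[k] LinearMap.ker S.g.hom ⧸ LinearMap.range S.moduleCatToCycles :=
    (LinearMap.range S.moduleCatToCycles).mkQ ∘ₗ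
      (Φ.symm.toLinearMap ∘ₗ N.subtype).codRestrict (LinearMap.ker S.g.hom) (fun v =>
        (hZ _).2 (by simpa using hNZ v.2))
  have hL : Function.Bijective L := by
    constructor
    · rw [← LinearMap.ker_eq_bot, eq_bot_iff]
      intro v hv
      rw [LinearMap.mem_ker, LinearMap.comp_apply, Submodule.mkQ_apply,
        Submodule.Quotient.mk_eq_zero] at hv
      obtain ⟨w, hw⟩ := hv
      have h1 : Φ (Φ.symm v) ∈ B := (hB _).1 ⟨w, congrArg Subtype.val hw⟩
      rw [LinearEquiv.apply_symm_apply] at h1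
      exact Subtype.ext ((Submodule.disjoint_def.1 hBN) v h1 v.2)
    · intro c
      obtain ⟨⟨z, hz⟩, rfl⟩ := Submodule.mkQ_surjective _ c
      have h1 : Φ z ∈ B ⊔ N := hsup ▸ (hZ z).1 hz
      obtain ⟨b, hb, n, hn, hbn⟩ := Submodule.mem_sup.1 h1
      refine ⟨⟨n, hn⟩, ?_⟩
      rw [LinearMap.comp_apply, ← sub_eq_zero, ← map_sub, Submodule.mkQ_apply,
        Submodule.Quotient.mk_eq_zero]
      obtain ⟨w, hw⟩ := (hB (-Φ.symm b)).2 (by simpa using B.neg_mem hb)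
      refine ⟨w, Subtype.ext ?_⟩
      change S.f w = Φ.symm n - z
      rw [hw, ← Φ.symm_apply_apply z, ← hbn, map_add]
      abel
  exact ⟨S.moduleCatHomologyIso.toLinearEquiv ≪≫ₗ (LinearEquiv.ofBijective L hL).symm⟩

variable {k : Type u} [Field k] {S : Type u} [Ring S] {M : Type u} [AddCommGroup M]
  [Module S M] {Y : ℕ → Type u} [∀ n, AddCommGroup (Y n)] [∀ n, Module S (Y n)]
  {d : ∀ n, Y (n + 1) →ₗ[S] Y n} {ε : Y 0 →ₗ[S] M}

namespace IsFreeResolution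

/-- The chain complex of a free resolution. -/
def chainComplex (h : IsFreeResolution S Y d ε) : ChainComplex (ModuleCat.{u} S) ℕ :=
  ChainComplex.of (fun n => ModuleCat.of S (Y n)) (fun n => ModuleCat.ofHom (d n)) fun n => by
    rw [← ModuleCat.ofHom_comp, (h.exact_succ n).linearMap_comp_eq_zero]
    rfl

theorem chainComplex_d (h : IsFreeResolution S Y d ε) (n : ℕ) :
    h.chainComplex.d (n + 1) n = ModuleCat.ofHom (d n) :=
  ChainComplex.of_d (fun n => ModuleCat.of S (Y n)) (fun n => ModuleCat.ofHom (d n)) n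

/-- The augmentation of a free resolution as a map of chain complexes. -/
def π (h : IsFreeResolution S Y d ε) :
    h.chainComplex ⟶ (ChainComplex.single₀ (ModuleCat.{u} S)).obj (ModuleCat.of S M) :=
  (h.chainComplex.toSingle₀Equiv _).symm ⟨ModuleCat.ofHom ε, by
    have h0 : h.chainComplex.d 1 0 = ModuleCat.ofHom (d 0) := h.chainComplex_d 0
    rw [h0]
    change ModuleCat.ofHom (d 0) ≫ ModuleCat.ofHom ε = 0
    rw [← ModuleCat.ofHom_comp, h.exact_zero.linearMap_comp_eq_zero]
    rfl⟩

theorem π_f_zero (h : IsFreeResolution S Y d ε) : h.π.f 0 = ModuleCat.ofHom ε :=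
  ChainComplex.toSingle₀Equiv_symm_apply_f_zero _ _

/-- In degree zero the condition amounts to exactness at `Y 0` and surjectivity of `ε`; in positive
degrees the target has no homology, and exactness of `Y` is what is needed. -/
theorem quasiIso_π (h : IsFreeResolution S Y d ε) : QuasiIso h.π where
  quasiIsoAt m := by
    cases m with
    | zero =>
      rw [ChainComplex.quasiIsoAt₀_iff, ShortComplex.quasiIso_iff_of_zeros' _ ?_ ?_ ?_]
      · constructor
        · rw [ShortComplex.moduleCat_exact_iff]
          intro v hv
          change Y 0 at v
          have hv' : ε v = 0 := by
            have h1 := congrArg (fun f => f.hom v) h.π_f_zero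
            exact h1.symm.trans hv
          obtain ⟨w, hw⟩ := (h.exact_zero v).1 hv'
          refine ⟨w, ?_⟩
          have h1 := congrArg (fun f => f.hom w) (h.chainComplex_d 0)
          exact h1.trans hw
        · rw [ModuleCat.epi_iff_surjective]
          intro c
          obtain ⟨v, hv⟩ := h.surjective c
          refine ⟨v, ?_⟩
          have h1 := congrArg (fun f => f.hom v) h.π_f_zero
          exact h1.trans hv
      · exact h.chainComplex.shape _ _ (by simp)
      · rfl
      · rfl
    | succ m =>
      rw [quasiIsoAt_iff_exactAt' (hL := ChainComplex.exactAt_succ_single_obj ..),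
        HomologicalComplex.exactAt_iff' _ (m + 2) (m + 1) m (by simp) (by simp),
        ShortComplex.moduleCat_exact_iff]
      intro v hv
      change Y (m + 1) at v
      have hv' : d m v = 0 := by
        have h1 := congrArg (fun f => f.hom v) (h.chainComplex_d m)
        exact h1.symm.trans hv
      obtain ⟨w, hw⟩ := (h.exact_succ m v).1 hv'
      refine ⟨w, ?_⟩
      have h1 := congrArg (fun f => f.hom w) (h.chainComplex_d (m + 1))
      exact h1.trans hw

/-- A free resolution is a projective resolution. -/
def projectiveResolution (h : IsFreeResolution S Y d ε) :
    ProjectiveResolution (ModuleCat.of S M) where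
  complex := h.chainComplex
  projective n := by
    have := h.free n
    exact ModuleCat.projective_of_free (Module.Free.chooseBasis S (Y n))
  π := h.π
  quasiIso := h.quasiIso_π

variable [Algebra k S] {T : Type u} [AddCommGroup T] [Module S T] [Module k T]
  [SMulCommClass S k T] [IsScalarTower k S T]

/-- The cochains of `Hom(Y, T)` as linear maps. -/
def homEquiv (h : IsFreeResolution S Y d ε) (n : ℕ) :
    (h.chainComplex.linearYonedaObj k (ModuleCat.of S T)).X n ≃ₗ[k] (Y n →ₗ[S] T) where
  toFun f := ModuleCat.Hom.hom (A := ModuleCat.of S (Y n)) (B := ModuleCat.of S T) f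
  invFun f := ModuleCat.ofHom f
  left_inv _ := rfl
  right_inv _ := rfl
  map_add' _ _ := rfl
  -- Scalars act on morphisms through the algebra map into `S` and on linear maps through the
  -- `k`-structure of `T`; the scalar tower identifies the two.
  map_smul' c f := by
    ext v
    exact algebraMap_smul S c (ModuleCat.Hom.hom (A := ModuleCat.of S (Y n))
      (B := ModuleCat.of S T) f v)

theorem homEquiv_d (h : IsFreeResolution S Y d ε) (n : ℕ)
    (f : (h.chainComplex.linearYonedaObj k (ModuleCat.of S T)).X n) :
    h.homEquiv (n + 1) ((h.chainComplex.linearYonedaObj k (ModuleCat.of S T)).d n (n + 1) f) =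
      coboundary k T (d n) (h.homEquiv n f) := by
  have h1 := congrArg (fun g : ModuleCat.of S (Y (n + 1)) ⟶ ModuleCat.of S (Y n) =>
    ModuleCat.Hom.hom (A := ModuleCat.of S (Y (n + 1)))
      (B := ModuleCat.of S T) (g ≫ (f : ModuleCat.of S (Y n) ⟶ ModuleCat.of S T)))
    (h.chainComplex_d n)
  exact h1

theorem d_eq_zero_iff (h : IsFreeResolution S Y d ε) (n : ℕ)
    (f : (h.chainComplex.linearYonedaObj k (ModuleCat.of S T)).X n) :
    (h.chainComplex.linearYonedaObj k (ModuleCat.of S T)).d n (n + 1) f = 0 ↔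
      h.homEquiv n f ∈ LinearMap.ker (coboundary k T (d n)) := by
  rw [LinearMap.mem_ker, ← h.homEquiv_d n, LinearEquiv.map_eq_zero_iff]

theorem exists_d_eq_iff (h : IsFreeResolution S Y d ε) (n : ℕ)
    (f : (h.chainComplex.linearYonedaObj k (ModuleCat.of S T)).X (n + 1)) :
    (∃ w, (h.chainComplex.linearYonedaObj k (ModuleCat.of S T)).d n (n + 1) w = f) ↔
      h.homEquiv (n + 1) f ∈ LinearMap.range (coboundary k T (d n)) := by
  constructor
  · rintro ⟨w, rfl⟩
    exact ⟨h.homEquiv n w, (h.homEquiv_d n w).symm⟩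
  · rintro ⟨w, hw⟩
    refine ⟨(h.homEquiv n).symm w, (h.homEquiv (n + 1)).injective ?_⟩
    rw [← hw, h.homEquiv_d, LinearEquiv.apply_symm_apply]

/-- Index `0` has no predecessor in the cochain complex, so the short complex at degree zero uses
`0` again, with the zero map as incoming differential. The space of coboundaries is then zero. -/
theorem exists_d_zero_zero_eq_iff (h : IsFreeResolution S Y d ε)
    (f : (h.chainComplex.linearYonedaObj k (ModuleCat.of S T)).X 0) :
    (∃ w, (h.chainComplex.linearYonedaObj k (ModuleCat.of S T)).d 0 0 w = f) ↔
      h.homEquiv 0 f ∈ (⊥ : Submodule k (Y 0 →ₗ[S] T)) := by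
  rw [Submodule.mem_bot, LinearEquiv.map_eq_zero_iff,
    (h.chainComplex.linearYonedaObj k (ModuleCat.of S T)).shape 0 0 (by simp)]
  constructor
  · rintro ⟨w, rfl⟩
    rfl
  · rintro rfl
    exact ⟨0, rfl⟩

/-- `Ext` through a complement of the coboundaries in the cocycles, in positive degree. -/
theorem nonempty_ext_succ_equiv (h : IsFreeResolution S Y d ε) (n : ℕ)
    (N : Submodule k (Y (n + 1) →ₗ[S] T))
    (hd : Disjoint (LinearMap.range (coboundary k T (d n))) N)
    (hs : LinearMap.range (coboundary k T (d n)) ⊔ N =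
      LinearMap.ker (coboundary k T (d (n + 1)))) :
    Nonempty (((Ext k (ModuleCat.{u} S) (n + 1)).obj (Opposite.op (ModuleCat.of S M))).obj
      (ModuleCat.of S T) ≃ₗ[k] N) := by
  let C := h.chainComplex.linearYonedaObj k (ModuleCat.of S T)
  obtain ⟨e⟩ := nonempty_homology_equiv (C.sc' n (n + 1) (n + 2)) (h.homEquiv (n + 1)) _ _ N
    (h.d_eq_zero_iff (n + 1)) (h.exists_d_eq_iff n) hd hs
  exact ⟨(h.projectiveResolution.isoExt (n + 1) (ModuleCat.of S T)).toLinearEquiv ≪≫ₗ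
    (ShortComplex.homologyMapIso (C.isoSc' n (n + 1) (n + 2) (by simp) (by simp))).toLinearEquiv
      ≪≫ₗ e⟩

/-- `Ext` in degree zero is the space of cocycles. -/
theorem nonempty_ext_zero_equiv (h : IsFreeResolution S Y d ε) :
    Nonempty (((Ext k (ModuleCat.{u} S) 0).obj (Opposite.op (ModuleCat.of S M))).obj
      (ModuleCat.of S T) ≃ₗ[k] LinearMap.ker (coboundary k T (d 0))) := by
  let C := h.chainComplex.linearYonedaObj k (ModuleCat.of S T)
  obtain ⟨e⟩ := nonempty_homology_equiv (C.sc' 0 0 1) (h.homEquiv 0) _ _ _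
    (h.d_eq_zero_iff 0) h.exists_d_zero_zero_eq_iff disjoint_bot_left (bot_sup_eq _)
  exact ⟨(h.projectiveResolution.isoExt 0 (ModuleCat.of S T)).toLinearEquiv ≪≫ₗ
    (ShortComplex.homologyMapIso (C.isoSc' 0 0 1 (by simp) (by simp))).toLinearEquiv ≪≫ₗ e⟩

end IsFreeResolution

end ExtComputation

/-! ### The cohomology of `R # kG` -/

section Cohomology

variable {k : Type u} [Field k] {p q : ℕ} [Fact p.Prime] [CharP k p] [Fact (p ∣ q)]

instance : IsScalarTower k (Bos k p q) (Triv k) where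
  smul_assoc c s t := by
    change augBos k p q (c • s) • t = c • augBos k p q s • t
    rw [map_smul, smul_assoc]

/-- One odd and two even indices have an odd sum, so in even degree no basis cochain has a nonzero
coboundary. -/
theorem setOf_not_odd_even_even_of_even {n : ℕ} (hn : Even n) :
    {t : Triples n | ¬(Odd t.1.1 ∧ Even t.1.2.1 ∧ Even t.1.2.2)} = Set.univ := by
  refine Set.eq_univ_of_forall fun t => ?_
  have := t.2
  simp only [Nat.even_iff, Nat.odd_iff, Set.mem_ofPred_eq] at hn ⊢
  omega

theorem setOf_even_odd_odd_of_odd {n : ℕ} (hn : Odd n) :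
    {t : Triples n | Even t.1.1 ∧ Odd t.1.2.1 ∧ Odd t.1.2.2} = ∅ := by
  refine Set.eq_empty_of_forall_notMem fun t => ?_
  have := t.2
  simp only [Nat.even_iff, Nat.odd_iff, Set.mem_ofPred_eq] at hn ⊢
  omega

variable [NeZero q] (hp : 2 < p)

theorem nonempty_cohomology_equiv_of_even (n : ℕ) (hn : Even n) :
    Nonempty (H k p q n ≃ₗ[k] Submodule.span k (dualY (equivariantK k p q hp) n ''
      {t | ¬(Even t.1.1 ∧ Odd t.1.2.1 ∧ Odd t.1.2.2)})) := by
  have hY := isFreeResolution_Y (equivariantK k p q hp) (augK_equivariantK hp)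
  have hker : LinearMap.ker (coboundary k (S := Bos k p q) (Triv k)
      (dYB (equivariantK k p q hp) n)) = ⊤ := by
    rw [ker_coboundary, setOf_not_odd_even_even_of_even hn, Set.image_univ,
      Module.Basis.span_eq]
  cases n with
  | zero =>
    -- In degree zero nothing is excluded, since an odd index is positive.
    have hset : {t : Triples 0 | ¬(Even t.1.1 ∧ Odd t.1.2.1 ∧ Odd t.1.2.2)} = Set.univ := by
      refine Set.eq_univ_of_forall fun t ht => ?_
      have := t.2
      have := ht.2.1.pos
      omega
    rw [hset, Set.image_univ, Module.Basis.span_eq, ← hker]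
    exact hY.nonempty_ext_zero_equiv
  | succ n =>
    -- Every cochain is a cocycle here, so the basis vectors outside the coboundaries span a
    -- complement that represents the cohomology.
    have hc := isCompl_span_image (dualY (equivariantK k p q hp) (n + 1))
      {t | Even t.1.1 ∧ Odd t.1.2.1 ∧ Odd t.1.2.2}
    rw [← range_coboundary hp n] at hc
    exact hY.nonempty_ext_succ_equiv n _ hc.disjoint (hc.sup_eq_top.trans hker.symm)

theorem nonempty_cohomology_equiv_of_odd (n : ℕ) (hn : Odd n) :
    Nonempty (H k p q n ≃ₗ[k] Submodule.span k (dualY (equivariantK k p q hp) n ''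
      {t | ¬(Odd t.1.1 ∧ Even t.1.2.1 ∧ Even t.1.2.2)})) := by
  have hY := isFreeResolution_Y (equivariantK k p q hp) (augK_equivariantK hp)
  obtain ⟨n, rfl⟩ := Nat.exists_eq_succ_of_ne_zero hn.pos.ne'
  -- One even and two odd indices have an even sum, so nothing is hit in odd degree and the
  -- cohomology is the whole space of cocycles.
  have hrange : LinearMap.range (coboundary k (S := Bos k p q) (Triv k)
      (dYB (equivariantK k p q hp) n)) = ⊥ := by
    rw [range_coboundary, setOf_even_odd_odd_of_odd hn,
      Set.image_empty, Submodule.span_empty]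
  rw [← ker_coboundary hp (n + 1)]
  refine hY.nonempty_ext_succ_equiv n _ ?_ ?_
  · rw [hrange]; exact disjoint_bot_left
  · rw [hrange]; exact bot_sup_eq _

end Cohomology

/-! ### Closed formulas for the action of powers of `g` on the `φ_{i,j}` -/

section Action

variable (k : Type u) [Field k] (p q : ℕ) [Fact p.Prime] [CharP k p] [Fact (p ∣ q)]
  [NeZero q] (hp : 2 < p)

theorem sum_inv_smul_one (s : ℕ) :
    ∑ t ∈ Finset.Icc 1 s, (g q ^ t)⁻¹ • (1 : R k p) = (s : k) • 1 := by
  simp [Nat.cast_smul_eq_nsmul]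

theorem equivariantK_phi_of_even_of_odd (n i j s : ℕ) (hi : Even i) (hj : Odd j) :
    (equivariantK k p q hp).rho n (g q ^ s) (phi k p n i j) =
        phi k p n i j + (s : k) • phi k p n (i + 1) (j - 1) ∧
      (equivariantK k p q hp).rho n (g q ^ s)⁻¹ (phi k p n i j) =
        phi k p n i j - (s : k) • phi k p n (i + 1) (j - 1) := by
  have h : twist k p i j = 1 := by
    rw [twist, if_neg (by simpa using hi), if_pos (by simpa using hj)]
  rw [equivariantK_phi, equivariantK_inv_phi, h, sum_smul_one, sum_inv_smul_one, smul_assoc,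
    one_smul]
  exact ⟨rfl, rfl⟩

theorem equivariantK_phi_of_even_of_even (n i j s : ℕ) (hi : Even i) (hj : Even j) :
    (equivariantK k p q hp).rho n (g q ^ s) (phi k p n i j) =
        phi k p n i j +
          (∑ t ∈ Finset.range s, g q ^ t • alpha k p) • phi k p n (i + 1) (j - 1) ∧
      (equivariantK k p q hp).rho n (g q ^ s)⁻¹ (phi k p n i j) =
        phi k p n i j -
          (∑ t ∈ Finset.Icc 1 s, (g q ^ t)⁻¹ • alpha k p) • phi k p n (i + 1) (j - 1) := by
  have h : twist k p i j = alpha k p := by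
    rw [twist, if_neg (by simpa using hi), if_neg (by simpa using hj)]
  rw [equivariantK_phi, equivariantK_inv_phi, h]
  exact ⟨rfl, rfl⟩

end Action

end JordanBosonization
end

open JordanBosonization

theorem mainTheorem4 {k : Type u} [Field k] (p q : ℕ) [Fact p.Prime] [CharP k p] (hp : 2 < p)
    [NeZero q] [Fact (p ∣ q)] :
    -- `R` is the twisted tensor product of `k[x]/(x^p)` and `k[y]/(y^p)`, and how `G` acts on it
    (∃ b : Module.Basis (Fin p × Fin p) k (R k p),
      ∀ ij, b ij = x k p ^ (ij.1 : ℕ) * y k p ^ (ij.2 : ℕ)) ∧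
    (∀ r l : ℕ, y k p ^ r * x k p ^ l = ∑ t ∈ Finset.range (r + 1),
      ((r.choose t : k) * (2⁻¹ : k) ^ t * (l.ascFactorial t : k)) •
        (x k p ^ (l + t) * y k p ^ (r - t))) ∧
    g q • x k p = x k p ∧ g q • y k p = x k p + y k p ∧
    -- the `R`-module structure of `P_i(A) ⊗ P_j(B)` is the one given by the twisting map `τ_i`
    (∀ i j l r m s : ℕ,
      (x k p ^ l * y k p ^ r) • (xPow k p i m ⊗ₜ[k] yPow k p j s) =
        ∑ t ∈ Finset.range (r + 1),
          ((r.choose t : k) * (2⁻¹ : k) ^ t * ((m + i % 2).ascFactorial t : k)) •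
            (xPow k p i (l + (m + t)) ⊗ₜ[k] yPow k p j (r - t + s))) ∧
    -- `K` is a free resolution of `k` over `R` with the stated bases and differentials
    (∃ (d : ∀ n, K k p (n + 1) →ₗ[R k p] K k p n) (ε : K k p 0 →ₗ[R k p] Triv k),
      (∀ n z, d n z = dK k p n z) ∧ (∀ z, ε z = toTriv k (augK k p z)) ∧
      IsFreeResolution (R k p) (K k p) d ε) ∧
    (∀ n, ∃ b : Module.Basis (Pairs n) (R k p) (K k p n),
      ∀ ij, b ij = phi k p n ij.1.1 ij.1.2) ∧
    (∀ n i j : ℕ, i + j = n + 1 →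
      dK k p n (phi k p (n + 1) i j) =
        coeffX k p i • phi k p n (i - 1) j + coeffY k p i j • phi k p n i (j - 1)) ∧
    -- `K` is `G`-equivariant
    ∃ E : EquivariantAction k (R k p) (G q) (K k p) (dK k p),
      (∀ n i j s : ℕ, i + j = n → Odd i →
        E.rho n (g q ^ s) (phi k p n i j) = phi k p n i j ∧
        E.rho n (g q ^ s)⁻¹ (phi k p n i j) = phi k p n i j) ∧
      (∀ n i j s : ℕ, i + j = n → Even i → Odd j →
        E.rho n (g q ^ s) (phi k p n i j) =
          phi k p n i j + (s : k) • phi k p n (i + 1) (j - 1) ∧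
        E.rho n (g q ^ s)⁻¹ (phi k p n i j) =
          phi k p n i j - (s : k) • phi k p n (i + 1) (j - 1)) ∧
      (∀ n i j s : ℕ, i + j = n → Even i → Even j →
        E.rho n (g q ^ s) (phi k p n i j) =
          phi k p n i j +
            (∑ t ∈ Finset.range s, g q ^ t • alpha k p) • phi k p n (i + 1) (j - 1) ∧
        E.rho n (g q ^ s)⁻¹ (phi k p n i j) =
          phi k p n i j -
            (∑ t ∈ Finset.Icc 1 s, (g q ^ t)⁻¹ • alpha k p) • phi k p n (i + 1) (j - 1)) ∧
      -- `Y` is a free resolution of `k` over `R # kG` with the stated bases and differentials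
      ∃ (d : ∀ n, Y E (n + 1) →ₗ[Bos k p q] Y E n) (ε : Y E 0 →ₗ[Bos k p q] Triv k),
        (∀ n z, d n z = dY E n z) ∧ (∀ z, ε z = toTriv k (augY E z)) ∧
        IsFreeResolution (Bos k p q) (Y E) d ε ∧
        (∀ n, ∃ b : Module.Basis (Triples n) (Bos k p q) (Y E n),
          ∀ t, b t = phi3 E n t.1.1 t.1.2.1 t.1.2.2) ∧
        (∀ n i j l : ℕ, i + j + l = n + 1 →
          d n (phi3 E (n + 1) i j l) =
            (ofR k p q (coeffX k p i) • phi3 E n (i - 1) j l +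
              ofR k p q (coeffY k p i j) • phi3 E n i (j - 1) l) +
            (-1 : k) ^ (i + j) •
              (coeffG k p q l • phi3 E n i j (l - 1) -
                coeffTwist k p q i j l • phi3 E n (i + 1) (j - 1) (l - 1))) ∧
        -- the dual bases, the cochain complex and the cohomology
        ∃ φ : ∀ n, Module.Basis (Triples n) k (Y E n →ₗ[Bos k p q] Triv k),
          (∀ n (t t' : Triples n),
            φ n t (phi3 E n t'.1.1 t'.1.2.1 t'.1.2.2) = toTriv k (if t = t' then 1 else 0)) ∧
          (∀ n (t : Triples n), Odd t.1.1 → Even t.1.2.1 → Even t.1.2.2 →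
            ∃ t' : Triples (n + 1), t'.1 = (t.1.1 - 1, t.1.2.1 + 1, t.1.2.2 + 1) ∧
              coboundary k (S := Bos k p q) (Triv k) (d n) (φ n t) = φ (n + 1) t') ∧
          (∀ n (t : Triples n), ¬(Odd t.1.1 ∧ Even t.1.2.1 ∧ Even t.1.2.2) →
            coboundary k (S := Bos k p q) (Triv k) (d n) (φ n t) = 0) ∧
          (∀ n, LinearMap.ker (coboundary k (S := Bos k p q) (Triv k) (d n)) =
            Submodule.span k (φ n '' {t | ¬(Odd t.1.1 ∧ Even t.1.2.1 ∧ Even t.1.2.2)})) ∧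
          (∀ n, LinearMap.range (coboundary k (S := Bos k p q) (Triv k) (d n)) =
            Submodule.span k (φ (n + 1) '' {t | Even t.1.1 ∧ Odd t.1.2.1 ∧ Odd t.1.2.2})) ∧
          (∀ n, Even n → Nonempty (H k p q n ≃ₗ[k]
            Submodule.span k (φ n '' {t | ¬(Even t.1.1 ∧ Odd t.1.2.1 ∧ Odd t.1.2.2)}))) ∧
          (∀ n, Odd n → Nonempty (H k p q n ≃ₗ[k]
            Submodule.span k (φ n '' {t | ¬(Odd t.1.1 ∧ Even t.1.2.1 ∧ Even t.1.2.2)}))) := by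
  refine ⟨⟨monomialBasis k p, monomialBasis_apply k p⟩, y_pow_mul_x_pow k p,
    by rw [g_smul, sigma_x], by rw [g_smul, sigma_y, one_smul, add_comm],
    x_pow_mul_y_pow_smul k p,
    ⟨dKR k p, augKR k p, fun _ _ => rfl, fun _ => rfl, isFreeResolution_K k p⟩,
    fun n => ⟨basisK k p n, basisK_apply k p n⟩, dK_phi k p hp, equivariantK k p q hp,
    fun n i j s _ hi => ⟨?_, ?_⟩,
    fun n i j s _ hi hj => equivariantK_phi_of_even_of_odd k p q hp n i j s hi hj,
    fun n i j s _ hi hj => equivariantK_phi_of_even_of_even k p q hp n i j s hi hj,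
    dYB _, augYB _ (augK_equivariantK hp), dYB_eq _, fun _ => rfl,
    isFreeResolution_Y _ (augK_equivariantK hp), fun n => ⟨basisY _ n, basisY_apply _ n⟩,
    dYB_phi3 hp, dualY _, ?_, ?_, coboundary_dualY_eq_zero hp, ker_coboundary hp,
    range_coboundary hp, nonempty_cohomology_equiv_of_even hp,
    nonempty_cohomology_equiv_of_odd hp⟩
  · exact equivariantK_phi_of_odd k p q hp n _ i j (by exact_mod_cast hi)
  · exact equivariantK_phi_of_odd k p q hp n _ i j (by exact_mod_cast hi)
  · intro n t t'
    rw [← basisY_apply, dualY_basisY]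
  · exact fun n t h1 h2 h3 => ⟨shiftTriple t, shiftTriple_val t h1,
      coboundary_dualY_of_odd hp n t ⟨h1, h2, h3⟩⟩
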